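/- **Setting.** Let $S$ be a complex manifold of dimension $r$ and $\pi\colon X\to S$ a family of $d$-dimensional complex tori: $X$ is a ($\sigma$-compact, Hausdorff) complex manifold, $\pi$ is a proper holomorphic submersion with a holomorphic section $e$, and every fibre $X_s$ is a complex torus. Let $\Lambda$ be the local system with stalks $\Lambda_s=H_1(X_s,\mathbb Z)$, a lattice in $\mathrm{Lie}(X_s)=T_{e(s)}X_s=\Lambda_s\otimes\mathbb R$, and let $\mathcal H=\Lambda\otimes\mathbb C\otimes C^\infty_S$, with Hodge decomposition $\mathcal H=\mathcal H^{-1,0}\oplus\mathcal H^{0,-1}$ ($\mathcal H^{-1,0}$, resp. $\mathcal H^{0,-1}$, is the $i$-, resp. $(-i)$-eigenspace of the complex structure of $\mathrm{Lie}(X_s)$ on $\Lambda_s\otimes\mathbb C$). Let the family be polarized, i.e. let a locally constant family of alternating pairings $\langle\cdot,\cdot\rangle=2\pi i\,E_s\colon\Lambda_s\times\Lambda_s\to2\pi i\,\mathbb Z$ be given with $E_s(iv,iw)=E_s(v,w)$ and $E_s(iv,v)>0$ for $0\ne v\in\mathrm{Lie}(X_s)$. **Definition of $g$.** Let $U\subset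 S$ be a connected open subset over which $\Lambda$ and the bundle $\mathrm{Lie}(X/S)$ are trivial, $s_0\in U$, $X_U=\pi^{-1}(U)$. Identify $\Lambda|_U$ with the constant local system $\Lambda_{s_0}$; the fibrewise exponential map induces a diffeomorphism $\varphi\colon U\times(\Lambda_{s_0}\otimes\mathbb R)/\Lambda_{s_0}\to X_U$ and hence a splitting $TX_U=\pi^*TU\oplus(\Lambda_{s_0}\otimes\mathbb R)$. Through it, sections of $\mathcal H$ over $U$ define complex vertical vector fields on $X_U$, and $\langle\cdot,\cdot\rangle$ defines a $2$-form on $X_U$, denoted $2\omega$. Put $\Lambda'_{s_0}=\{\lambda\in\Lambda_{s_0}\otimes\mathbb C:\langle\lambda,\mu\rangle\in2\pi i\mathbb Z\ \ \forall\mu\in\Lambda_{s_0}\}$, $\kappa=[\Lambda'_{s_0}:\Lambda_{s_0}]$, and $\chi_\lambda(x)=\exp\langle\lambda,\mathrm{pr}_2\varphi^{-1}(x)\rangle$ for $\lambda\in\Lambda'_{s_0}$; let $\lambda=\lambda^{-1,0}+\lambda^{0,-1}$ be the Hodge decomposition, a decomposition into sections of $\mathcal H$ over $U$. Writing $i_v$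 for contraction with, and $[v]$ for Lie derivative along, a vector field $v$, put for $a,b\ge1$ $$g_{a,b}=\sum_{\lambda\in\Lambda'_{s_0}\setminus\{0\}}\chi_\lambda\,(\lambda^{0,-1})^{a-1}(\lambda^{-1,0})^{b-1}\sum_{k=0}^{2d}\frac{(-1)^d\,(a+b+k-1)!}{(a+b-1)!\,k!\,d!\,\kappa}\;\frac{i_{\lambda^{-1,0}}\,i_{\lambda^{0,-1}}\,[\lambda^{-1,0}]^k\,\omega^d}{\langle\lambda^{-1,0},\lambda^{0,-1}\rangle^{a+b+k}},$$ a series of $C^\infty$ $(2d-2)$-forms on $X_U$ with values in $\mathrm{Sym}^{a+b-2}\pi^*\mathcal H$, regarded as a series of currents. The polylogarithmic current is $$g=\sum_{n\ge2}\ \sum_{\substack{a,b\ge1\\a+b=n}}(-1)^a g_{a,b},$$ a $(2d-2)$-current with values in $\prod_{k\ge0}\mathrm{Sym}^k\pi^*\mathcal H$ (for general $S$ it is glued from these local currents, since the sets $U$ cover $S$). **Proposition.** For every such $U$, the series $g_{a,b}$ converge as currents on $X_U$ (they are summable on every smooth test form with compact support in $X_U$), and the restriction of $g$ to $X_U\setminus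 e(U)$ is a smooth current: there is a $C^\infty$ differential form $\gamma$ of degree $2d-2$ on $X_U\setminus e(U)$ with values in $\prod_k\mathrm{Sym}^k\pi^*\mathcal H$ such that $g(\eta)=\int\gamma\wedge\eta$ for every smooth form $\eta$ of degree $2r+2$ with compact support in $X_U\setminus e(U)$. Consequently the restriction of $g$ to $X^\infty\setminus e(S^\infty)$ is smooth. -/

import Mathlib

open scoped Manifold ContDiff

noncomputable section

namespace Polylog

/-! ### Exterior algebra -/

section Algebra

variable {E : Type*} [NormedAddCommGroup E] [NormedSpace ℝ E]

/-- The product `(v₀, …, v_{p+q-1}) ↦ α(v₀, …, v_{p-1}) β(v_p, …, v_{p+q-1})`. -/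
def altMul {p q : ℕ} (α : E [⋀^Fin p]→L[ℝ] ℂ) (β : E [⋀^Fin q]→L[ℝ] ℂ) :
    ContinuousMultilinearMap ℝ (fun _ : Fin (p + q) => E) ℂ where
  toMultilinearMap :=
    ((LinearMap.mul' ℝ ℂ).compMultilinearMap
      (MultilinearMap.domCoprod α.toMultilinearMap β.toMultilinearMap)).domDomCongr finSumFinEquiv
  cont := by
    change Continuous fun v : Fin (p + q) → E =>
      α (fun i => v (finSumFinEquiv (Sum.inl i))) * β (fun i => v (finSumFinEquiv (Sum.inr i)))
    exact (α.cont.comp (by fun_prop)).mul (β.cont.comp (by fun_prop))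

/-- The wedge product: `(α ∧ β)(v) = (p! q!)⁻¹ ∑_σ sgn σ · α(v_{σ0}, …) β(v_{σp}, …)`. -/
def wedge {p q : ℕ} (α : E [⋀^Fin p]→L[ℝ] ℂ) (β : E [⋀^Fin q]→L[ℝ] ℂ) :
    E [⋀^Fin (p + q)]→L[ℝ] ℂ :=
  ((p.factorial * q.factorial : ℝ)⁻¹) •
    ContinuousMultilinearMap.alternatization (altMul α β)

/-- The wedge powers `α ∧ ⋯ ∧ α` of an alternating 2-form. -/
def wedgePow (α : E [⋀^Fin 2]→L[ℝ] ℂ) : (k : ℕ) → E [⋀^Fin (2 * k)]→L[ℝ] ℂ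
  | 0 => (ContinuousAlternatingMap.constOfIsEmpty ℝ E (Fin 0) (1 : ℂ) :)
  | k + 1 => wedge (wedgePow α k) α

/-- Contraction of a complex valued `(p+1)`-form with the complex tangent vector `v.1 + i v.2`. -/
def contractSucc {p : ℕ} (v : E × E) (α : E [⋀^Fin (p + 1)]→L[ℝ] ℂ) : E [⋀^Fin p]→L[ℝ] ℂ :=
  α.curryLeft v.1 + Complex.I • α.curryLeft v.2

/-- Contraction of a complex valued `p`-form with the complex tangent vector `v.1 + i v.2`
(zero on `0`-forms). -/
def contract (v : E × E) : {p : ℕ} → (E [⋀^Fin p]→L[ℝ] ℂ) → E [⋀^Fin (p - 1)]→L[ℝ] ℂ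
  | 0, _ => 0
  | _ + 1, α => contractSucc v α

end Algebra

/-! ### Differential forms and currents on the real manifold underlying a complex manifold

As everywhere in Mathlib, the tangent space at a point `x` of a manifold modelled on `Fin n → ℂ`
is the model space (through the preferred chart at `x`). It is used as a real vector space. -/

section Forms

/-- Complex valued differential `p`-forms, without regularity, on the real manifold underlying the
`n`-dimensional complex manifold `M`. -/
abbrev DForm (n p : ℕ) (M : Type*) : Type _ := M → (Fin n → ℂ) [⋀^Fin p]→L[ℝ] ℂ

variable {n p : ℕ} {M : Type*} [TopologicalSpace M] [ChartedSpace (Fin n → ℂ) M]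

/-- The expression `(e⁻¹)^* α` of a form in a chart `e`. -/
def inChart (e : OpenPartialHomeomorph M (Fin n → ℂ)) (α : DForm n p M) :
    DForm n p (Fin n → ℂ) := fun y =>
  (α (e.symm y)).compContinuousLinearMap
    (mfderiv 𝓘(ℝ, Fin n → ℂ) 𝓘(ℝ, Fin n → ℂ) e.symm y : (Fin n → ℂ) →L[ℝ] (Fin n → ℂ))

/-- `α` is a `C^∞` differential form on the open set `W`. -/
def SmoothFormOn (α : DForm n p M) (W : Set M) : Prop :=
  ∀ e ∈ atlas (Fin n → ℂ) M, ContDiffOn ℝ ∞ (inChart e α) (e.target ∩ e.symm ⁻¹' W)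

/-- Exterior derivative. -/
def extD (α : DForm n p M) : DForm n (p + 1) M := fun x =>
  extDeriv (inChart (chartAt (Fin n → ℂ) x) α) (chartAt (Fin n → ℂ) x x)

/-- Lie derivative along the complex vector field `Z.1 + i Z.2`,
given by Cartan's formula `L_Z = d i_Z + i_Z d`. -/
def lieD (Z : M → (Fin n → ℂ) × (Fin n → ℂ)) : {p : ℕ} → DForm n p M → DForm n p M
  | 0, α => fun x => contractSucc (Z x) (extD α x)
  | _ + 1, α => fun x =>
      extD (fun y => contractSucc (Z y) (α y)) x + contractSucc (Z x) (extD α x)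

/-- The oriented real basis `(e₁, i e₁, e₂, i e₂, …)` of `ℂ^n`. -/
def stdFrame (n : ℕ) (k : Fin (2 * n)) : Fin n → ℂ :=
  Pi.single ⟨k / 2, by omega⟩ (if (k : ℕ) % 2 = 0 then 1 else Complex.I)

/-- The real manifold underlying a complex manifold is smooth. -/
theorem isManifold_real [IsManifold 𝓘(ℂ, Fin n → ℂ) ω M] :
    IsManifold 𝓘(ℝ, Fin n → ℂ) ∞ M := by
  refine isManifold_of_contDiffOn _ _ _ fun e e' he he' => ?_
  have h := (contDiffGroupoid ω 𝓘(ℂ, Fin n → ℂ)).compatible he he'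
  rw [contDiffGroupoid, mem_groupoid_of_pregroupoid] at h
  exact (h.1.restrict_scalars ℝ).of_le le_top

section Integral

variable [IsManifold 𝓘(ℂ, Fin n → ℂ) ω M] [T2Space M] [SigmaCompactSpace M]

variable (n M) in
/-- A smooth partition of unity subordinate to the domains of the preferred charts. -/
def chartPartition : SmoothPartitionOfUnity M 𝓘(ℝ, Fin n → ℂ) M Set.univ :=
  haveI : IsManifold 𝓘(ℝ, Fin n → ℂ) ∞ M := isManifold_real
  (SmoothPartitionOfUnity.exists_isSubordinate_chartAt_source 𝓘(ℝ, Fin n → ℂ) M).choose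

/-- The integral `∫_M α` of a compactly supported form of top degree `m = 2n`
over `M` with its canonical orientation. -/
def formIntegral {m : ℕ} (hm : m = 2 * n) (α : DForm n m M) : ℂ :=
  ∑ᶠ i : M, ∫ y in (chartAt (Fin n → ℂ) i).target,
    (chartPartition n M i ((chartAt (Fin n → ℂ) i).symm y) : ℂ) *
      inChart (chartAt (Fin n → ℂ) i) α y fun j => stdFrame n (Fin.cast hm j)

/-- The value `∫_M α ∧ η` at the test form `η` of the current defined by the form `α`. -/
def formCurrent (hp : p ≤ 2 * n) (α : DForm n p M) (η : DForm n (2 * n - p) M) : ℂ :=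
  formIntegral (by omega) fun x => wedge (α x) (η x)

/-- Test forms on the open set `W`: smooth forms with compact support contained in `W`. -/
def IsTestForm (W : Set M) (η : DForm n p M) : Prop :=
  SmoothFormOn η Set.univ ∧ HasCompactSupport η ∧ tsupport η ⊆ W

/-- The restriction of the `p`-current `T` to the open set `W` is smooth: it is given there by a
`C^∞` differential form `γ`. -/
def IsSmoothCurrentOn (hp : p ≤ 2 * n) (T : DForm n (2 * n - p) M → ℂ) (W : Set M) : Prop :=
  ∃ γ : DForm n p M, SmoothFormOn γ W ∧ ∀ η, IsTestForm W η → T η = formCurrent hp γ η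

end Integral

end Forms

/-! ### Polarized families of complex tori -/

section Families

variable (r d : ℕ) (S X : Type*) [TopologicalSpace S] [ChartedSpace (Fin r → ℂ) S]
  [TopologicalSpace X] [ChartedSpace (Fin (r + d) → ℂ) X]

/-- A family of `d`-dimensional complex tori over the complex manifold `S`: a proper holomorphic
submersion `X → S` with a holomorphic section, all of whose fibres are complex tori `ℂ^d / L`. -/
structure TorusFamily where
  proj : X → S
  zero : S → X
  proj_holo : ContMDiff 𝓘(ℂ, Fin (r + d) → ℂ) 𝓘(ℂ, Fin r → ℂ) ω proj
  proj_proper : IsProperMap proj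
  proj_submersion : ∀ x, Function.Surjective
    (mfderiv 𝓘(ℂ, Fin (r + d) → ℂ) 𝓘(ℂ, Fin r → ℂ) proj x)
  zero_holo : ContMDiff 𝓘(ℂ, Fin r → ℂ) 𝓘(ℂ, Fin (r + d) → ℂ) ω zero
  proj_zero : ∀ s, proj (zero s) = s
  fibre_torus : ∀ s, ∃ (L : Submodule ℤ (Fin d → ℂ)) (q : (Fin d → ℂ) → X),
    DiscreteTopology L ∧ Submodule.span ℝ (L : Set (Fin d → ℂ)) = ⊤ ∧
    ContMDiff 𝓘(ℂ, Fin d → ℂ) 𝓘(ℂ, Fin (r + d) → ℂ) ω q ∧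
    (∀ v, Function.Injective (mfderiv 𝓘(ℂ, Fin d → ℂ) 𝓘(ℂ, Fin (r + d) → ℂ) q v)) ∧
    Set.range q = proj ⁻¹' {s} ∧ ∀ v w, q v = q w ↔ v - w ∈ L

variable {r d S X}

/-- The Lie algebra of the fibre `X_s`: the vertical tangent space of `X` at `zero s`. -/
def TorusFamily.Lie (𝒳 : TorusFamily r d S X) (s : S) : Submodule ℂ (Fin (r + d) → ℂ) :=
  let D : (Fin (r + d) → ℂ) →L[ℂ] (Fin r → ℂ) :=
    mfderiv 𝓘(ℂ, Fin (r + d) → ℂ) 𝓘(ℂ, Fin r → ℂ) 𝒳.proj (𝒳.zero s)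
  LinearMap.ker D.toLinearMap

/-- The fibrewise exponential sequence `0 → Λ → Lie(X/S) → X → 0` over a connected open set `U`
with base point, together with frames of `Lie(X/S)` and of the local system `Λ` over `U`:
`unif s : ℂ^d → X_s` is the exponential map, and `period j`, `j < 2d`, is the frame of `Λ`. -/
structure PeriodFrame (𝒳 : TorusFamily r d S X) where
  U : Set S
  isOpen_U : IsOpen U
  isPreconnected_U : IsPreconnected U
  s₀ : S
  s₀_mem : s₀ ∈ U
  unif : S → (Fin d → ℂ) → X
  unif_holo : ContMDiffOn (𝓘(ℂ, Fin r → ℂ).prod 𝓘(ℂ, Fin d → ℂ)) 𝓘(ℂ, Fin (r + d) → ℂ) ω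
    (fun q : S × (Fin d → ℂ) => unif q.1 q.2) (U ×ˢ Set.univ)
  unif_etale : ∀ s ∈ U, ∀ v, Function.Bijective
    (mfderiv (𝓘(ℂ, Fin r → ℂ).prod 𝓘(ℂ, Fin d → ℂ)) 𝓘(ℂ, Fin (r + d) → ℂ)
      (fun q : S × (Fin d → ℂ) => unif q.1 q.2) (s, v))
  unif_zero : ∀ s ∈ U, unif s 0 = 𝒳.zero s
  range_unif : ∀ s ∈ U, Set.range (unif s) = 𝒳.proj ⁻¹' {s}
  period : Fin (2 * d) → S → (Fin d → ℂ)
  period_holo : ∀ j, ContMDiffOn 𝓘(ℂ, Fin r → ℂ) 𝓘(ℂ, Fin d → ℂ) ω (period j) U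
  period_indep : ∀ s ∈ U, LinearIndependent ℝ fun j => period j s
  unif_eq_iff : ∀ s ∈ U, ∀ v w,
    unif s v = unif s w ↔ v - w ∈ Submodule.span ℤ (Set.range fun j => period j s)

namespace PeriodFrame

variable {𝒳 : TorusFamily r d S X} (F : PeriodFrame 𝒳)

theorem proj_unif {s : S} (hs : s ∈ F.U) (v : Fin d → ℂ) : 𝒳.proj (F.unif s v) = s := by
  have h : F.unif s v ∈ 𝒳.proj ⁻¹' {s} := F.range_unif s hs ▸ Set.mem_range_self v
  exact h

/-- The derivative at `0` of `unif s`, a linear isomorphism `ℂ^d → Lie(X_s)`. -/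
def lieMap (s : S) (hs : s ∈ F.U) : (Fin d → ℂ) →ₗ[ℂ] 𝒳.Lie s :=
  let D : (Fin d → ℂ) →L[ℂ] (Fin (r + d) → ℂ) :=
    mfderiv 𝓘(ℂ, Fin d → ℂ) 𝓘(ℂ, Fin (r + d) → ℂ) (F.unif s) 0
  LinearMap.codRestrict (𝒳.Lie s) D.toLinearMap
    (by
      intro v
      have hq : MDifferentiableAt 𝓘(ℂ, Fin d → ℂ) 𝓘(ℂ, Fin (r + d) → ℂ) (F.unif s) 0 := by
        have h1 : MDifferentiableAt (𝓘(ℂ, Fin r → ℂ).prod 𝓘(ℂ, Fin d → ℂ)) 𝓘(ℂ, Fin (r + d) → ℂ)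
            (fun q : S × (Fin d → ℂ) => F.unif q.1 q.2) (s, 0) :=
          (F.unif_holo.contMDiffAt ((F.isOpen_U.prod isOpen_univ).mem_nhds
            ⟨hs, trivial⟩)).mdifferentiableAt (by simp)
        have h2 : MDifferentiableAt 𝓘(ℂ, Fin d → ℂ) (𝓘(ℂ, Fin r → ℂ).prod 𝓘(ℂ, Fin d → ℂ))
            (fun v : Fin d → ℂ => (s, v)) 0 :=
          mdifferentiableAt_const.prodMk mdifferentiableAt_id
        exact h1.comp (0 : Fin d → ℂ) h2
      have hp : MDifferentiableAt 𝓘(ℂ, Fin (r + d) → ℂ) 𝓘(ℂ, Fin r → ℂ) 𝒳.proj (F.unif s 0) :=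
        𝒳.proj_holo.contMDiffAt.mdifferentiableAt (by simp)
      have hc := mfderiv_comp (0 : Fin d → ℂ) hp hq
      have he : 𝒳.proj ∘ F.unif s = fun _ => s := funext fun w => F.proj_unif hs w
      rw [he, mfderiv_const, F.unif_zero s hs] at hc
      exact (congrArg (fun f => f v) hc).symm)

end PeriodFrame

/-- A polarization of the family: a locally constant family of integral alternating forms on the
lattices `Λ_s = H₁(X_s, ℤ)`, each satisfying Riemann's bilinear relations. The forms are given by
their real bilinear extensions to `Lie(X_s) = Λ_s ⊗ ℝ`. -/
structure Polarization (𝒳 : TorusFamily r d S X) where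
  form : ∀ s, 𝒳.Lie s →ₗ[ℝ] 𝒳.Lie s →ₗ[ℝ] ℝ
  alternating : ∀ s v, form s v v = 0
  type_one_one : ∀ s v w, form s (Complex.I • v) (Complex.I • w) = form s v w
  positive : ∀ s v, v ≠ 0 → 0 < form s (Complex.I • v) v
  integral : ∀ (F : PeriodFrame 𝒳) (j k : Fin (2 * d)), ∃ m : ℤ, ∀ s (hs : s ∈ F.U),
    form s (F.lieMap s hs (F.period j s)) (F.lieMap s hs (F.period k s)) = m

/-! ### The polylogarithmic current

Over `U` the local system `Λ` is identified through the frame with `Λ_{s₀} = ℤ^{2d}`, so that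
`Λ_{s₀} ⊗ ℝ = ℝ^{2d}` and `Λ_{s₀} ⊗ ℂ = ℂ^{2d}`. -/

namespace PeriodFrame

variable {𝒳 : TorusFamily r d S X} (F : PeriodFrame 𝒳) (pol : Polarization 𝒳)

/-- The isomorphism `Λ_{s₀} ⊗ ℝ = ℝ^{2d} → ℂ^d = Lie(X_s)` given by the periods. -/
def per (s : S) : (Fin (2 * d) → ℝ) →L[ℝ] (Fin d → ℂ) :=
  ∑ j, (ContinuousLinearMap.proj (R := ℝ) (φ := fun _ : Fin (2 * d) => ℝ) j).smulRight
    (F.period j s)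

/-- The real coordinate map `(s, u) ↦ φ(s, u)`, inducing the `C^∞`-trivialisation
`φ : U × (ℝ^{2d} / ℤ^{2d}) ≃ X_U`. -/
def triv (q : S × (Fin (2 * d) → ℝ)) : X := F.unif q.1 (F.per q.1 q.2)

/-- A lift `u ∈ ℝ^{2d}` of the second component of `φ⁻¹(x)`. -/
def coord (x : X) : Fin (2 * d) → ℝ :=
  Function.invFun (fun u => F.triv (𝒳.proj x, u)) x

/-- The tangent map of `φ` at `φ⁻¹(x)`, from `T_s S ⊕ ℝ^{2d}` to `T_x X`. -/
def trivD (x : X) : ((Fin r → ℂ) × (Fin (2 * d) → ℝ)) →L[ℝ] (Fin (r + d) → ℂ) :=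
  mfderiv (𝓘(ℝ, Fin r → ℂ).prod 𝓘(ℝ, Fin (2 * d) → ℝ)) 𝓘(ℝ, Fin (r + d) → ℂ) F.triv
    (𝒳.proj x, F.coord x)

/-- The projection `T_x X → ℝ^{2d}` given by the decomposition `T X_U = T U ⊕ ℝ^{2d}`. -/
def vertProj (x : X) : (Fin (r + d) → ℂ) →L[ℝ] (Fin (2 * d) → ℝ) :=
  (ContinuousLinearMap.snd ℝ (Fin r → ℂ) (Fin (2 * d) → ℝ)).comp (F.trivD x).inverse

/-- The complex vertical vector field (real part, imaginary part) on `X_U` attached to a section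
`w` of `Λ ⊗ ℂ ⊗ C^∞` over `U`. -/
def vertField (w : S → Fin (2 * d) → ℂ) (x : X) : (Fin (r + d) → ℂ) × (Fin (r + d) → ℂ) :=
  (F.trivD x (0, fun j => (w (𝒳.proj x) j).re), F.trivD x (0, fun j => (w (𝒳.proj x) j).im))

/-- The pairing `⟨x, y⟩` on `Λ_{s₀} ⊗ ℂ = ℂ^{2d}` with `⟨Λ_{s₀}, Λ_{s₀}⟩ ⊆ 2πiℤ`
defined by the polarization. -/
def pair (x y : Fin (2 * d) → ℂ) : ℂ :=
  ∑ j, ∑ k, x j * y k * (2 * Real.pi * Complex.I *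
    (pol.form F.s₀ (F.lieMap F.s₀ F.s₀_mem (F.period j F.s₀))
      (F.lieMap F.s₀ F.s₀_mem (F.period k F.s₀)) : ℝ))

variable (d) in
/-- The lattice `Λ_{s₀} = ℤ^{2d}` in `Λ_{s₀} ⊗ ℂ = ℂ^{2d}`. -/
def lattice : AddSubgroup (Fin (2 * d) → ℂ) :=
  ((Int.castAddHom ℂ).compLeft (Fin (2 * d))).range

/-- The `2πi`-dual `Λ'_{s₀}` of `Λ_{s₀}`. -/
def dualLattice : AddSubgroup (Fin (2 * d) → ℂ) where
  carrier := {x | ∀ y ∈ lattice d, ∃ m : ℤ, F.pair pol x y = 2 * Real.pi * Complex.I * m}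
  zero_mem' := fun y _ => ⟨0, by simp [pair]⟩
  add_mem' := by
    intro a b ha hb y hy
    obtain ⟨m, hm⟩ := ha y hy
    obtain ⟨m', hm'⟩ := hb y hy
    refine ⟨m + m', ?_⟩
    have : F.pair pol (a + b) y = F.pair pol a y + F.pair pol b y := by
      simp only [pair, Pi.add_apply, add_mul, Finset.sum_add_distrib]
    rw [this, hm, hm']
    push_cast
    ring
  neg_mem' := by
    intro a ha y hy
    obtain ⟨m, hm⟩ := ha y hy
    refine ⟨-m, ?_⟩
    have : F.pair pol (-a) y = -F.pair pol a y := by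
      simp only [pair, Pi.neg_apply, neg_mul, Finset.sum_neg_distrib]
    rw [this, hm]
    push_cast
    ring

/-- The index `κ = [Λ'_{s₀} : Λ_{s₀}]`. -/
def kappa : ℕ := (lattice d).relIndex (F.dualLattice pol)

/-- The character `χ_λ = exp⟨λ, pr₂ ∘ φ⁻¹⟩` on `X_U`. -/
def chi (l : Fin (2 * d) → ℂ) (x : X) : ℂ :=
  Complex.exp (F.pair pol l fun j => (F.coord x j : ℂ))

/-- The complex structure of `Lie(X_s)` transported to `ℝ^{2d}` and extended to `ℂ^{2d}`. -/
def cpx (s : S) (l : Fin (2 * d) → ℂ) : Fin (2 * d) → ℂ := fun j =>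
  ((F.per s).inverse (Complex.I • F.per s fun k => (l k).re) j : ℂ) +
    Complex.I * ((F.per s).inverse (Complex.I • F.per s fun k => (l k).im) j : ℂ)

/-- The component `λ^{-1,0}` in the Hodge decomposition of `Λ ⊗ ℂ = H₁(X_s, ℂ)` at `s`:
the eigenspace of the complex structure for the eigenvalue `i`. -/
def hodgeA (l : Fin (2 * d) → ℂ) (s : S) : Fin (2 * d) → ℂ :=
  (1 / 2 : ℂ) • (l - Complex.I • F.cpx s l)

/-- The component `λ^{0,-1}` in the Hodge decomposition of `Λ ⊗ ℂ = H₁(X_s, ℂ)` at `s`: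
the eigenspace of the complex structure for the eigenvalue `-i`. -/
def hodgeB (l : Fin (2 * d) → ℂ) (s : S) : Fin (2 * d) → ℂ :=
  (1 / 2 : ℂ) • (l + Complex.I • F.cpx s l)

theorem pair_self (x : Fin (2 * d) → ℂ) : F.pair pol x x = 0 := by
  have hanti : ∀ v w, pol.form F.s₀ v w = -pol.form F.s₀ w v := by
    intro v w
    have h := pol.alternating F.s₀ (v + w)
    simp only [map_add, LinearMap.add_apply, pol.alternating] at h
    linarith
  have h : F.pair pol x x = -F.pair pol x x := by
    conv_lhs => rw [pair, Finset.sum_comm]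
    rw [pair, ← Finset.sum_neg_distrib]
    refine Finset.sum_congr rfl fun j _ => ?_
    rw [← Finset.sum_neg_distrib]
    refine Finset.sum_congr rfl fun k _ => ?_
    rw [hanti]
    push_cast
    ring
  exact self_eq_neg.mp h

/-- The alternating 2-form `(x, y) ↦ ⟨x, y⟩` on `Λ_{s₀} ⊗ ℝ = ℝ^{2d}`. -/
def pairForm : (Fin (2 * d) → ℝ) [⋀^Fin 2]→L[ℝ] ℂ where
  toFun v := F.pair pol (fun j => (v 0 j : ℂ)) (fun j => (v 1 j : ℂ))
  map_update_add' := by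
    intro _ v i a b
    fin_cases i
    · simp only [Fin.zero_eta, Function.update_self, pair, Pi.add_apply, Complex.ofReal_add,
        add_mul, Finset.sum_add_distrib, Function.update_of_ne (one_ne_zero : (1 : Fin 2) ≠ 0)]
    · simp only [Fin.mk_one, Function.update_self, pair, Pi.add_apply, Complex.ofReal_add,
        mul_add, add_mul, Finset.sum_add_distrib,
        Function.update_of_ne (zero_ne_one : (0 : Fin 2) ≠ 1)]
  map_update_smul' := by
    intro _ v i c a
    fin_cases i
    · simp only [Fin.zero_eta, Function.update_self, pair, Pi.smul_apply, smul_eq_mul,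
        Complex.ofReal_mul, Function.update_of_ne (one_ne_zero : (1 : Fin 2) ≠ 0),
        Complex.real_smul, Finset.mul_sum, mul_assoc]
    · simp only [Fin.mk_one, Function.update_self, pair, Pi.smul_apply, smul_eq_mul,
        Complex.ofReal_mul, Function.update_of_ne (zero_ne_one : (0 : Fin 2) ≠ 1),
        Complex.real_smul, Finset.mul_sum, mul_assoc, mul_left_comm]
  cont := by
    change Continuous fun v : Fin 2 → Fin (2 * d) → ℝ =>
      F.pair pol (fun j => (v 0 j : ℂ)) (fun j => (v 1 j : ℂ))
    simp only [pair]
    fun_prop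
  map_eq_zero_of_eq' := by
    intro v i j h hij
    have h01 : v 0 = v 1 := by
      fin_cases i <;> fin_cases j <;> simp_all
    change F.pair pol (fun j => (v 0 j : ℂ)) (fun j => (v 1 j : ℂ)) = 0
    rw [h01, pair_self]

/-- The 2-form `ω` on `X_U` representing the polarization: `2ω` is the 2-form which corresponds
to the pairing under `T X_U = T U ⊕ ℝ^{2d}`. -/
def omega : DForm (r + d) 2 X := fun x =>
  (1 / 2 : ℂ) • (F.pairForm pol).compContinuousLinearMap (F.vertProj x)

/-- The element of `Sym¹(Λ_{s₀} ⊗ ℂ)` attached to `w ∈ ℂ^{2d}`; the symmetric algebra of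
`Λ_{s₀} ⊗ ℂ = ℂ^{2d}` is the polynomial ring in the `2d` basis vectors. -/
def symOne (w : Fin (2 * d) → ℂ) : MvPolynomial (Fin (2 * d)) ℂ :=
  ∑ j, MvPolynomial.C (w j) * MvPolynomial.X j

/-- The coefficient of the monomial `m` in the term of index `λ` of `g_{a,b}`, a form of degree
`2d - 2` on `X_U`. The operator `(⟨λ^{-1,0}, λ^{0,-1}⟩ - [λ^{-1,0}])^{-(a+b)}` applied to `ω^d` is
expanded in powers of the Lie derivative `[λ^{-1,0}]`, whose `k`-th power vanishes on `ω^d` for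
`k > 2d`. -/
def term (a b : ℕ) (m : Fin (2 * d) →₀ ℕ) (l : Fin (2 * d) → ℂ) :
    DForm (r + d) (2 * d - 1 - 1) X := fun x =>
  let s := 𝒳.proj x
  let A := F.hodgeA l
  let B := F.hodgeB l
  (F.chi pol l x * (symOne (B s) ^ (a - 1) * symOne (A s) ^ (b - 1)).coeff m) •
    ∑ k ∈ Finset.range (2 * d + 1),
      ((-1) ^ d * ((a + b + k - 1).factorial : ℂ) /
          ((a + b - 1).factorial * k.factorial * d.factorial * F.kappa pol) /
          F.pair pol (A s) (B s) ^ (a + b + k)) •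
        contract (F.vertField A x) (contract (F.vertField B x)
          ((lieD (F.vertField A))^[k] (fun y => wedgePow (F.omega pol y) d) x))

/-- The index set `Λ'_{s₀} ∖ {0}`. -/
abbrev Index : Type := {l : Fin (2 * d) → ℂ // l ∈ F.dualLattice pol ∧ l ≠ 0}

variable [IsManifold 𝓘(ℂ, Fin (r + d) → ℂ) ω X] [T2Space X] [SigmaCompactSpace X]

/-- The terms of `g_{a,b}` (coefficient of the monomial `m`), as currents of degree `2d - 2`. -/
def termCurrent (a b : ℕ) (m : Fin (2 * d) →₀ ℕ) (l : Fin (2 * d) → ℂ)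
    (η : DForm (r + d) (2 * (r + d) - (2 * d - 1 - 1)) X) : ℂ :=
  formCurrent (by omega) (F.term pol a b m l) η

/-- The polylogarithmic current `g = ∑_{n ≥ 2} ∑_{a + b = n, a, b ≥ 1} (-1)^a g_{a,b}` on `X_U`,
`g_{a,b}` having values in `Sym^{a+b-2}`. A current with values in `∏_k Sym^k(Λ_{s₀} ⊗ ℂ)` is the
family, indexed by the monomials `m`, of its coefficients; only `a + b - 2 = |m|` contributes to
the coefficient of `m`. -/
def polylogCurrent (m : Fin (2 * d) →₀ ℕ)
    (η : DForm (r + d) (2 * (r + d) - (2 * d - 1 - 1)) X) : ℂ :=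
  ∑ p ∈ Finset.HasAntidiagonal.antidiagonal m.degree, (-1) ^ (p.1 + 1) *
    ∑' l : F.Index pol, F.termCurrent pol (p.1 + 1) (p.2 + 1) m l η

end PeriodFrame

end Families

end Polylog

set_option linter.unusedSectionVars false

/-! In the real coordinates `(s, u)` on `U × ℝ^{2d}` the dual lattice becomes `ℤ^{2d}` and the
character of index `n` becomes `exp(2πi n·u)`. The remaining factor of a term is the value at `ξ =
n` of a function smooth in `ξ ≠ 0` and in the point `w`, a finite sum of pieces homogeneous in `ξ`
of degrees `-(a+b+k)`. Its denominators are powers of `π E(Jλ, λ)`, positive by the polarization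
(`pair_hodgeA_hodgeB`, `isHomog_symbolTerm`). So `g_{a,b}` is a Fourier series `∑ χ_n g_n` along the
fibres whose coefficients behave like a symbol.

Convergence as a current is an oscillation argument: against a compactly supported smooth kernel,
integration by parts along the fibres yields decay faster than any power of `n`
(`exists_norm_pow_mul_integral_char_mul_le`).

For smoothness, let `W(u) = ∑_j (2 - 2 cos 2πu_j)`. It vanishes exactly at lattice points, that is,
on the zero section. Summation by parts turns multiplication of the series by `W^N` into the `N`-th
power of the discrete Laplacian acting on the coefficients in `n`. This gains `2N` orders of decay:
a difference of a homogeneous function is controlled by a derivative, which is homogeneous of one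
degree less, while derivatives in `w` preserve the degree (`IsHomog.decaysOn_iteratedFDeriv_lap`).
Hence `W^N` times the series is `C^k` once `N` is large compared with `k`. Off the zero section one
divides by `W^N`; the quotient `regSum` does not depend on `N` (`IsSymbol.regSum_add`), so it is
`C^k` for every `k`, and it represents the current (`IsSymbol.tsum_integral_eq`).

The rest is transport between `X` and these coordinates. `exists_formCurrent_eq` writes integration
against a fixed test form as a finite sum of integrals over coordinate domains, with kernels that do
not depend on the form being integrated; the same kernels therefore serve every term of the series
and its regularised sum. -/

namespace Polylog

open MeasureTheory

/-! ### The discrete Laplacian -/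

section Laplacian

variable {R R' M M' : Type*} [Ring R] [Ring R'] {m : ℕ} [AddCommGroup M] [AddCommGroup M']

/-- The (positive) discrete Laplacian of a function on `R^m`. -/
def lap (g : (Fin m → R) → M) (x : Fin m → R) : M :=
  ∑ j, ((g x - g (x + Pi.single j 1)) + (g x - g (x - Pi.single j 1)))

/-- A ring map sends unit steps to unit steps. For `ℤ → ℝ` this lets the Laplacian of a sampled
symbol be estimated on `ℝ^m`, where derivatives are available. -/
theorem lap_comp_castHom (φ : R →+* R') (g : (Fin m → R') → M) :
    lap (fun x : Fin m → R => g (φ ∘ x)) = fun x => lap g (φ ∘ x) := by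
  have h1 : ∀ (x : Fin m → R) j, φ ∘ (x + Pi.single j 1) = φ ∘ x + Pi.single j 1 := by
    intro x j
    ext i
    by_cases h : i = j
    · subst h; simp
    · simp [h]
  have h2 : ∀ (x : Fin m → R) j, φ ∘ (x - Pi.single j 1) = φ ∘ x - Pi.single j 1 := by
    intro x j
    ext i
    by_cases h : i = j
    · subst h; simp
    · simp [h]
  funext x
  simp only [lap, h1, h2]

theorem iterate_lap_comp_castHom (φ : R →+* R') (g : (Fin m → R') → M) (N : ℕ) :
    lap^[N] (fun x : Fin m → R => g (φ ∘ x)) = fun x => lap^[N] g (φ ∘ x) := by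
  induction N with
  | zero => rfl
  | succ N ih => rw [Function.iterate_succ_apply', ih, lap_comp_castHom,
      Function.iterate_succ_apply']

theorem map_lap (φ : M →+ M') (g : (Fin m → R) → M) :
    lap (fun x => φ (g x)) = fun x => φ (lap g x) := by
  funext x
  simp [lap, map_sum]

theorem map_iterate_lap (φ : M →+ M') (g : (Fin m → R) → M) (N : ℕ) :
    lap^[N] (fun x => φ (g x)) = fun x => φ (lap^[N] g x) := by
  induction N with
  | zero => rfl
  | succ N ih => rw [Function.iterate_succ_apply', ih, map_lap, Function.iterate_succ_apply']

theorem iterate_lap_apply {E : Type*} (g : (Fin m → R) → E → M) (N : ℕ) (x : Fin m → R) (w : E) :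
    lap^[N] g x w = lap^[N] (fun x => g x w) x :=
  (congrFun (map_iterate_lap (Pi.evalAddMonoidHom (fun _ : E => M) w) g N) x).symm

theorem lap_add (f g : (Fin m → R) → M) : lap (f + g) = lap f + lap g := by
  funext x
  simp only [lap, Pi.add_apply, ← Finset.sum_add_distrib]
  exact Finset.sum_congr rfl fun j _ => by abel

theorem iterate_lap_add (f g : (Fin m → R) → M) (N : ℕ) :
    lap^[N] (f + g) = lap^[N] f + lap^[N] g := by
  induction N with
  | zero => rfl
  | succ N ih => simp only [Function.iterate_succ_apply', ih, lap_add]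

/-- Iterated differences in the directions `vs`. -/
def diffs (vs : List (Fin m → R)) (g : (Fin m → R) → M) : (Fin m → R) → M :=
  vs.foldr fwdDiff g

theorem diffs_cons (v : Fin m → R) (vs : List (Fin m → R)) (g : (Fin m → R) → M) (x : Fin m → R) :
    diffs (v :: vs) g x = diffs vs g (x + v) - diffs vs g x := rfl

theorem diffs_append (vs vs' : List (Fin m → R)) (g : (Fin m → R) → M) :
    diffs (vs ++ vs') g = diffs vs (diffs vs' g) := List.foldr_append

theorem map_diffs (φ : M →+ M') (vs : List (Fin m → R)) (g : (Fin m → R) → M) (x : Fin m → R) :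
    diffs vs (fun x => φ (g x)) x = φ (diffs vs g x) := by
  induction vs generalizing x with
  | nil => rfl
  | cons v vs ih => simp only [diffs_cons, ih, map_sub]

theorem diffs_sum {ι : Type*} (s : Finset ι) (vs : List (Fin m → R)) (g : ι → (Fin m → R) → M)
    (x : Fin m → R) : diffs vs (fun x => ∑ i ∈ s, g i x) x = ∑ i ∈ s, diffs vs (g i) x := by
  induction vs generalizing x with
  | nil => rfl
  | cons v vs ih => simp only [diffs_cons, ih, Finset.sum_sub_distrib]

/-- The second difference with steps `e_j` and `-e_j` is `2g(x) - g(x + e_j) - g(x - e_j)`, sign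
included. Decay of Laplacians thereby reduces to decay of iterated first differences. -/
theorem diffs_lap (vs : List (Fin m → R)) (g : (Fin m → R) → M) (x : Fin m → R) :
    diffs vs (lap g) x =
      ∑ j, diffs (vs ++ [Pi.single j 1, -Pi.single j 1]) g x := by
  have h : lap g = fun x => ∑ j, diffs [Pi.single j 1, -Pi.single j 1] g x := by
    funext x
    refine Finset.sum_congr rfl fun j _ => ?_
    change _ = (g (x + Pi.single j 1 + -Pi.single j 1) - g (x + Pi.single j 1)) -
      (g (x + -Pi.single j 1) - g x)
    rw [add_neg_cancel_right, ← sub_eq_add_neg]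
    abel
  rw [h, diffs_sum]
  simp only [diffs_append]

end Laplacian

/-! ### Homogeneous symbols -/

section Symbols


variable {m : ℕ} {E G : Type} [NormedAddCommGroup E] [NormedSpace ℝ E]
  [NormedAddCommGroup G] [NormedSpace ℝ G]

/-- `h` is smooth on `(ℝ^m ∖ 0) × O` and homogeneous of degree `-q` in the first variable. -/
def IsHomog (O : Set E) (q : ℕ) (h : (Fin m → ℝ) → E → G) : Prop :=
  ContDiffOn ℝ ∞ (fun p : (Fin m → ℝ) × E => h p.1 p.2) ({0}ᶜ ×ˢ O) ∧
    ∀ t : ℝ, 0 < t → ∀ ξ, ξ ≠ 0 → ∀ w ∈ O, t ^ q • h (t • ξ) w = h ξ w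

/-- `h` is `O(‖ξ‖^{-p})` for `ξ → ∞`, uniformly on `K`. -/
def DecaysOn (K : Set E) (p : ℕ) (h : (Fin m → ℝ) → E → G) : Prop :=
  ∃ C R : ℝ, ∀ ξ, R ≤ ‖ξ‖ → ∀ w ∈ K, ‖h ξ w‖ ≤ C * ‖ξ‖⁻¹ ^ p

theorem DecaysOn.sum {ι : Type*} {K : Set E} {p : ℕ} (s : Finset ι)
    {h : ι → (Fin m → ℝ) → E → G} (hh : ∀ i ∈ s, DecaysOn K p (h i)) :
    DecaysOn K p fun ξ w => ∑ i ∈ s, h i ξ w := by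
  classical
  induction s using Finset.induction_on with
  | empty => exact ⟨0, 0, fun ξ _ w _ => by simp⟩
  | insert i s hi ih =>
    obtain ⟨C, R, h1⟩ := hh i (Finset.mem_insert_self _ _)
    obtain ⟨C', R', h2⟩ := ih fun j hj => hh j (Finset.mem_insert_of_mem hj)
    refine ⟨C + C', max R R', fun ξ hξ w hw => ?_⟩
    beta_reduce
    rw [Finset.sum_insert hi, add_mul]
    exact (norm_add_le _ _).trans (add_le_add (h1 ξ ((le_max_left _ _).trans hξ) w hw)
      (h2 ξ ((le_max_right _ _).trans hξ) w hw))

variable {O : Set E} {q : ℕ} {h : (Fin m → ℝ) → E → G}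

/-- Scaling reduces the estimate to the unit sphere times `K`, which is compact. -/
theorem IsHomog.decaysOn (hh : IsHomog O q h) {K : Set E} (hK : IsCompact K) (hKO : K ⊆ O) :
    DecaysOn K q h := by
  have hc : ContinuousOn (fun p : (Fin m → ℝ) × E => h p.1 p.2) (Metric.sphere 0 1 ×ˢ K) :=
    hh.1.continuousOn.mono (Set.prod_mono (fun x hx => by
      rintro rfl
      simp at hx) hKO)
  obtain ⟨C, hC⟩ := ((isCompact_sphere _ _).prod hK).exists_bound_of_continuousOn hc
  refine ⟨C, 1, fun ξ hξ w hw => ?_⟩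
  have h0 : 0 < ‖ξ‖ := by linarith
  have h1 : ‖ξ‖⁻¹ • ξ ∈ Metric.sphere (0 : Fin m → ℝ) 1 := by
    rw [mem_sphere_zero_iff_norm, norm_smul, norm_inv, norm_norm, inv_mul_cancel₀ h0.ne']
  have h2 := hh.2 ‖ξ‖⁻¹ (inv_pos.2 h0) ξ (norm_pos_iff.1 h0) w (hKO hw)
  rw [← h2, norm_smul, norm_pow, norm_inv, norm_norm, mul_comm]
  exact mul_le_mul_of_nonneg_right (hC (_, w) ⟨h1, hw⟩) (by positivity)

theorem isOpen_compl_zero_prod (hO : IsOpen O) : IsOpen (({0}ᶜ : Set (Fin m → ℝ)) ×ˢ O) :=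
  isOpen_compl_singleton.prod hO

theorem IsHomog.hasFDerivAt_left (hh : IsHomog O q h) (hO : IsOpen O) {ξ : Fin m → ℝ}
    (hξ : ξ ≠ 0) {w : E} (hw : w ∈ O) :
    HasFDerivAt (fun ξ => h ξ w)
      ((fderiv ℝ (fun p : (Fin m → ℝ) × E => h p.1 p.2) (ξ, w)).comp
        (ContinuousLinearMap.inl ℝ _ _)) ξ := by
  have h1 : DifferentiableAt ℝ (fun p : (Fin m → ℝ) × E => h p.1 p.2) (ξ, w) :=
    (hh.1.differentiableOn (by simp)).differentiableAt
      ((isOpen_compl_zero_prod hO).mem_nhds ⟨hξ, hw⟩)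
  exact HasFDerivAt.comp (g := fun p : (Fin m → ℝ) × E => h p.1 p.2) (f := fun ξ => (ξ, w)) ξ
    h1.hasFDerivAt
    (hasFDerivAt_prodMk_left ξ w)

theorem IsHomog.hasFDerivAt_right (hh : IsHomog O q h) (hO : IsOpen O) {ξ : Fin m → ℝ}
    (hξ : ξ ≠ 0) {w : E} (hw : w ∈ O) :
    HasFDerivAt (h ξ)
      ((fderiv ℝ (fun p : (Fin m → ℝ) × E => h p.1 p.2) (ξ, w)).comp
        (ContinuousLinearMap.inr ℝ _ _)) w := by
  have h1 : DifferentiableAt ℝ (fun p : (Fin m → ℝ) × E => h p.1 p.2) (ξ, w) :=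
    (hh.1.differentiableOn (by simp)).differentiableAt
      ((isOpen_compl_zero_prod hO).mem_nhds ⟨hξ, hw⟩)
  exact HasFDerivAt.comp (g := fun p : (Fin m → ℝ) × E => h p.1 p.2) (f := fun w => (ξ, w)) w
    h1.hasFDerivAt
    (hasFDerivAt_prodMk_right ξ w)

/-- Differentiating `t^q h(tξ, w) = h(ξ, w)` in `ξ` brings out one more factor `t`. -/
theorem IsHomog.fderiv_left (hh : IsHomog O q h) (hO : IsOpen O) (v : Fin m → ℝ) :
    IsHomog O (q + 1) fun ξ w => fderiv ℝ (fun ξ => h ξ w) ξ v := by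
  constructor
  · have h1 : ContDiffOn ℝ ∞ (fun p => fderiv ℝ (fun p : (Fin m → ℝ) × E => h p.1 p.2) p (v, 0))
        ({0}ᶜ ×ˢ O) :=
      (hh.1.fderiv_of_isOpen (isOpen_compl_zero_prod hO) (by simp)).clm_apply contDiffOn_const
    refine h1.congr fun p hp => ?_
    beta_reduce
    rw [(hh.hasFDerivAt_left hO hp.1 hp.2).fderiv]
    simp
  · intro t ht ξ hξ w hw
    have h1 : (fun ξ => t ^ q • h (t • ξ) w) =ᶠ[nhds ξ] fun ξ => h ξ w := by
      filter_upwards [isOpen_compl_singleton.mem_nhds hξ] with ξ' hξ' using hh.2 t ht ξ' hξ' w hw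
    have h2 := (hh.hasFDerivAt_left hO (smul_ne_zero ht.ne' hξ) hw).differentiableAt
    have h3 : DifferentiableAt ℝ (fun ξ => h (t • ξ) w) ξ :=
      DifferentiableAt.comp (g := fun ξ => h ξ w) ξ h2 (by fun_prop)
    beta_reduce
    rw [← h1.fderiv_eq, fderiv_fun_const_smul h3]
    have h4 := fderiv_comp_smul (𝕜 := ℝ) (f := fun ξ => h ξ w) (x := ξ) t
    rw [h4]
    simp [smul_smul, pow_succ]

/-- The factor `t^q` does not involve `w`, so derivatives in `w` keep the degree. This is why every
derivative of the symbols decays at the same rate. -/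
theorem IsHomog.fderiv_right (hh : IsHomog O q h) (hO : IsOpen O) :
    IsHomog O q fun ξ w => fderiv ℝ (h ξ) w := by
  constructor
  · have h1 : ContDiffOn ℝ ∞ (fun p => (fderiv ℝ (fun p : (Fin m → ℝ) × E => h p.1 p.2) p).comp
        (ContinuousLinearMap.inr ℝ (Fin m → ℝ) E)) ({0}ᶜ ×ˢ O) :=
      (hh.1.fderiv_of_isOpen (isOpen_compl_zero_prod hO) (by simp)).clm_comp contDiffOn_const
    exact h1.congr fun p hp => (hh.hasFDerivAt_right hO hp.1 hp.2).fderiv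
  · intro t ht ξ hξ w hw
    have h1 : (fun w => t ^ q • h (t • ξ) w) =ᶠ[nhds w] h ξ := by
      filter_upwards [hO.mem_nhds hw] with w' hw' using hh.2 t ht ξ hξ w' hw'
    have h2 := (hh.hasFDerivAt_right hO (smul_ne_zero ht.ne' hξ) hw).differentiableAt
    beta_reduce
    rw [← h1.fderiv_eq, fderiv_fun_const_smul h2]

/-- Along the segment from `ξ` to `ξ + v` norms stay comparable to `‖ξ‖`, so a decay estimate on the
segment becomes one at `ξ`. -/
theorem norm_add_smul_inv_le {ξ v : Fin m → ℝ} (hξ : 2 * ‖v‖ + 1 ≤ ‖ξ‖) {t : ℝ}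
    (ht : t ∈ Set.Icc (0 : ℝ) 1) : ‖ξ‖ - ‖v‖ ≤ ‖ξ + t • v‖ ∧ ‖ξ + t • v‖⁻¹ ≤ 2 * ‖ξ‖⁻¹ := by
  have h1 : ‖t • v‖ ≤ ‖v‖ := by
    rw [norm_smul, Real.norm_of_nonneg ht.1]
    exact mul_le_of_le_one_left (norm_nonneg _) ht.2
  have h2 := norm_sub_le (ξ + t • v) (t • v)
  rw [add_sub_cancel_right] at h2
  have h0 := norm_nonneg v
  refine ⟨by linarith, ?_⟩
  rw [← div_eq_mul_inv, inv_eq_one_div, div_le_div_iff₀ (by linarith) (by linarith)]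
  linarith

/-- By the mean value inequality a difference in direction `v` is bounded by the derivative along
`v`, homogeneous of one degree less. The induction on `vs` quantifies over `q` and `h` so as to
apply to that derivative. -/
theorem IsHomog.decaysOn_diffs (hO : IsOpen O) {K : Set E} (hK : IsCompact K) (hKO : K ⊆ O)
    (vs : List (Fin m → ℝ)) :
    ∀ (q : ℕ) (h : (Fin m → ℝ) → E → G), IsHomog O q h →
      DecaysOn K (q + vs.length) fun ξ w => diffs vs (fun ξ => h ξ w) ξ := by
  -- Differences commute with differentiation when no shifted point hits the singularity `0`; the
  -- bound on the sum of the norms ensures this.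
  have key : ∀ f : (Fin m → ℝ) → G, (∀ ξ, ξ ≠ 0 → DifferentiableAt ℝ f ξ) →
      ∀ vs : List (Fin m → ℝ), ∀ ξ, (vs.map norm).sum < ‖ξ‖ →
        HasFDerivAt (diffs vs f) (diffs vs (fderiv ℝ f) ξ) ξ := by
    intro f hf vs
    induction vs with
    | nil =>
      intro ξ hξ
      refine (hf ξ ?_).hasFDerivAt
      rintro rfl
      simp at hξ
    | cons v vs ih =>
      intro ξ hξ
      rw [List.map_cons, List.sum_cons] at hξ
      have h3 := norm_sub_le (ξ + v) v
      rw [add_sub_cancel_right] at h3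
      exact ((hasFDerivAt_comp_add_right v).2 (ih (ξ + v) (by linarith))).sub
        (ih ξ (by linarith [norm_nonneg v]))
  induction vs with
  | nil => exact fun q h hh => hh.decaysOn hK hKO
  | cons v vs ih =>
    intro q h hh
    obtain ⟨C, R, hCR⟩ := ih (q + 1) _ (hh.fderiv_left hO v)
    -- The power of `2` comes from `norm_add_smul_inv_le`. The three thresholds are for that lemma,
    -- for the inductive estimate along the whole segment, and for `key`.
    refine ⟨C * 2 ^ (q + (v :: vs).length),
      max (2 * ‖v‖ + 1) (max (R + ‖v‖) (‖v‖ + (vs.map norm).sum + 1)), fun ξ hξ w hw => ?_⟩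
    have e1 := (le_max_left _ _).trans hξ
    have e2 := (le_max_left _ _).trans ((le_max_right _ _).trans hξ)
    have e3 := (le_max_right _ _).trans ((le_max_right _ _).trans hξ)
    have hder : ∀ t ∈ Set.Icc (0 : ℝ) 1, HasDerivWithinAt
        (fun t : ℝ => diffs vs (fun ξ => h ξ w) (ξ + t • v))
        (diffs vs (fun ξ => fderiv ℝ (fun ξ => h ξ w) ξ v) (ξ + t • v)) (Set.Icc 0 1) t := by
      intro t ht
      have h1 := key (fun ξ => h ξ w)
        (fun ξ hξ => (hh.hasFDerivAt_left hO hξ (hKO hw)).differentiableAt) vs (ξ + t • v)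
        (by linarith [(norm_add_smul_inv_le e1 ht).1])
      have h2 : HasDerivAt (fun t : ℝ => ξ + t • v) v t := by
        simpa using ((hasDerivAt_id t).smul_const v).const_add ξ
      have h3 := (h1.comp_hasDerivAt t h2).hasDerivWithinAt (s := Set.Icc 0 1)
      have h4 := map_diffs (ContinuousLinearMap.apply ℝ G v : _ →L[ℝ] G).toLinearMap.toAddMonoidHom
        vs (fderiv ℝ fun ξ => h ξ w) (ξ + t • v)
      change diffs vs (fun ξ => fderiv ℝ (fun ξ => h ξ w) ξ v) (ξ + t • v) =
        (diffs vs (fderiv ℝ fun ξ => h ξ w) (ξ + t • v)) v at h4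
      rw [h4]
      exact h3
    have hC0 : 0 ≤ C := by
      have h5 := (norm_nonneg _).trans (hCR ξ (by linarith [norm_nonneg v]) w hw)
      have h6 : 0 < ‖ξ‖⁻¹ ^ (q + 1 + vs.length) := by
        have : 0 < ‖ξ‖ := by linarith [norm_nonneg v]
        positivity
      by_contra hneg
      exact absurd h5 (not_le.2 (mul_neg_of_neg_of_pos (not_le.1 hneg) h6))
    have hmv := norm_image_sub_le_of_norm_deriv_le_segment_01' hder
      (C := C * (2 * ‖ξ‖⁻¹) ^ (q + (v :: vs).length)) fun t ht => by
        have ht' := Set.Ico_subset_Icc_self ht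
        refine (hCR (ξ + t • v) (by linarith [(norm_add_smul_inv_le e1 ht').1]) w hw).trans ?_
        have : q + 1 + vs.length = q + (v :: vs).length := by simp; omega
        rw [this]
        gcongr
        exact (norm_add_smul_inv_le e1 ht').2
    simp only [one_smul, zero_smul, add_zero] at hmv
    rw [mul_pow, ← mul_assoc] at hmv
    exact hmv

/-- Each Laplacian is traded for two more differences appended to `vs`, hence the induction with
`vs` arbitrary. -/
theorem IsHomog.decaysOn_lap (hh : IsHomog O q h) (hO : IsOpen O) {K : Set E} (hK : IsCompact K)
    (hKO : K ⊆ O) (N : ℕ) (vs : List (Fin m → ℝ)) :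
    DecaysOn K (q + 2 * N + vs.length) fun ξ w => diffs vs (lap^[N] fun ξ => h ξ w) ξ := by
  induction N generalizing vs with
  | zero => exact IsHomog.decaysOn_diffs hO hK hKO vs q h hh
  | succ N ih =>
    simp only [Function.iterate_succ_apply', diffs_lap]
    refine DecaysOn.sum _ fun j _ => ?_
    have := ih (vs ++ [Pi.single j 1, -Pi.single j 1])
    rwa [List.length_append, List.length_cons, List.length_singleton,
      show q + 2 * N + (vs.length + (1 + 1)) = q + 2 * (N + 1) + vs.length by omega] at this

/-- `IsHomog` leaves the value at `ξ = 0` free, yet Laplacians near the origin sample it. The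
normalisation `h 0 = 0` keeps them smooth in `w`. -/
theorem IsHomog.contDiffOn_right (hh : IsHomog O q h) (h0 : ∀ w, h 0 w = 0) (ξ : Fin m → ℝ) :
    ContDiffOn ℝ ∞ (h ξ) O := by
  by_cases hξ : ξ = 0
  · subst hξ
    exact contDiffOn_const.congr fun w _ => h0 w
  · exact hh.1.comp (contDiff_prodMk_right ξ).contDiffOn fun w hw => ⟨hξ, hw⟩

theorem contDiffOn_iterate_lap {R : Type*} [Ring R] {h : (Fin m → R) → E → G}
    (hh : ∀ ξ, ContDiffOn ℝ ∞ (h ξ) O) (N : ℕ) (ξ : Fin m → R) :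
    ContDiffOn ℝ ∞ (lap^[N] h ξ) O := by
  induction N generalizing ξ with
  | zero => exact hh ξ
  | succ N ih =>
    rw [Function.iterate_succ_apply']
    have : lap (lap^[N] h) ξ = fun w => ∑ j, ((lap^[N] h ξ w - lap^[N] h (ξ + Pi.single j 1) w) +
        (lap^[N] h ξ w - lap^[N] h (ξ - Pi.single j 1) w)) := by
      funext w
      simp [lap, Finset.sum_apply]
    rw [this]
    exact ContDiffOn.sum fun j _ => ((ih _).sub (ih _)).add ((ih _).sub (ih _))

theorem fderiv_iterate_lap {R : Type*} [Ring R] {h : (Fin m → R) → E → G}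
    (hh : ∀ ξ, ContDiffOn ℝ ∞ (h ξ) O) (hO : IsOpen O) (N : ℕ) (ξ : Fin m → R) {w : E}
    (hw : w ∈ O) :
    fderiv ℝ (lap^[N] h ξ) w = lap^[N] (fun ξ w => fderiv ℝ (h ξ) w) ξ w := by
  induction N generalizing ξ with
  | zero => rfl
  | succ N ih =>
    rw [Function.iterate_succ_apply', Function.iterate_succ_apply']
    have : lap (lap^[N] h) ξ = fun w => ∑ j, ((lap^[N] h ξ w - lap^[N] h (ξ + Pi.single j 1) w) +
        (lap^[N] h ξ w - lap^[N] h (ξ - Pi.single j 1) w)) := by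
      funext w
      simp [lap, Finset.sum_apply]
    have hd : ∀ ξ, DifferentiableAt ℝ (lap^[N] h ξ) w := fun ξ =>
      ((contDiffOn_iterate_lap hh N ξ).differentiableOn (by simp)).differentiableAt
        (hO.mem_nhds hw)
    have hd' := fun ξ => (hd ξ).hasFDerivAt
    rw [this]
    refine (HasFDerivAt.fun_sum fun j _ =>
      ((hd' ξ).sub (hd' _)).add ((hd' ξ).sub (hd' _))).fderiv.trans ?_
    simp only [lap, Finset.sum_apply, Pi.add_apply, Pi.sub_apply, ih]

/-- All derivatives in `w` of iterated Laplacians of a homogeneous symbol decay. -/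
theorem IsHomog.decaysOn_iteratedFDeriv_lap (hO : IsOpen O) {K : Set E} (hK : IsCompact K)
    (hKO : K ⊆ O) (N i : ℕ) : ∀ {G : Type} [NormedAddCommGroup G] [NormedSpace ℝ G]
      {h : (Fin m → ℝ) → E → G}, IsHomog O q h → (∀ w, h 0 w = 0) →
      DecaysOn K (2 * N) fun ξ w => iteratedFDeriv ℝ i (lap^[N] h ξ) w := by
  induction i with
  | zero =>
    intro G _ _ h hh h0
    obtain ⟨C, R, hCR⟩ := hh.decaysOn_lap hO hK hKO N []
    -- For `‖ξ‖ ≥ 1` the extra `q` orders of decay can be dropped.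
    refine ⟨|C|, max 1 R, fun ξ hξ w hw => ?_⟩
    rw [norm_iteratedFDeriv_zero, iterate_lap_apply]
    refine (hCR ξ ((le_max_right _ _).trans hξ) w hw).trans ?_
    have h1 := (le_max_left _ _).trans hξ
    have h2 : ‖ξ‖⁻¹ ≤ 1 := inv_le_one_of_one_le₀ h1
    have h3 : 0 ≤ ‖ξ‖⁻¹ := by positivity
    exact mul_le_mul (le_abs_self C) (pow_le_pow_of_le_one h3 h2 (by simp))
      (by positivity) (abs_nonneg C)
  | succ i ih =>
    intro G _ _ h hh h0
    -- The derivative in `w` is a symbol of the same degree with values in `E →L[ℝ] G`; this is why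
    -- the target space varies in the induction.
    obtain ⟨C, R, hCR⟩ := ih (hh.fderiv_right hO) (fun w => by
      have : h 0 = fun _ => 0 := funext h0
      rw [this]
      simp)
    refine ⟨C, R, fun ξ hξ w hw => ?_⟩
    refine le_trans (le_of_eq ?_) (hCR ξ hξ w hw)
    rw [← norm_iteratedFDeriv_fderiv]
    congr 1
    refine Filter.EventuallyEq.eq_of_nhds (f := iteratedFDeriv ℝ i (fderiv ℝ (lap^[N] h ξ)))
      (Filter.EventuallyEq.iteratedFDeriv ℝ ?_ i)
    filter_upwards [hO.mem_nhds (hKO hw)] with w' hw'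
    exact fderiv_iterate_lap (fun ξ => hh.contDiffOn_right h0 ξ) hO N ξ hw'

end Symbols

/-! ### Families indexed by a lattice -/

section Families


variable {m : ℕ} {E G H : Type} [NormedAddCommGroup E] [NormedSpace ℝ E]
  [NormedAddCommGroup G] [NormedSpace ℝ G] [NormedAddCommGroup H] [NormedSpace ℝ H]

theorem norm_intCast_pi (n : Fin m → ℤ) : ‖((Int.castRingHom ℝ) ∘ n : Fin m → ℝ)‖ = ‖n‖ := by
  simp only [Pi.norm_def]
  congr 2

/-- Comparison with the lattice series `∑ ‖n‖^{-(m+1)}`, whose exponent exceeds the rank `m`. -/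
theorem summable_inv_one_add_norm_pow : Summable fun n : Fin m → ℤ => (1 + ‖n‖)⁻¹ ^ (m + 1) := by
  let b := Pi.basisFun ℝ (Fin m)
  let L : Submodule ℤ (Fin m → ℝ) := Submodule.span ℤ (Set.range b)
  have hmem : ∀ n : Fin m → ℤ, ((Int.castRingHom ℝ) ∘ n : Fin m → ℝ) ∈ L := by
    intro n
    rw [Module.Basis.mem_span_iff_repr_mem]
    intro i
    exact ⟨n i, by simp [b]⟩
  have hinj : Function.Injective fun n : Fin m → ℤ => (⟨_, hmem n⟩ : L) := by
    intro n n' h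
    funext i
    have := congrFun (congrArg Subtype.val h) i
    simpa using this
  have hrank : Module.finrank ℤ L < m + 1 := by
    rw [ZLattice.rank ℝ L]
    simp
  have h1 := (ZLattice.summable_norm_pow_inv L (m + 1) hrank).comp_injective hinj
  -- The comparison fails only at `n = 0`, where `‖n‖⁻¹` takes the value `0`; a finite exception is
  -- harmless.
  refine Summable.of_norm_bounded_eventually h1 ?_
  rw [Filter.eventually_cofinite]
  refine Set.Finite.subset (Set.finite_singleton (0 : Fin m → ℤ)) fun n hn => ?_
  by_contra hne
  refine hn ?_
  have h2 : 0 < ‖n‖ := norm_pos_iff.2 hne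
  have h3 : ‖(⟨_, hmem n⟩ : L)‖ = ‖n‖ := norm_intCast_pi n
  simp only [Function.comp_apply, h3]
  rw [Real.norm_of_nonneg (by positivity)]
  gcongr
  linarith

/-- A family of smooth functions on `O`, each of whose derivatives is `O((1 + ‖n‖)^{-p})`
locally uniformly on `O`. -/
def DecayFamily (O : Set E) (p : ℕ) (g : (Fin m → ℤ) → E → G) : Prop :=
  (∀ n, ContDiffOn ℝ ∞ (g n) O) ∧ ∀ K ⊆ O, IsCompact K → ∀ i : ℕ, ∃ C : ℝ, ∀ n, ∀ w ∈ K,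
    ‖iteratedFDeriv ℝ i (g n) w‖ ≤ C * (1 + ‖n‖)⁻¹ ^ p

variable {O : Set E} {p : ℕ} {g : (Fin m → ℤ) → E → G}

theorem DecayFamily.exists_nonneg (hg : DecayFamily O p g) {K : Set E} (hKO : K ⊆ O)
    (hK : IsCompact K) (i : ℕ) : ∃ C : ℝ, 0 ≤ C ∧ ∀ n, ∀ w ∈ K,
      ‖iteratedFDeriv ℝ i (g n) w‖ ≤ C * (1 + ‖n‖)⁻¹ ^ p := by
  obtain ⟨C, hC⟩ := hg.2 K hKO hK i
  exact ⟨|C|, abs_nonneg C, fun n w hw => (hC n w hw).trans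
    (mul_le_mul_of_nonneg_right (le_abs_self C) (by positivity))⟩

theorem DecayFamily.mono (hg : DecayFamily O p g) {p' : ℕ} (hp : p' ≤ p) : DecayFamily O p' g := by
  refine ⟨hg.1, fun K hKO hK i => ?_⟩
  obtain ⟨C, hC0, hC⟩ := hg.exists_nonneg hKO hK i
  refine ⟨C, fun n w hw => (hC n w hw).trans (mul_le_mul_of_nonneg_left ?_ hC0)⟩
  exact pow_le_pow_of_le_one (by positivity)
    (inv_le_one_of_one_le₀ (by linarith [norm_nonneg n])) hp

theorem DecayFamily.comp_add (hg : DecayFamily O 0 g) (v : Fin m → ℤ) :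
    DecayFamily O 0 fun n => g (n + v) := by
  refine ⟨fun n => hg.1 _, fun K hKO hK i => ?_⟩
  obtain ⟨C, hC⟩ := hg.2 K hKO hK i
  exact ⟨C, fun n w hw => by simpa using hC (n + v) w hw⟩

theorem DecayFamily.add (hO : IsOpen O) (hg : DecayFamily O p g) {g' : (Fin m → ℤ) → E → G}
    (hg' : DecayFamily O p g') : DecayFamily O p (g + g') := by
  refine ⟨fun n => (hg.1 n).add (hg'.1 n), fun K hKO hK i => ?_⟩
  obtain ⟨C, hC⟩ := hg.2 K hKO hK i
  obtain ⟨C', hC'⟩ := hg'.2 K hKO hK i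
  refine ⟨C + C', fun n w hw => ?_⟩
  have h1 : ∀ {f : E → G}, ContDiffOn ℝ ∞ f O → ContDiffAt ℝ i f w := fun h =>
    (h.contDiffAt (hO.mem_nhds (hKO hw))).of_le (by exact_mod_cast le_top)
  rw [Pi.add_apply, iteratedFDeriv_add_apply (h1 (hg.1 n)) (h1 (hg'.1 n)), add_mul]
  exact (norm_add_le _ _).trans (add_le_add (hC n w hw) (hC' n w hw))

theorem DecayFamily.zero : DecayFamily O p (0 : (Fin m → ℤ) → E → G) :=
  ⟨fun _ => contDiffOn_const, fun _ _ _ i => ⟨0, fun n w _ => by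
    have : (0 : (Fin m → ℤ) → E → G) n = fun _ => 0 := rfl
    rw [this, iteratedFDeriv_fun_zero]
    simp⟩⟩

/-- A family on `O` whose iterated Laplacians decay like those of a symbol of order `0`. -/
def IsSymbol (O : Set E) (g : (Fin m → ℤ) → E → G) : Prop :=
  ∀ N : ℕ, DecayFamily O (2 * N) (lap^[N] g)

theorem IsSymbol.sum {ι : Type*} (hO : IsOpen O) (s : Finset ι) {g : ι → (Fin m → ℤ) → E → G}
    (hg : ∀ i ∈ s, IsSymbol O (g i)) : IsSymbol O (∑ i ∈ s, g i) := by
  classical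
  induction s using Finset.induction_on with
  | empty =>
    intro N
    have h1 := map_iterate_lap (0 : (E → G) →+ (E → G)) (0 : (Fin m → ℤ) → E → G) N
    have h2 : lap^[N] (0 : (Fin m → ℤ) → E → G) = 0 := h1
    rw [Finset.sum_empty, h2]
    exact DecayFamily.zero
  | insert i s hi ih =>
    intro N
    rw [Finset.sum_insert hi, iterate_lap_add]
    exact (hg i (Finset.mem_insert_self _ _) N).add hO
      (ih (fun j hj => hg j (Finset.mem_insert_of_mem hj)) N)

/-- Far from the origin this is the decay of symbols, with a factor `2` for replacing `‖n‖` by `1 +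
‖n‖`. The finitely many remaining lattice points are bounded on the compact set one by one, and
their bounds are added to the constant. -/
theorem IsHomog.isSymbol {q : ℕ} {h : (Fin m → ℝ) → E → G} (hh : IsHomog O q h) (hO : IsOpen O)
    (h0 : ∀ w, h 0 w = 0) : IsSymbol O fun n : Fin m → ℤ => h (Int.castRingHom ℝ ∘ n) := by
  intro N
  rw [iterate_lap_comp_castHom]
  have hs : ∀ n : Fin m → ℤ, ContDiffOn ℝ ∞ (lap^[N] h (Int.castRingHom ℝ ∘ n)) O := fun n =>
    contDiffOn_iterate_lap (fun ξ => hh.contDiffOn_right h0 ξ) N _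
  refine ⟨hs, fun K hKO hK i => ?_⟩
  obtain ⟨C, R, hCR⟩ := hh.decaysOn_iteratedFDeriv_lap hO hK hKO N i h0
  have hfin : {n : Fin m → ℤ | ‖n‖ ≤ max 1 R}.Finite := by
    have := (isCompact_closedBall (0 : Fin m → ℤ) (max 1 R)).finite
      (DiscreteTopology.isDiscrete)
    refine this.subset fun n hn => ?_
    simpa using hn
  have hb : ∀ n : Fin m → ℤ, ∃ B : ℝ, ∀ w ∈ K,
      ‖iteratedFDeriv ℝ i (lap^[N] h (Int.castRingHom ℝ ∘ n)) w‖ ≤ B := by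
    intro n
    refine hK.exists_bound_of_continuousOn fun w hw => ContinuousAt.continuousWithinAt ?_
    have h1 : ContDiffAt ℝ i (lap^[N] h (Int.castRingHom ℝ ∘ n)) w :=
      ((hs n).contDiffAt (hO.mem_nhds (hKO hw))).of_le (by exact_mod_cast le_top)
    exact h1.continuousAt_iteratedFDeriv le_rfl
  choose B hB using hb
  refine ⟨|C| * 2 ^ (2 * N) + ∑ n ∈ hfin.toFinset, |B n| * (1 + ‖n‖) ^ (2 * N),
    fun n w hw => ?_⟩
  have hsum0 : 0 ≤ ∑ n ∈ hfin.toFinset, |B n| * (1 + ‖n‖) ^ (2 * N) :=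
    Finset.sum_nonneg fun n _ => by positivity
  by_cases hn : ‖n‖ ≤ max 1 R
  · have h1 : |B n| * (1 + ‖n‖) ^ (2 * N) ≤ ∑ n ∈ hfin.toFinset, |B n| * (1 + ‖n‖) ^ (2 * N) :=
      Finset.single_le_sum (f := fun n : Fin m → ℤ => |B n| * (1 + ‖n‖) ^ (2 * N))
        (fun n _ => by positivity) (hfin.mem_toFinset.2 hn)
    have h2 : |B n| ≤ (∑ n ∈ hfin.toFinset, |B n| * (1 + ‖n‖) ^ (2 * N)) *
        (1 + ‖n‖)⁻¹ ^ (2 * N) := by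
      rw [inv_pow, ← div_eq_mul_inv, le_div_iff₀ (by positivity)]
      exact h1
    refine ((hB n w hw).trans (le_abs_self _)).trans (h2.trans ?_)
    gcongr
    linarith [show 0 ≤ |C| * 2 ^ (2 * N) by positivity]
  · rw [not_le] at hn
    have h1 : 1 ≤ ‖n‖ := (le_max_left _ _).trans hn.le
    have h2 := hCR (Int.castRingHom ℝ ∘ n)
      (by rw [norm_intCast_pi]; exact (le_max_right _ _).trans hn.le) w hw
    rw [norm_intCast_pi] at h2
    have h3 : ‖n‖⁻¹ ≤ 2 * (1 + ‖n‖)⁻¹ := by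
      rw [← div_eq_mul_inv, inv_eq_one_div, div_le_div_iff₀ (by linarith) (by linarith)]
      linarith
    calc _ ≤ C * ‖n‖⁻¹ ^ (2 * N) := h2
      _ ≤ |C| * (2 * (1 + ‖n‖)⁻¹) ^ (2 * N) :=
        mul_le_mul (le_abs_self C) (pow_le_pow_left₀ (by positivity) h3 _) (by positivity)
          (abs_nonneg C)
      _ = (|C| * 2 ^ (2 * N)) * (1 + ‖n‖)⁻¹ ^ (2 * N) := by rw [mul_pow, mul_assoc]
      _ ≤ _ := by
        gcongr
        linarith

/-- A family of smooth functions supported in `K`, all of whose derivatives are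
`O((1 + ‖n‖)^{-p})`. -/
def TestFamily (K : Set E) (p : ℕ) (f : (Fin m → ℤ) → E → H) : Prop :=
  (∀ n, ContDiff ℝ ∞ (f n)) ∧ (∀ n, ∀ w ∉ K, f n w = 0) ∧
    ∀ i : ℕ, ∃ C : ℝ, ∀ n w, ‖iteratedFDeriv ℝ i (f n) w‖ ≤ C * (1 + ‖n‖)⁻¹ ^ p

theorem contDiff_of_contDiffOn_of_tsupport {f : E → G} (hO : IsOpen O) (hf : ContDiffOn ℝ ∞ f O)
    (hs : tsupport f ⊆ O) : ContDiff ℝ ∞ f := by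
  rw [contDiff_iff_contDiffAt]
  intro w
  by_cases hw : w ∈ O
  · exact hf.contDiffAt (hO.mem_nhds hw)
  · have : f =ᶠ[nhds w] fun _ => 0 := by
      filter_upwards [(isClosed_tsupport f).isOpen_compl.mem_nhds fun h => hw (hs h)] with x hx
      exact image_eq_zero_of_notMem_tsupport hx
    exact contDiffAt_const.congr_of_eventuallyEq this

/-- By the Leibniz rule, since the cut-off `Θ` does not depend on `n` and has bounded derivatives.
The locally uniform estimates become global ones. -/
theorem DecayFamily.testFamily (hg : DecayFamily O p g) (hO : IsOpen O) {Θ : E → G →L[ℝ] H}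
    (hΘ : ContDiff ℝ ∞ Θ) (hc : HasCompactSupport Θ) (hs : tsupport Θ ⊆ O) :
    TestFamily (tsupport Θ) p fun n w => Θ w (g n w) := by
  have hz : ∀ n, ∀ w ∉ tsupport Θ, Θ w (g n w) = 0 := by
    intro n w hw
    rw [image_eq_zero_of_notMem_tsupport hw, zero_apply]
  have hts : ∀ n, tsupport (fun w => Θ w (g n w)) ⊆ tsupport Θ := by
    intro n
    refine closure_minimal (fun w hw => ?_) (isClosed_tsupport Θ)
    by_contra h
    exact hw (hz n w h)
  refine ⟨fun n => contDiff_of_contDiffOn_of_tsupport hO (hΘ.contDiffOn.clm_apply (hg.1 n))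
    ((hts n).trans hs), hz, fun i => ?_⟩
  have hB : ∀ j : ℕ, ∃ B : ℝ, 0 ≤ B ∧ ∀ w, ‖iteratedFDeriv ℝ j Θ w‖ ≤ B := by
    intro j
    obtain ⟨B, hB⟩ := (hc.iteratedFDeriv (𝕜 := ℝ) j).exists_bound_of_continuous
      (hΘ.continuous_iteratedFDeriv (by exact_mod_cast le_top))
    exact ⟨|B|, abs_nonneg _, fun w => (hB w).trans (le_abs_self B)⟩
  choose B hB0 hB using hB
  choose C hC0 hC using fun j => hg.exists_nonneg hs hc j
  refine ⟨∑ j ∈ Finset.range (i + 1), (i.choose j : ℝ) * B j * C (i - j), fun n w => ?_⟩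
  by_cases hw : w ∈ tsupport Θ
  · have h1 := norm_iteratedFDerivWithin_clm_apply (𝕜 := ℝ) (n := i) (N := ∞) (s := O)
      hΘ.contDiffOn (hg.1 n) hO.uniqueDiffOn (hs hw) (by exact_mod_cast le_top)
    rw [iteratedFDerivWithin_of_isOpen i hO (hs hw)] at h1
    refine h1.trans ?_
    rw [Finset.sum_mul]
    refine Finset.sum_le_sum fun j _ => ?_
    rw [iteratedFDerivWithin_of_isOpen _ hO (hs hw), iteratedFDerivWithin_of_isOpen _ hO (hs hw),
      mul_assoc _ (C (i - j))]
    exact mul_le_mul (mul_le_mul_of_nonneg_left (hB j w) (by positivity)) (hC (i - j) n w hw)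
      (norm_nonneg _) (mul_nonneg (by positivity) (hB0 j))
  · have h1 : iteratedFDeriv ℝ i (fun w => Θ w (g n w)) w = 0 :=
      image_eq_zero_of_notMem_tsupport fun h =>
        hw (hts n (tsupport_iteratedFDeriv_subset i h))
    rw [h1, norm_zero]
    refine mul_nonneg (Finset.sum_nonneg fun j _ => ?_) (by positivity)
    exact mul_nonneg (mul_nonneg (by positivity) (hB0 j)) (hC0 _)

end Families

/-! ### Summation by parts -/

section SummationByParts

variable {m : ℕ} {H : Type*} [NormedAddCommGroup H]

/-- Summation by parts: in `c k n` the index `k` stands for the character and `n` for the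
coefficient. Translating the summation variable moves a shift from one index to the other, which is
legitimate because every shifted diagonal is summable. -/
theorem hasSum_lap {c : (Fin m → ℤ) → (Fin m → ℤ) → H}
    (hc : ∀ v, Summable fun n => c (n + v) n) :
    (Summable fun n => lap (fun k => c n k) n) ∧
    (Summable fun n => lap (fun k => c k n) n) ∧
    ∑' n, lap (fun k => c k n) n = ∑' n, lap (fun k => c n k) n := by
  have e : ∀ v : Fin m → ℤ, ∀ n, c n (n - v) = (fun n => c (n + v) n) ((Equiv.subRight v) n) := by
    intro v n
    simp
  have hc' : ∀ v, Summable fun n => c n (n - v) := fun v => by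
    simp only [e]
    exact (Equiv.subRight v).summable_iff.2 (hc v)
  have ht : ∀ v, ∑' n, c n (n - v) = ∑' n, c (n + v) n := fun v => by
    simp only [e]
    exact (Equiv.subRight v).tsum_eq (fun n => c (n + v) n)
  have h0 : Summable fun n => c n n := by simpa using hc 0
  have a1 : ∀ v, Summable fun n => c (n - v) n := fun v => by
    simpa only [sub_eq_add_neg] using hc (-v)
  have a2 : ∀ v, Summable fun n => c n (n + v) := fun v => by
    simpa only [sub_neg_eq_add] using hc' (-v)
  have t1 : ∀ v, ∑' n, c n (n + v) = ∑' n, c (n - v) n := fun v => by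
    simpa only [sub_neg_eq_add, ← sub_eq_add_neg] using ht (-v)
  have A : ∀ j : Fin m, HasSum (fun n => (c n n - c n (n + Pi.single j 1)) +
      (c n n - c n (n - Pi.single j 1))) _ := fun j =>
    (h0.hasSum.sub (a2 (Pi.single j 1)).hasSum).add (h0.hasSum.sub (hc' (Pi.single j 1)).hasSum)
  have B : ∀ j : Fin m, HasSum (fun n => (c n n - c (n + Pi.single j 1) n) +
      (c n n - c (n - Pi.single j 1) n)) _ := fun j =>
    (h0.hasSum.sub (hc (Pi.single j 1)).hasSum).add (h0.hasSum.sub (a1 (Pi.single j 1)).hasSum)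
  have A' := hasSum_sum fun j (_ : j ∈ Finset.univ) => A j
  have B' := hasSum_sum fun j (_ : j ∈ Finset.univ) => B j
  refine ⟨A'.summable, B'.summable, B'.tsum_eq.trans (Eq.trans ?_ A'.tsum_eq.symm)⟩
  refine Finset.sum_congr rfl fun j _ => ?_
  rw [ht, t1]
  abel

end SummationByParts

/-! ### Characters -/

section Characters


variable {m : ℕ} {E : Type} [NormedAddCommGroup E] [NormedSpace ℝ E]
  (u : E →L[ℝ] (Fin m → ℝ))

/-- The linear form `w ↦ 2πi n · u(w)`. -/
def charArg (n : Fin m → ℤ) : E →L[ℝ] ℂ :=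
  ∑ j, (2 * Real.pi * Complex.I * n j : ℂ) •
    Complex.ofRealCLM.comp ((ContinuousLinearMap.proj j).comp u)

theorem charArg_apply (n : Fin m → ℤ) (w : E) :
    charArg u n w = 2 * Real.pi * Complex.I * ∑ j, (n j : ℂ) * (u w j : ℂ) := by
  simp only [charArg, sum_apply, smul_apply,
    ContinuousLinearMap.comp_apply, ContinuousLinearMap.proj_apply, Complex.ofRealCLM_apply,
    smul_eq_mul, Finset.mul_sum, mul_assoc]

/-- The character `w ↦ exp(2πi n · u(w))`. -/
def char (n : Fin m → ℤ) (w : E) : ℂ := Complex.exp (charArg u n w)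

theorem char_add (n k : Fin m → ℤ) (w : E) : char u (n + k) w = char u n w * char u k w := by
  rw [char, char, char, ← Complex.exp_add, charArg_apply, charArg_apply, charArg_apply, ← mul_add,
    ← Finset.sum_add_distrib]
  simp only [Pi.add_apply, Int.cast_add, add_mul]

theorem norm_char (n : Fin m → ℤ) (w : E) : ‖char u n w‖ = 1 := by
  have : charArg u n w = ((2 * Real.pi * ∑ j, (n j : ℝ) * u w j : ℝ) : ℂ) * Complex.I := by
    rw [charArg_apply]
    push_cast
    ring
  rw [char, this, Complex.norm_exp_ofReal_mul_I]

/-- The symbol `∑_j (2 - 2 cos (2π u_j))` of the discrete Laplacian. -/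
def charWeight (w : E) : ℂ :=
  ∑ j, ((1 - char u (Pi.single j 1) w) + (1 - char u (-Pi.single j 1) w))

/-- As functions of the frequency, characters are eigenfunctions of the Laplacian. Hence
multiplication by `charWeight` can be moved onto the coefficients. -/
theorem lap_char (n : Fin m → ℤ) (w : E) :
    lap (fun k => char u k w) n = charWeight u w * char u n w := by
  simp only [lap, charWeight, Finset.sum_mul, sub_eq_add_neg n, char_add]
  exact Finset.sum_congr rfl fun j _ => by ring

theorem charWeight_eq (w : E) :
    charWeight u w = ((∑ j, 2 * (1 - Real.cos (2 * Real.pi * u w j)) : ℝ) : ℂ) := by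
  have h1 : ∀ (j : Fin m) (s : ℤ), charArg u (Pi.single j s) w =
      2 * Real.pi * Complex.I * (s * u w j) := by
    intro j s
    rw [charArg_apply, Finset.sum_eq_single j (fun i _ hi => by simp [hi]) (by simp)]
    simp
  rw [charWeight]
  push_cast
  refine Finset.sum_congr rfl fun j _ => ?_
  rw [char, char, ← Pi.single_neg, h1, h1, Complex.cos]
  have e1 : (2 * Real.pi * Complex.I * (((1 : ℤ) : ℂ) * (u w j : ℂ)) : ℂ) =
      2 * Real.pi * (u w j : ℂ) * Complex.I := by push_cast; ring
  have e2 : (2 * Real.pi * Complex.I * (((-1 : ℤ) : ℂ) * (u w j : ℂ)) : ℂ) =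
      -(2 * Real.pi * (u w j : ℂ)) * Complex.I := by push_cast; ring
  rw [e1, e2]
  ring

/-- A sum of nonnegative terms vanishes only if each cosine is `1`. A single factor `1 - χ_{e_j}`
would vanish on a whole hypersurface; the Laplacian is used because its symbol vanishes only at
lattice points. -/
theorem charWeight_eq_zero_iff (w : E) :
    charWeight u w = 0 ↔ ∃ n : Fin m → ℤ, ∀ j, u w j = n j := by
  have h0 : ∀ j ∈ Finset.univ, 0 ≤ 2 * (1 - Real.cos (2 * Real.pi * u w j)) := fun j _ => by
    linarith [Real.cos_le_one (2 * Real.pi * u w j)]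
  rw [charWeight_eq, Complex.ofReal_eq_zero, Finset.sum_eq_zero_iff_of_nonneg h0]
  constructor
  · intro h
    have : ∀ j, ∃ k : ℤ, u w j = k := by
      intro j
      have h1 : Real.cos (2 * Real.pi * u w j) = 1 := by linarith [h j (Finset.mem_univ _)]
      obtain ⟨k, hk⟩ := (Real.cos_eq_one_iff _).1 h1
      refine ⟨k, mul_left_cancel₀ Real.two_pi_pos.ne' ?_⟩
      rw [← hk]
      ring
    choose n hn using this
    exact ⟨n, hn⟩
  · rintro ⟨n, hn⟩ j _
    rw [hn j, mul_comm (2 * Real.pi), Real.cos_int_mul_two_pi]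
    simp

theorem contDiff_char (n : Fin m → ℤ) : ContDiff ℝ ∞ (char u n) :=
  (charArg u n).contDiff.cexp

theorem contDiff_charWeight : ContDiff ℝ ∞ (charWeight u) :=
  ContDiff.sum fun _ _ => (contDiff_const.sub (contDiff_char u _)).add
    (contDiff_const.sub (contDiff_char u _))

theorem fderiv_char (n : Fin m → ℤ) (w : E) :
    fderiv ℝ (char u n) w = char u n w • charArg u n :=
  ((charArg u n).hasFDerivAt.cexp).fderiv

theorem norm_charArg_le (n : Fin m → ℤ) :
    ‖charArg u n‖ ≤ (2 * Real.pi * (m * ‖u‖)) * (1 + ‖n‖) := by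
  refine ContinuousLinearMap.opNorm_le_bound _ (by positivity) fun w => ?_
  have h1 : ‖∑ j, (n j : ℂ) * (u w j : ℂ)‖ ≤ m * (‖n‖ * (‖u‖ * ‖w‖)) := by
    refine (norm_sum_le _ _).trans ?_
    have : ∀ j ∈ Finset.univ, ‖(n j : ℂ) * (u w j : ℂ)‖ ≤ ‖n‖ * (‖u‖ * ‖w‖) := by
      intro j _
      rw [norm_mul, Complex.norm_intCast, Complex.norm_real]
      refine mul_le_mul ?_ ((norm_le_pi_norm (u w) j).trans (u.le_opNorm w)) (norm_nonneg _)
        (norm_nonneg _)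
      have := norm_le_pi_norm n j
      rwa [Int.norm_eq_abs] at this
    refine (Finset.sum_le_sum this).trans ?_
    simp
  rw [charArg_apply, norm_mul, norm_mul, norm_mul, Complex.norm_I, Complex.norm_real,
    Complex.norm_two, Real.norm_of_nonneg Real.pi_pos.le, mul_one]
  calc _ ≤ 2 * Real.pi * (m * (‖n‖ * (‖u‖ * ‖w‖))) := by gcongr
    _ = (2 * Real.pi * (m * ‖u‖) * ‖n‖) * ‖w‖ := by ring
    _ ≤ _ := by
      gcongr
      linarith

/-- The derivative of a character is that character times a constant covector of size `O(1 + ‖n‖)`,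
so each derivative costs one power. -/
theorem norm_iteratedFDeriv_char_le (n : Fin m → ℤ) (i : ℕ) (w : E) :
    ‖iteratedFDeriv ℝ i (char u n) w‖ ≤ ((2 * Real.pi * (m * ‖u‖)) * (1 + ‖n‖)) ^ i := by
  induction i with
  | zero => rw [norm_iteratedFDeriv_zero, norm_char, pow_zero]
  | succ i ih =>
    have h1 : fderiv ℝ (char u n) =
        ((ContinuousLinearMap.id ℝ ℂ).smulRight (charArg u n) : ℂ →L[ℝ] E →L[ℝ] ℂ) ∘ char u n := by
      funext w
      rw [fderiv_char]
      rfl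
    rw [← norm_iteratedFDeriv_fderiv, h1]
    refine (ContinuousLinearMap.norm_iteratedFDeriv_comp_left _
      (contDiff_char u n).contDiffAt (by exact_mod_cast le_top)).trans ?_
    rw [pow_succ']
    refine mul_le_mul ?_ ih (norm_nonneg _) (by positivity)
    refine le_trans ?_ (norm_charArg_le u n)
    refine ContinuousLinearMap.opNorm_le_bound _ (norm_nonneg _) fun z => ?_
    rw [mul_comm, ← norm_smul]
    rfl

variable {H : Type} [NormedAddCommGroup H] [NormedSpace ℝ H] [NormedSpace ℂ H]
  [IsScalarTower ℝ ℂ H] {K : Set E}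

theorem exists_norm_iteratedFDeriv_char_smul_le {p : ℕ} {f : (Fin m → ℤ) → E → H}
    (hf : TestFamily K p f) (k : ℕ) : ∃ C : ℝ, ∀ i ≤ k, ∀ n w,
      ‖iteratedFDeriv ℝ i (fun w => char u n w • f n w) w‖ ≤
        C * ((1 + ‖n‖) ^ k * (1 + ‖n‖)⁻¹ ^ p) := by
  have hB : ∀ i : ℕ, ∃ B : ℝ, 0 ≤ B ∧ ∀ n w,
      ‖iteratedFDeriv ℝ i (f n) w‖ ≤ B * (1 + ‖n‖)⁻¹ ^ p := by
    intro i
    obtain ⟨B, hB⟩ := hf.2.2 i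
    exact ⟨|B|, abs_nonneg B, fun n w => (hB n w).trans
      (mul_le_mul_of_nonneg_right (le_abs_self B) (by positivity))⟩
  choose B hB0 hB using hB
  set c := 2 * Real.pi * (m * ‖u‖)
  have hc : 0 ≤ c := by positivity
  have hnn : ∀ i, 0 ≤ ∑ j ∈ Finset.range (i + 1), (i.choose j : ℝ) * c ^ j * B (i - j) := fun i =>
    Finset.sum_nonneg fun j _ => mul_nonneg (by positivity) (hB0 _)
  -- Adding the Leibniz constants of all orders up to `k` gives a single constant for all of them.
  refine ⟨∑ i ∈ Finset.range (k + 1),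
    ∑ j ∈ Finset.range (i + 1), (i.choose j : ℝ) * c ^ j * B (i - j), fun i hi n w => ?_⟩
  have h1 := ContinuousLinearMap.norm_iteratedFDeriv_le_of_bilinear_of_le_one
    (ContinuousLinearMap.lsmul ℝ ℂ : ℂ →L[ℝ] H →L[ℝ] H) (contDiff_char u n) (hf.1 n) w (n := i)
    (by exact_mod_cast le_top) ContinuousLinearMap.opNorm_lsmul_le
  simp only [ContinuousLinearMap.lsmul_apply] at h1
  refine h1.trans ?_
  have hn : 1 ≤ 1 + ‖n‖ := by linarith [norm_nonneg n]
  have h2 : ∑ j ∈ Finset.range (i + 1), (i.choose j : ℝ) * ‖iteratedFDeriv ℝ j (char u n) w‖ *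
      ‖iteratedFDeriv ℝ (i - j) (f n) w‖ ≤
      (∑ j ∈ Finset.range (i + 1), (i.choose j : ℝ) * c ^ j * B (i - j)) *
        ((1 + ‖n‖) ^ k * (1 + ‖n‖)⁻¹ ^ p) := by
    rw [Finset.sum_mul]
    refine Finset.sum_le_sum fun j hj => ?_
    have h3 : ‖iteratedFDeriv ℝ j (char u n) w‖ ≤ c ^ j * (1 + ‖n‖) ^ k := by
      refine (norm_iteratedFDeriv_char_le u n j w).trans ?_
      rw [mul_pow]
      gcongr
      exact (Finset.mem_range_succ_iff.1 hj).trans hi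
    calc _ ≤ (i.choose j : ℝ) * (c ^ j * (1 + ‖n‖) ^ k) * (B (i - j) * (1 + ‖n‖)⁻¹ ^ p) :=
        mul_le_mul (mul_le_mul_of_nonneg_left h3 (by positivity)) (hB _ n w) (norm_nonneg _)
          (by positivity)
      _ = _ := by ring
  refine h2.trans (mul_le_mul_of_nonneg_right ?_ (by positivity))
  exact Finset.single_le_sum (f := fun i => ∑ j ∈ Finset.range (i + 1),
    (i.choose j : ℝ) * c ^ j * B (i - j)) (fun i _ => hnn i) (Finset.mem_range_succ_iff.2 hi)

/-- Of the `p` orders of decay, `k` pay for differentiating the characters and `m + 1` for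
summability over `ℤ^m`. -/
theorem contDiff_tsum_char_smul [CompleteSpace H] {p k : ℕ} (hp : k + m + 1 ≤ p)
    {f : (Fin m → ℤ) → E → H}
    (hf : TestFamily K p f) : ContDiff ℝ k fun w => ∑' n, char u n w • f n w := by
  obtain ⟨C, hC⟩ := exists_norm_iteratedFDeriv_char_smul_le u hf k
  have h := contDiff_tsum (𝕜 := ℝ) (N := (k : ℕ∞)) (f := fun n w => char u n w • f n w)
    (v := fun _ n => |C| * (1 + ‖n‖)⁻¹ ^ (m + 1))
    (fun n => ((contDiff_char u n).smul (hf.1 n)).of_le (by exact_mod_cast le_top))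
    (fun _ _ => summable_inv_one_add_norm_pow.mul_left |C|) ?_
  · exact h
  · intro i n w hi
    refine (hC i (by exact_mod_cast hi) n w).trans ?_
    have hn : 1 ≤ 1 + ‖n‖ := by linarith [norm_nonneg n]
    have hn' : (1 + ‖n‖)⁻¹ ≤ 1 := inv_le_one_of_one_le₀ hn
    refine mul_le_mul (le_abs_self C) ?_ (by positivity) (abs_nonneg C)
    calc (1 + ‖n‖) ^ k * (1 + ‖n‖)⁻¹ ^ p ≤ (1 + ‖n‖) ^ k * (1 + ‖n‖)⁻¹ ^ (k + (m + 1)) := by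
          refine mul_le_mul_of_nonneg_left ?_ (by positivity)
          exact pow_le_pow_of_le_one (by positivity) hn' (by omega)
      _ = (1 + ‖n‖)⁻¹ ^ (m + 1) := by
        rw [pow_add, ← mul_assoc, ← mul_pow, mul_inv_cancel₀ (by positivity), one_pow, one_mul]

end Characters

/-! ### Series of oscillatory integrals -/

section Oscillatory


variable {m : ℕ} {E : Type} [NormedAddCommGroup E] [NormedSpace ℝ E]
  (u : E →L[ℝ] (Fin m → ℝ))

theorem TestFamily.fderiv_apply {H : Type} [NormedAddCommGroup H] [NormedSpace ℝ H] {K : Set E}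
    (hK : IsClosed K) {p : ℕ} {f : (Fin m → ℤ) → E → H} (hf : TestFamily K p f) (v : E) :
    TestFamily K p fun n w => fderiv ℝ (f n) w v := by
  refine ⟨fun n => ((hf.1 n).fderiv_right (m := ∞) (by simp)).clm_apply contDiff_const,
    fun n w hw => ?_, fun i => ?_⟩
  · have : f n =ᶠ[nhds w] fun _ => 0 := by
      filter_upwards [hK.isOpen_compl.mem_nhds hw] with x hx using hf.2.1 n x hx
    beta_reduce
    rw [this.fderiv_eq]
    simp
  · obtain ⟨C, hC⟩ := hf.2.2 (i + 1)
    refine ⟨‖v‖ * C, fun n w => ?_⟩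
    refine (norm_iteratedFDeriv_clm_apply_const (𝕜 := ℝ) (f := fderiv ℝ (f n)) (c := v) (n := i)
      (N := ∞) ((hf.1 n).fderiv_right (m := ∞) (by simp)).contDiffAt
      (by exact_mod_cast le_top)).trans ?_
    rw [norm_iteratedFDeriv_fderiv, mul_assoc]
    exact mul_le_mul_of_nonneg_left (hC n w) (norm_nonneg v)

variable [MeasurableSpace E] [BorelSpace E] [FiniteDimensional ℝ E] {μ : Measure E}
  [μ.IsAddHaarMeasure]

theorem integrable_of_eq_zero {f : E → ℂ} (hf : Continuous f) {K : Set E} (hK : IsCompact K)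
    (h0 : ∀ w ∉ K, f w = 0) : Integrable f μ :=
  hf.integrable_of_hasCompactSupport (HasCompactSupport.intro hK h0)

/-- Integration by parts: along `v j` the character has derivative `2πi n_j χ_n`, so one factor
`n_j` is exchanged for a derivative of `f n`, which again forms a test family. No decay of `f` in
`n` is needed. -/
theorem exists_norm_pow_mul_integral_char_mul_le {v : Fin m → E}
    (hv : ∀ j, u (v j) = Pi.single j 1) {K : Set E} (hK : IsCompact K) (N : ℕ) :
    ∀ {f : (Fin m → ℤ) → E → ℂ}, TestFamily K 0 f →
      ∃ C, ∀ n, ‖n‖ ^ N * ‖∫ w, char u n w * f n w ∂μ‖ ≤ C := by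
  induction N with
  | zero =>
    intro f hf
    obtain ⟨C, hC⟩ := hf.2.2 0
    refine ⟨C * μ.real K, fun n => ?_⟩
    rw [pow_zero, one_mul, ← setIntegral_eq_integral_of_forall_compl_eq_zero (s := K)
      fun w hw => by rw [hf.2.1 n w hw, mul_zero]]
    refine norm_setIntegral_le_of_norm_le_const hK.measure_lt_top fun w _ => ?_
    simpa [norm_char] using hC n w
  | succ N ih =>
    intro f hf
    choose C hC using fun j => ih (hf.fderiv_apply hK.isClosed (v j))
    refine ⟨∑ j, (2 * Real.pi)⁻¹ * C j, fun n => ?_⟩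
    have key : ∀ j, |(n j : ℝ)| * ‖∫ w, char u n w * f n w ∂μ‖ =
        (2 * Real.pi)⁻¹ * ‖∫ w, char u n w * fderiv ℝ (f n) w (v j) ∂μ‖ := by
      intro j
      have hd : ∀ w, fderiv ℝ (char u n) w (v j) =
          (2 * Real.pi * Complex.I * n j) * char u n w := by
        intro w
        rw [fderiv_char, smul_apply, charArg_apply, hv, smul_eq_mul,
          Finset.sum_eq_single j (fun i _ hi => by simp [hi]) (by simp)]
        simp
        ring
      have hcd : Continuous fun w => fderiv ℝ (f n) w (v j) :=
        ((hf.fderiv_apply hK.isClosed (v j)).1 n).continuous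
      have hcc := (contDiff_char u n).continuous
      have hparts := integral_mul_fderiv_eq_neg_fderiv_mul_of_integrable (μ := μ)
        (f := char u n) (g := f n) (v := v j)
        (by
          simp only [hd]
          exact integrable_of_eq_zero ((continuous_const.mul hcc).mul (hf.1 n).continuous) hK
            fun w hw => by rw [hf.2.1 n w hw, mul_zero])
        (integrable_of_eq_zero (hcc.mul hcd) hK fun w hw => by
          rw [show fderiv ℝ (f n) w (v j) = 0 from
            (hf.fderiv_apply hK.isClosed (v j)).2.1 n w hw, mul_zero])
        (integrable_of_eq_zero (hcc.mul (hf.1 n).continuous) hK fun w hw => by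
          rw [hf.2.1 n w hw, mul_zero])
        (fun w _ => (contDiff_char u n).differentiable (by simp) w)
        (fun w _ => (hf.1 n).differentiable (by simp) w)
      rw [hparts, norm_neg]
      simp only [hd, mul_assoc (2 * Real.pi * Complex.I * n j : ℂ)]
      rw [integral_const_mul, norm_mul, norm_mul, norm_mul, norm_mul, Complex.norm_I,
        Complex.norm_two, Complex.norm_real, Complex.norm_intCast,
        Real.norm_of_nonneg Real.pi_pos.le]
      field_simp
    -- The sup norm is bounded by the sum of the coordinates, so all directions are used and none
    -- has to be selected according to `n`.
    have hn : ‖n‖ ≤ ∑ j, |(n j : ℝ)| := by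
      refine (pi_norm_le_iff_of_nonneg (Finset.sum_nonneg fun j _ => abs_nonneg _)).2 fun j => ?_
      rw [Int.norm_eq_abs]
      exact Finset.single_le_sum (f := fun j => |(n j : ℝ)|) (fun j _ => abs_nonneg _)
        (Finset.mem_univ j)
    calc ‖n‖ ^ (N + 1) * ‖∫ w, char u n w * f n w ∂μ‖
        ≤ ‖n‖ ^ N * (∑ j, |(n j : ℝ)|) * ‖∫ w, char u n w * f n w ∂μ‖ := by
          rw [pow_succ]
          gcongr
      _ = ∑ j, (2 * Real.pi)⁻¹ *
          (‖n‖ ^ N * ‖∫ w, char u n w * fderiv ℝ (f n) w (v j) ∂μ‖) := by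
          rw [Finset.mul_sum, Finset.sum_mul]
          refine Finset.sum_congr rfl fun j _ => ?_
          rw [mul_assoc, key]
          ring
      _ ≤ _ := Finset.sum_le_sum fun j _ =>
          mul_le_mul_of_nonneg_left (hC j n) (by positivity)

/-- The exponents `0` and `m + 1` are combined because the comparison series involves `1 + ‖n‖`,
which also controls `n = 0`. -/
theorem TestFamily.summable_integral_char_mul {v : Fin m → E}
    (hv : ∀ j, u (v j) = Pi.single j 1) {K : Set E} (hK : IsCompact K)
    {f : (Fin m → ℤ) → E → ℂ} (hf : TestFamily K 0 f) :
    Summable fun n => ∫ w, char u n w * f n w ∂μ := by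
  obtain ⟨C, hC⟩ := exists_norm_pow_mul_integral_char_mul_le (μ := μ) u hv hK 0 hf
  obtain ⟨C', hC'⟩ := exists_norm_pow_mul_integral_char_mul_le (μ := μ) u hv hK (m + 1) hf
  refine Summable.of_norm_bounded
    (summable_inv_one_add_norm_pow.mul_left (2 ^ m * (C + C'))) fun n => ?_
  rw [inv_pow, ← div_eq_mul_inv, le_div_iff₀ (by positivity), mul_comm]
  have h1 : (1 + ‖n‖) ^ (m + 1) ≤ 2 ^ m * (1 ^ (m + 1) + ‖n‖ ^ (m + 1)) :=
    add_pow_le zero_le_one (norm_nonneg n) (m + 1)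
  calc _ ≤ 2 ^ m * (1 ^ (m + 1) + ‖n‖ ^ (m + 1)) * ‖∫ w, char u n w * f n w ∂μ‖ := by gcongr
    _ = 2 ^ m * (‖n‖ ^ 0 * ‖∫ w, char u n w * f n w ∂μ‖ +
        ‖n‖ ^ (m + 1) * ‖∫ w, char u n w * f n w ∂μ‖) := by ring
    _ ≤ _ := by
      gcongr
      · exact hC n
      · exact hC' n

variable {G : Type} [NormedAddCommGroup G] [NormedSpace ℝ G] [NormedSpace ℂ G]
  [IsScalarTower ℝ ℂ G] {O : Set E} {g : (Fin m → ℤ) → E → G} {Θ : E → G →L[ℝ] ℂ}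

theorem summable_integral_char_smul {v : Fin m → E} (hv : ∀ j, u (v j) = Pi.single j 1)
    (hO : IsOpen O) (hg : DecayFamily O 0 g) (hΘ : ContDiff ℝ ∞ Θ) (hc : HasCompactSupport Θ)
    (hs : tsupport Θ ⊆ O) (hlin : ∀ w (c : ℂ) x, Θ w (c • x) = c * Θ w x) :
    Summable fun n => ∫ w, Θ w (char u n w • g n w) ∂μ := by
  simp only [hlin]
  have hT : TestFamily (tsupport Θ) 0 fun n w => Θ w (g n w) := hg.testFamily hO hΘ hc hs
  exact hT.summable_integral_char_mul u hv hc

theorem lap_integral {φ : (Fin m → ℤ) → E → ℂ} (hφ : ∀ k, Integrable (φ k) μ) (n : Fin m → ℤ) :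
    lap (fun k => ∫ w, φ k w ∂μ) n = ∫ w, lap (fun k => φ k w) n ∂μ := by
  simp only [lap]
  have hs : ∀ k, Integrable (fun w => φ n w - φ k w) μ := fun k => (hφ n).sub (hφ k)
  have hs' : ∀ k k', Integrable (fun w => (φ n w - φ k w) + (φ n w - φ k' w)) μ :=
    fun k k' => (hs k).add (hs k')
  refine Eq.trans ?_ (integral_finsetSum Finset.univ fun j _ =>
    hs' (n + Pi.single j 1) (n - Pi.single j 1)).symm
  refine Finset.sum_congr rfl fun j _ => ?_
  rw [integral_add (hs _) (hs _), integral_sub (hφ _) (hφ _), integral_sub (hφ _) (hφ _)]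

/-- Summation by parts for the integrated terms. The coefficients need not decay: the oscillatory
integrals supply the convergence. -/
theorem tsum_integral_charWeight_mul {v : Fin m → E} (hv : ∀ j, u (v j) = Pi.single j 1)
    (hO : IsOpen O) (hg : DecayFamily O 0 g) (hΘ : ContDiff ℝ ∞ Θ) (hc : HasCompactSupport Θ)
    (hs : tsupport Θ ⊆ O) (hlin : ∀ w (c : ℂ) x, Θ w (c • x) = c * Θ w x) :
    ∑' n, ∫ w, charWeight u w * Θ w (char u n w • g n w) ∂μ =
      ∑' n, ∫ w, Θ w (char u n w • lap g n w) ∂μ := by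
  have hT : TestFamily (tsupport Θ) 0 fun n w => Θ w (g n w) := hg.testFamily hO hΘ hc hs
  have hz : ∀ n, ∀ w ∉ tsupport Θ, Θ w (g n w) = 0 := hT.2.1
  let c : (Fin m → ℤ) → (Fin m → ℤ) → ℂ := fun k n => ∫ w, char u k w * Θ w (g n w) ∂μ
  have hi : ∀ k n, Integrable (fun w => char u k w * Θ w (g n w)) μ := fun k n =>
    integrable_of_eq_zero ((contDiff_char u k).continuous.mul (hT.1 n).continuous) hc
      fun w hw => by rw [hz n w hw, mul_zero]
  -- A translation turns a shifted diagonal into the oscillatory series of the shifted family, which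
  -- satisfies the same bounds.
  have hsum : ∀ v', Summable fun n => c (n + v') n := by
    intro v'
    have h1 := ((hg.comp_add (-v')).testFamily hO hΘ hc hs).summable_integral_char_mul (μ := μ)
      u hv hc
    have h2 := (Equiv.addRight v').summable_iff.2 h1
    refine h2.congr fun n => ?_
    simp [c]
  have h := (hasSum_lap hsum).2.2
  have hl : ∀ n, lap (fun k => c k n) n =
      ∫ w, charWeight u w * Θ w (char u n w • g n w) ∂μ := by
    intro n
    rw [lap_integral fun k => hi k n]
    refine integral_congr_ae (Filter.Eventually.of_forall fun w => ?_)
    have h1 := congrFun (map_lap (AddMonoidHom.mulRight (Θ w (g n w))) fun k => char u k w) n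
    simp only [AddMonoidHom.mulRight_apply] at h1
    simp only [hlin, h1, lap_char, mul_assoc]
  have hr : ∀ n, lap (fun k => c n k) n = ∫ w, Θ w (char u n w • lap g n w) ∂μ := by
    intro n
    rw [lap_integral fun k => hi n k]
    refine integral_congr_ae (Filter.Eventually.of_forall fun w => ?_)
    have h1 := congrFun (map_lap (((AddMonoidHom.mulLeft (char u n w)).comp
      (Θ w).toLinearMap.toAddMonoidHom).comp (Pi.evalAddMonoidHom (fun _ : E => G) w)) g) n
    simp only [hlin]
    exact h1
  simpa only [hl, hr] using h

theorem IsSymbol.decayFamily (hg : IsSymbol O g) : DecayFamily O 0 g := hg 0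

theorem isSymbol_lap (hg : IsSymbol O g) : IsSymbol O (lap g) := fun N =>
  (hg (N + 1)).mono (by omega)

theorem contDiff_charWeight_pow_smul (hΘ : ContDiff ℝ ∞ Θ) (N : ℕ) :
    ContDiff ℝ ∞ fun w => charWeight u w ^ N • Θ w :=
  ((contDiff_charWeight u).pow N).smul hΘ

theorem tsum_integral_charWeight_pow_mul {v : Fin m → E} (hv : ∀ j, u (v j) = Pi.single j 1)
    (hO : IsOpen O) (hΘ : ContDiff ℝ ∞ Θ) (hc : HasCompactSupport Θ)
    (hs : tsupport Θ ⊆ O) (hlin : ∀ w (c : ℂ) x, Θ w (c • x) = c * Θ w x) (N : ℕ) :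
    ∀ {g : (Fin m → ℤ) → E → G}, IsSymbol O g →
    ∑' n, ∫ w, charWeight u w ^ N * Θ w (char u n w • g n w) ∂μ =
      ∑' n, ∫ w, Θ w (char u n w • lap^[N] g n w) ∂μ := by
  induction N with
  | zero => intro g _; simp
  | succ N ih =>
    intro g hg
    -- The powers of the weight already present are absorbed into the kernel, so that the one-step
    -- identity applies.
    let Θ' : E → G →L[ℝ] ℂ := fun w => charWeight u w ^ N • Θ w
    have happ : ∀ w x, Θ' w x = charWeight u w ^ N * Θ w x := fun w x => rfl
    have hsub : tsupport Θ' ⊆ tsupport Θ := closure_mono fun w hw h =>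
      hw (ContinuousLinearMap.ext fun x => by rw [happ, h]; simp)
    have hc' : HasCompactSupport Θ' := hc.mono' (subset_closure.trans hsub)
    have hlin' : ∀ w (c : ℂ) x, Θ' w (c • x) = c * Θ' w x := fun w c x => by
      rw [happ, happ, hlin]
      ring
    have h1 := tsum_integral_charWeight_mul (μ := μ) (Θ := Θ') u hv hO hg.decayFamily
      (contDiff_charWeight_pow_smul u hΘ N) hc' (hsub.trans hs) hlin'
    simp only [happ] at h1
    rw [Function.iterate_succ_apply, ← ih (isSymbol_lap hg), ← h1]
    simp only [pow_succ', mul_assoc]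

/-- The sum of the series `∑_n χ_n g_n`, regularised by summation by parts. -/
def regSum (N : ℕ) (g : (Fin m → ℤ) → E → G) (w : E) : G :=
  (charWeight u w)⁻¹ ^ N • ∑' n, char u n w • lap^[N] g n w

theorem IsSymbol.summable_char_smul [CompleteSpace G] (hg : IsSymbol O g) {N : ℕ}
    (hN : m + 1 ≤ 2 * N) {w : E} (hw : w ∈ O) (v : Fin m → ℤ) :
    Summable fun n => char u (n + v) w • lap^[N] g n w := by
  obtain ⟨C, hC⟩ := (hg N).mono hN |>.2 {w} (by simpa) isCompact_singleton 0
  refine Summable.of_norm_bounded (summable_inv_one_add_norm_pow.mul_left C) fun n => ?_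
  rw [norm_smul, norm_char, one_mul]
  simpa using hC n w rfl

/-- One further summation by parts, now pointwise since the series converges absolutely: it produces
a factor `charWeight`, which cancels one inverse. -/
theorem IsSymbol.regSum_succ [CompleteSpace G] (hg : IsSymbol O g) {N : ℕ} (hN : m + 1 ≤ 2 * N)
    {w : E} (hw : w ∈ O) (h0 : charWeight u w ≠ 0) : regSum u (N + 1) g w = regSum u N g w := by
  have h := (hasSum_lap (c := fun k n => char u k w • lap^[N] g n w)
    fun v => hg.summable_char_smul u hN hw v).2.2
  have hl : ∀ n, lap (fun k => char u k w • lap^[N] g n w) n =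
      charWeight u w • char u n w • lap^[N] g n w := by
    intro n
    rw [smul_smul, ← lap_char]
    exact congrFun (map_lap ((smulAddHom ℂ G).flip (lap^[N] g n w)) fun k => char u k w) n
  have hr : ∀ n, lap (fun k => char u n w • lap^[N] g k w) n =
      char u n w • lap^[N + 1] g n w := by
    intro n
    rw [Function.iterate_succ_apply']
    exact congrFun (map_lap ((smulAddHom ℂ G (char u n w)).comp
      (Pi.evalAddMonoidHom (fun _ : E => G) w)) (lap^[N] g)) n
  simp only [hl, hr] at h
  rw [tsum_const_smul''] at h
  rw [regSum, regSum, ← h, smul_smul, pow_succ, mul_assoc, inv_mul_cancel₀ h0, mul_one]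

theorem IsSymbol.regSum_add [CompleteSpace G] (hg : IsSymbol O g) {N : ℕ} (hN : m + 1 ≤ 2 * N)
    {w : E} (hw : w ∈ O) (h0 : charWeight u w ≠ 0) (k : ℕ) :
    regSum u (N + k) g w = regSum u N g w := by
  induction k with
  | zero => rfl
  | succ k ih => rw [← add_assoc, hg.regSum_succ u (by omega) hw h0, ih]

/-- To see that the sum is `C^k` near a point, `N` is replaced by `N + (k + m + 1)`. This does not
change the sum off the zeros of the weight and provides enough decay to differentiate `k` times term
by term. -/
theorem IsSymbol.contDiffOn_regSum [CompleteSpace G] (hg : IsSymbol O g) (hO : IsOpen O) {N : ℕ}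
    (hN : m + 1 ≤ 2 * N) : ContDiffOn ℝ ∞ (regSum u N g) (O ∩ {w | charWeight u w ≠ 0}) := by
  have hO' : IsOpen (O ∩ {w | charWeight u w ≠ 0}) :=
    hO.inter (isOpen_compl_singleton.preimage (contDiff_charWeight u).continuous)
  refine contDiffOn_infty.2 fun k w hw => ContDiffAt.contDiffWithinAt ?_
  obtain ⟨ψ, hψc, hψ, hψs, hψ1⟩ : ∃ ψ : E → ℝ, HasCompactSupport ψ ∧
      ContDiff ℝ ∞ ψ ∧ tsupport ψ ⊆ O ∧ ∀ᶠ x in nhds w, ψ x = 1 := by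
    obtain ⟨ε, hε, hεO⟩ := Metric.nhds_basis_closedBall.mem_iff.1 (hO.mem_nhds hw.1)
    let b : ContDiffBump w := ⟨ε / 2, ε, half_pos hε, half_lt_self hε⟩
    exact ⟨b, b.hasCompactSupport, b.contDiff, by rwa [b.tsupport_eq],
      b.eventuallyEq_one⟩
  have hk : m + 1 ≤ 2 * (N + (k + m + 1)) := by omega
  -- The bump function makes the locally uniform bounds global, as term by term differentiation
  -- requires, and changes nothing near `w`.
  let Ψ : E → G →L[ℝ] G := fun x => ψ x • ContinuousLinearMap.id ℝ G
  have hT := (hg (N + (k + m + 1))).testFamily (Θ := Ψ) hO (hψ.smul contDiff_const)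
    hψc.smul_right ((tsupport_smul_subset_left _ _).trans hψs)
  have hsm := contDiff_tsum_char_smul u (k := k) (by omega) hT
  have hsm' : ContDiffAt ℝ k (fun w => (charWeight u w)⁻¹ ^ (N + (k + m + 1)) •
      ∑' n, char u n w • Ψ w (lap^[N + (k + m + 1)] g n w)) w :=
    ((((contDiff_charWeight u).contDiffAt.of_le (by exact_mod_cast le_top)).inv hw.2).pow _).smul
      hsm.contDiffAt
  refine hsm'.congr_of_eventuallyEq ?_
  filter_upwards [hO'.mem_nhds hw, hψ1] with x hx hx1
  rw [← hg.regSum_add u hN hx.1 hx.2 (k + m + 1), regSum]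
  simp [Ψ, hx1]

/-- The support of the kernel avoids the zeros of the weight, so the kernel is `charWeight ^ N`
times another test kernel `Θ'`. Moving the weight onto the coefficients leaves an absolutely
convergent series, for which sum and integral may be exchanged. -/
theorem IsSymbol.tsum_integral_eq [CompleteSpace G] {v : Fin m → E}
    (hv : ∀ j, u (v j) = Pi.single j 1)
    (hg : IsSymbol O g) (hO : IsOpen O) (hΘ : ContDiff ℝ ∞ Θ) (hc : HasCompactSupport Θ)
    (hs : tsupport Θ ⊆ O ∩ {w | charWeight u w ≠ 0})
    (hlin : ∀ w (c : ℂ) x, Θ w (c • x) = c * Θ w x) {N : ℕ} (hN : m + 1 ≤ 2 * N) :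
    ∑' n, ∫ w, Θ w (char u n w • g n w) ∂μ = ∫ w, Θ w (regSum u N g w) ∂μ := by
  have hO' : IsOpen (O ∩ {w | charWeight u w ≠ 0}) :=
    hO.inter (isOpen_compl_singleton.preimage (contDiff_charWeight u).continuous)
  let Θ' : E → G →L[ℝ] ℂ := fun w => (charWeight u w)⁻¹ ^ N • Θ w
  have happ : ∀ w x, Θ' w x = (charWeight u w)⁻¹ ^ N * Θ w x := fun w x => rfl
  have hsub : tsupport Θ' ⊆ tsupport Θ := closure_mono fun w hw h =>
      hw (ContinuousLinearMap.ext fun x => by rw [happ, h]; simp)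
  have hs' : tsupport Θ' ⊆ O ∩ {w | charWeight u w ≠ 0} := hsub.trans hs
  have hΘ' : ContDiff ℝ ∞ Θ' := by
    refine contDiff_of_contDiffOn_of_tsupport hO' (ContDiffOn.smul (ContDiffOn.pow
      (ContDiffOn.inv (contDiff_charWeight u).contDiffOn fun w hw => hw.2) N) hΘ.contDiffOn) hs'
  have hc' : HasCompactSupport Θ' := hc.mono' (subset_closure.trans hsub)
  have hlin' : ∀ w (c : ℂ) x, Θ' w (c • x) = c * Θ' w x := fun w c x => by
    rw [happ, happ, hlin]
    ring
  -- At the zeros of the weight both sides vanish because `Θ` does.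
  have hfac : ∀ w x, Θ w x = charWeight u w ^ N * Θ' w x := by
    intro w x
    by_cases hw : charWeight u w = 0
    · have : Θ w = 0 := image_eq_zero_of_notMem_tsupport fun h => (hs h).2 hw
      rw [happ, this]
      simp
    · simp only [happ]
      rw [← mul_assoc, ← mul_pow, mul_inv_cancel₀ hw, one_pow, one_mul]
  have h1 := tsum_integral_charWeight_pow_mul (μ := μ) u hv hO hΘ' hc'
    (hs'.trans Set.inter_subset_left) hlin' N hg
  have hT : TestFamily (tsupport Θ') (m + 1) fun n w => Θ' w (lap^[N] g n w) :=
    ((hg N).mono hN).testFamily hO hΘ' hc' (hs'.trans Set.inter_subset_left)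
  have hz : ∀ n, ∀ w ∉ tsupport Θ', Θ' w (lap^[N] g n w) = 0 := hT.2.1
  obtain ⟨C, hC⟩ := hT.2.2 0
  have hreg : ∀ w, Θ w (regSum u N g w) = ∑' n, Θ' w (char u n w • lap^[N] g n w) := by
    intro w
    by_cases hw : w ∈ tsupport Θ'
    · have h2 := hg.summable_char_smul u hN (hs' hw).1 0
      simp only [add_zero] at h2
      rw [← (Θ' w).map_tsum h2, regSum, hlin]
      rw [happ]
    · have h3 : Θ' w = 0 := image_eq_zero_of_notMem_tsupport hw
      rw [hfac, h3]
      simp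
  simp only [hreg]
  rw [← integral_tsum_of_summable_integral_norm]
  · simp only [← h1, ← hfac]
  · intro n
    simp only [hlin']
    exact integrable_of_eq_zero ((contDiff_char u n).continuous.mul (hT.1 n).continuous) hc'
      fun w hw => by rw [hz n w hw, mul_zero]
  · refine Summable.of_norm_bounded
      (summable_inv_one_add_norm_pow.mul_left (C * μ.real (tsupport Θ'))) fun n => ?_
    rw [← setIntegral_eq_integral_of_forall_compl_eq_zero (s := tsupport Θ')
      fun w hw => by rw [image_eq_zero_of_notMem_tsupport hw]; simp]
    refine (norm_setIntegral_le_of_norm_le_const (C := C * (1 + ‖n‖)⁻¹ ^ (m + 1))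
      hc'.measure_lt_top fun w _ => ?_).trans (le_of_eq (by ring))
    rw [norm_norm, hlin', norm_mul, norm_char, one_mul]
    simpa using hC n w

end Oscillatory

/-! ### Exterior algebra -/

section Exterior

variable {E E' : Type} [NormedAddCommGroup E] [NormedSpace ℝ E] [NormedAddCommGroup E']
  [NormedSpace ℝ E'] {p q : ℕ}

theorem wedge_apply (α : E [⋀^Fin p]→L[ℝ] ℂ) (β : E [⋀^Fin q]→L[ℝ] ℂ) (v : Fin (p + q) → E) :
    wedge α β v = ((p.factorial * q.factorial : ℝ)⁻¹) • ∑ σ : Equiv.Perm (Fin (p + q)),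
      Equiv.Perm.sign σ • (α (fun i => v (σ (finSumFinEquiv (Sum.inl i)))) *
        β (fun i => v (σ (finSumFinEquiv (Sum.inr i))))) := by
  rw [wedge, ContinuousAlternatingMap.smul_apply,
    ContinuousMultilinearMap.alternatization_apply_apply]
  rfl

theorem wedge_compContinuousLinearMap (α : E [⋀^Fin p]→L[ℝ] ℂ) (β : E [⋀^Fin q]→L[ℝ] ℂ)
    (f : E' →L[ℝ] E) : (wedge α β).compContinuousLinearMap f =
      wedge (α.compContinuousLinearMap f) (β.compContinuousLinearMap f) := by
  ext v
  rw [ContinuousAlternatingMap.compContinuousLinearMap_apply, wedge_apply, wedge_apply]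
  rfl

/-- The linear form `α ↦ (α ∧ β)(v)`. -/
def wedgeEval (v : Fin (p + q) → E) :
    (E [⋀^Fin q]→L[ℝ] ℂ) →ₗ[ℝ] (E [⋀^Fin p]→L[ℝ] ℂ) →ₗ[ℝ] ℂ :=
  LinearMap.mk₂ ℝ (fun β α => wedge α β v)
    (fun β β' α => by
      simp only [wedge_apply, ContinuousAlternatingMap.add_apply, mul_add, smul_add,
        Finset.sum_add_distrib])
    (fun c β α => by
      simp only [wedge_apply, ContinuousAlternatingMap.smul_apply, mul_smul_comm]
      simp only [smul_comm _ c, ← Finset.smul_sum])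
    (fun β α α' => by
      simp only [wedge_apply, ContinuousAlternatingMap.add_apply, add_mul, smul_add,
        Finset.sum_add_distrib])
    (fun c β α => by
      simp only [wedge_apply, ContinuousAlternatingMap.smul_apply, smul_mul_assoc]
      simp only [smul_comm _ c, ← Finset.smul_sum])

theorem wedgeEval_apply (v : Fin (p + q) → E) (α : E [⋀^Fin p]→L[ℝ] ℂ)
    (β : E [⋀^Fin q]→L[ℝ] ℂ) : wedgeEval v β α = wedge α β v := rfl

theorem wedgeEval_smul (v : Fin (p + q) → E) (c : ℂ) (α : E [⋀^Fin p]→L[ℝ] ℂ)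
    (β : E [⋀^Fin q]→L[ℝ] ℂ) : wedgeEval v β (c • α) = c * wedgeEval v β α := by
  simp only [wedgeEval_apply, wedge_apply, ContinuousAlternatingMap.smul_apply, smul_mul_assoc]
  simp only [smul_eq_mul, ← mul_smul_comm, ← Finset.mul_sum]

theorem wedgePow_compContinuousLinearMap (α : E [⋀^Fin 2]→L[ℝ] ℂ) (f : E' →L[ℝ] E) (k : ℕ) :
    (wedgePow α k).compContinuousLinearMap f = wedgePow (α.compContinuousLinearMap f) k := by
  induction k with
  | zero => rfl
  | succ k ih =>
    change (wedge (wedgePow α k) α).compContinuousLinearMap f = _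
    rw [wedge_compContinuousLinearMap, ih]
    rfl

theorem contractSucc_compContinuousLinearMap (v : E' × E') (α : E [⋀^Fin (p + 1)]→L[ℝ] ℂ)
    (f : E' →L[ℝ] E) : (contractSucc (f v.1, f v.2) α).compContinuousLinearMap f =
      contractSucc v (α.compContinuousLinearMap f) := by
  simp only [contractSucc, ContinuousAlternatingMap.curryLeft_compContinuousLinearMap]
  rfl

theorem contract_compContinuousLinearMap (v : E' × E') (α : E [⋀^Fin p]→L[ℝ] ℂ)
    (f : E' →L[ℝ] E) : (contract (f v.1, f v.2) α).compContinuousLinearMap f =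
      contract v (α.compContinuousLinearMap f) := by
  cases p with
  | zero => rfl
  | succ p => exact contractSucc_compContinuousLinearMap v α f

theorem contractSucc_smul_smul (s t : ℝ) (v : E × E) (α : E [⋀^Fin (p + 1)]→L[ℝ] ℂ) :
    contractSucc (s • v) (t • α) = (s * t) • contractSucc v α := by
  ext w
  simp only [contractSucc, ContinuousAlternatingMap.add_apply,
    ContinuousAlternatingMap.smul_apply, ContinuousAlternatingMap.curryLeft_apply_apply,
    Prod.smul_fst, Prod.smul_snd, map_smul, ContinuousAlternatingMap.curryLeft_smul,
    smul_apply, smul_eq_mul, Complex.real_smul]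
  push_cast
  ring

theorem contract_smul_smul (s t : ℝ) (v : E × E) (α : E [⋀^Fin p]→L[ℝ] ℂ) :
    contract (s • v) (t • α) = (s * t) • contract v α := by
  cases p with
  | zero => exact (smul_zero (A := E [⋀^Fin (0 - 1)]→L[ℝ] ℂ) (s * t)).symm
  | succ p => exact contractSucc_smul_smul s t v α

theorem contDiff_contractSucc : ContDiff ℝ ∞
    fun x : (E × E) × (E [⋀^Fin (p + 1)]→L[ℝ] ℂ) => contractSucc x.1 x.2 := by
  let L : (E [⋀^Fin (p + 1)]→L[ℝ] ℂ) →L[ℝ] (E →L[ℝ] E [⋀^Fin p]→L[ℝ] ℂ) :=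
    (ContinuousAlternatingMap.curryLeftLI
      (𝕜 := ℝ) (E := E) (F := ℂ) (n := p)).toContinuousLinearMap
  have h : ContDiff ℝ ∞ fun α : E [⋀^Fin (p + 1)]→L[ℝ] ℂ => α.curryLeft := by
    change ContDiff ℝ ∞ fun α => L α
    fun_prop
  have h1 : ContDiff ℝ ∞ fun x : (E × E) × (E [⋀^Fin (p + 1)]→L[ℝ] ℂ) => x.2.curryLeft x.1.1 :=
    (h.comp contDiff_snd).clm_apply (contDiff_fst.comp contDiff_fst)
  have h2 : ContDiff ℝ ∞ fun x : (E × E) × (E [⋀^Fin (p + 1)]→L[ℝ] ℂ) => x.2.curryLeft x.1.2 :=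
    (h.comp contDiff_snd).clm_apply (contDiff_snd.comp contDiff_fst)
  exact h1.add (h2.const_smul Complex.I)

theorem contDiff_contract : ContDiff ℝ ∞
    fun x : (E × E) × (E [⋀^Fin p]→L[ℝ] ℂ) => contract x.1 x.2 := by
  cases p with
  | zero => exact contDiff_const
  | succ p => exact contDiff_contractSucc

/-! ### Smoothness of form valued maps in finite dimension -/

section FiniteDimensional

variable [FiniteDimensional ℝ E]

/-- A form is determined by its values on tuples of basis vectors. A linear left inverse of this
evaluation reduces smoothness of form valued maps to that of scalar functions. -/
theorem exists_evaluation_inverse (p : ℕ) :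
    ∃ (κ : Type) (_ : Fintype κ) (v : κ → Fin p → E) (L : (κ → ℂ) →L[ℝ] E [⋀^Fin p]→L[ℝ] ℂ),
      ∀ α : E [⋀^Fin p]→L[ℝ] ℂ, L (fun k => α (v k)) = α := by
  let b := Module.finBasis ℝ E
  let κ := Fin p → Fin (Module.finrank ℝ E)
  let ev : (E [⋀^Fin p]→L[ℝ] ℂ) →ₗ[ℝ] (κ → ℂ) :=
    { toFun := fun α k => α fun i => b (k i)
      map_add' := fun _ _ => rfl
      map_smul' := fun _ _ => rfl }
  have hinj : LinearMap.ker ev = ⊥ := by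
    refine LinearMap.ker_eq_bot.2 fun α β h => ?_
    apply ContinuousAlternatingMap.toAlternatingMap_injective
    refine AlternatingMap.coe_multilinearMap_injective (Module.Basis.ext_multilinear (fun _ => b)
      fun k => ?_)
    exact congrFun h k
  obtain ⟨L, hL⟩ := ev.exists_leftInverse_of_injective hinj
  exact ⟨κ, inferInstance, fun k i => b (k i), LinearMap.toContinuousLinearMap L,
    fun α => LinearMap.congr_fun hL α⟩

instance finiteDimensional_alternating : FiniteDimensional ℝ (E [⋀^Fin p]→L[ℝ] ℂ) := by
  obtain ⟨κ, _, v, L, hL⟩ := exists_evaluation_inverse (E := E) p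
  exact FiniteDimensional.of_surjective L.toLinearMap fun α => ⟨_, hL α⟩

variable {P : Type*} [NormedAddCommGroup P] [NormedSpace ℝ P] {s : Set P}

theorem contDiffOn_alternating_iff {α : P → E [⋀^Fin p]→L[ℝ] ℂ} :
    ContDiffOn ℝ ∞ α s ↔ ∀ v, ContDiffOn ℝ ∞ (fun x => α x v) s := by
  refine ⟨fun h v => ?_, fun h => ?_⟩
  · exact (ContinuousAlternatingMap.apply ℝ E ℂ v : _ →L[ℝ] ℂ).contDiff.comp_contDiffOn h
  · obtain ⟨κ, _, v, L, hL⟩ := exists_evaluation_inverse (E := E) p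
    have h1 : ContDiffOn ℝ ∞ (fun x k => α x (v k)) s := contDiffOn_pi.2 fun k => h (v k)
    exact (L.contDiff.comp_contDiffOn h1).congr fun x _ => (hL (α x)).symm

theorem contDiffOn_compContinuousLinearMap [FiniteDimensional ℝ E'] {α : P → E [⋀^Fin p]→L[ℝ] ℂ}
    {f : P → E' →L[ℝ] E} (hα : ContDiffOn ℝ ∞ α s) (hf : ContDiffOn ℝ ∞ f s) :
    ContDiffOn ℝ ∞ (fun x => (α x).compContinuousLinearMap (f x)) s := by
  rw [contDiffOn_alternating_iff]
  intro v
  have h1 : ContDiffOn ℝ ∞ (fun x => (α x).toContinuousMultilinearMap) s :=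
    (ContinuousAlternatingMap.toContinuousMultilinearMapLI
      (𝕜 := ℝ) (E := E) (F := ℂ) (ι := Fin p)).contDiff.comp_contDiffOn hα
  have h2 : ContDiffOn ℝ ∞ (fun x =>
      ContinuousMultilinearMap.compContinuousLinearMapContinuousMultilinear ℝ
        (fun _ : Fin p => E') (fun _ => E) ℂ fun _ => f x) s :=
    (ContinuousMultilinearMap.contDiff _).comp_contDiffOn (contDiffOn_pi.2 fun _ => hf)
  exact (ContinuousMultilinearMap.apply ℝ (fun _ : Fin p => E') ℂ v).contDiff.comp_contDiffOn
    (h2.clm_apply h1)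

end FiniteDimensional

end Exterior

/-! ### Calculus of homogeneous functions -/

section HomogCalculus

variable {m : ℕ} {E G G' H : Type} [NormedAddCommGroup E] [NormedSpace ℝ E]
  [NormedAddCommGroup G] [NormedSpace ℝ G] [NormedAddCommGroup G'] [NormedSpace ℝ G']
  [NormedAddCommGroup H] [NormedSpace ℝ H]

/-- `h` is smooth on `(ℝ^m ∖ 0) × O` and homogeneous of degree `e` in the first variable. -/
def HomogOn (O : Set E) (e : ℤ) (h : (Fin m → ℝ) → E → G) : Prop :=
  ContDiffOn ℝ ∞ (fun p : (Fin m → ℝ) × E => h p.1 p.2) ({0}ᶜ ×ˢ O) ∧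
    ∀ t : ℝ, 0 < t → ∀ ξ, ξ ≠ 0 → ∀ w ∈ O, h (t • ξ) w = t ^ e • h ξ w

variable {O : Set E} {e e' : ℤ} {h : (Fin m → ℝ) → E → G} {h' : (Fin m → ℝ) → E → G'}

/-- Integer degrees serve the intermediate bookkeeping, where numerators have positive degree; the
decay estimates only see the final negative degree. -/
theorem HomogOn.isHomog {q : ℕ} (hh : HomogOn O (-q : ℤ) h) : IsHomog O q h := by
  refine ⟨hh.1, fun t ht ξ hξ w hw => ?_⟩
  rw [hh.2 t ht ξ hξ w hw, smul_smul, zpow_neg, zpow_natCast,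
    mul_inv_cancel₀ (pow_ne_zero _ ht.ne'), one_smul]

theorem HomogOn.congr {g : (Fin m → ℝ) → E → G} (hh : HomogOn O e h)
    (hg : ∀ ξ, ξ ≠ 0 → ∀ w ∈ O, g ξ w = h ξ w) : HomogOn O e g :=
  ⟨hh.1.congr fun p hp => hg p.1 hp.1 p.2 hp.2, fun t ht ξ hξ w hw => by
    rw [hg _ (smul_ne_zero ht.ne' hξ) w hw, hg ξ hξ w hw, hh.2 t ht ξ hξ w hw]⟩

theorem homogOn_const {f : E → G} (hf : ContDiffOn ℝ ∞ f O) :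
    HomogOn (m := m) O 0 fun _ w => f w :=
  ⟨hf.comp contDiff_snd.contDiffOn fun _ hp => hp.2, fun t _ ξ _ w _ => by simp⟩

theorem homogOn_linear {L : E → (Fin m → ℝ) →L[ℝ] G} (hL : ContDiffOn ℝ ∞ L O) :
    HomogOn O 1 fun ξ w => L w ξ :=
  ⟨(hL.comp contDiff_snd.contDiffOn fun _ hp => hp.2).clm_apply contDiff_fst.contDiffOn,
    fun t _ ξ _ w _ => by simp⟩

theorem HomogOn.map (hh : HomogOn O e h) (L : G →L[ℝ] H) : HomogOn O e fun ξ w => L (h ξ w) :=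
  ⟨L.contDiff.comp_contDiffOn hh.1, fun t ht ξ hξ w hw => by
    beta_reduce
    rw [hh.2 t ht ξ hξ w hw, map_smul]⟩

/-- Smoothness and compatibility with real scalars are all that is required of `f`; products, scalar
multiplication and contractions are instances. -/
theorem HomogOn.map₂ (hh : HomogOn O e h) (hh' : HomogOn O e' h') (f : G → G' → H)
    (hf : ContDiff ℝ ∞ fun x : G × G' => f x.1 x.2)
    (hs : ∀ (s t : ℝ) x y, f (s • x) (t • y) = (s * t) • f x y) :
    HomogOn O (e + e') fun ξ w => f (h ξ w) (h' ξ w) :=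
  ⟨hf.comp_contDiffOn (hh.1.prodMk hh'.1), fun t ht ξ hξ w hw => by
    beta_reduce
    rw [hh.2 t ht ξ hξ w hw, hh'.2 t ht ξ hξ w hw, hs, zpow_add₀ ht.ne']⟩

theorem HomogOn.add {g : (Fin m → ℝ) → E → G} (hh : HomogOn O e h) (hg : HomogOn O e g) :
    HomogOn O e fun ξ w => h ξ w + g ξ w :=
  ⟨hh.1.add hg.1, fun t ht ξ hξ w hw => by
    beta_reduce
    rw [hh.2 t ht ξ hξ w hw, hg.2 t ht ξ hξ w hw, smul_add]⟩

theorem HomogOn.sum {ι : Type*} (s : Finset ι) {h : ι → (Fin m → ℝ) → E → G}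
    (hh : ∀ i ∈ s, HomogOn O e (h i)) : HomogOn O e fun ξ w => ∑ i ∈ s, h i ξ w :=
  ⟨ContDiffOn.sum fun i hi => (hh i hi).1, fun t ht ξ hξ w hw => by
    rw [Finset.smul_sum]
    exact Finset.sum_congr rfl fun i hi => (hh i hi).2 t ht ξ hξ w hw⟩

theorem HomogOn.prodMk (hh : HomogOn O e h) (hh' : HomogOn O e h') :
    HomogOn O e fun ξ w => (h ξ w, h' ξ w) :=
  ⟨hh.1.prodMk hh'.1, fun t ht ξ hξ w hw => by
    beta_reduce
    rw [hh.2 t ht ξ hξ w hw, hh'.2 t ht ξ hξ w hw, Prod.smul_mk]⟩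

theorem HomogOn.mul {f g : (Fin m → ℝ) → E → ℂ} (hf : HomogOn O e f) (hg : HomogOn O e' g) :
    HomogOn O (e + e') fun ξ w => f ξ w * g ξ w :=
  hf.map₂ hg (fun x y => x * y) (contDiff_fst.mul contDiff_snd) fun s t x y => by
    simp only [Complex.real_smul]
    push_cast
    ring

theorem HomogOn.smul [NormedSpace ℂ G] [IsScalarTower ℝ ℂ G] {f : (Fin m → ℝ) → E → ℂ}
    (hf : HomogOn O e f) (hh : HomogOn O e' h) : HomogOn O (e + e') fun ξ w => f ξ w • h ξ w :=
  hf.map₂ hh (fun x y => x • y) (contDiff_fst.smul contDiff_snd) fun s t x y => by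
    rw [smul_assoc, smul_comm x t y, smul_smul]

theorem HomogOn.inv_pow {f : (Fin m → ℝ) → E → ℂ} (hf : HomogOn O e f)
    (h0 : ∀ ξ, ξ ≠ 0 → ∀ w ∈ O, f ξ w ≠ 0) (n : ℕ) :
    HomogOn O (-(n * e)) fun ξ w => (f ξ w ^ n)⁻¹ := by
  refine ⟨ContDiffOn.inv (hf.1.pow n) fun p hp => pow_ne_zero _ (h0 p.1 hp.1 p.2 hp.2),
    fun t ht ξ hξ w hw => ?_⟩
  beta_reduce
  rw [hf.2 t ht ξ hξ w hw, Complex.real_smul, Complex.real_smul, mul_pow, mul_inv, zpow_neg,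
    mul_comm (n : ℤ), zpow_mul, zpow_natCast]
  push_cast
  rfl

theorem HomogOn.fderiv_right (hh : HomogOn O e h) (hO : IsOpen O) :
    HomogOn O e fun ξ w => fderiv ℝ (h ξ) w := by
  have hd : ∀ ξ, ξ ≠ 0 → ∀ w ∈ O, HasFDerivAt (h ξ)
      ((fderiv ℝ (fun p : (Fin m → ℝ) × E => h p.1 p.2) (ξ, w)).comp
        (ContinuousLinearMap.inr ℝ _ _)) w := by
    intro ξ hξ w hw
    have h1 : DifferentiableAt ℝ (fun p : (Fin m → ℝ) × E => h p.1 p.2) (ξ, w) :=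
      (hh.1.differentiableOn (by simp)).differentiableAt
        ((isOpen_compl_zero_prod hO).mem_nhds ⟨hξ, hw⟩)
    exact HasFDerivAt.comp (g := fun p : (Fin m → ℝ) × E => h p.1 p.2) (f := fun w => (ξ, w)) w
      h1.hasFDerivAt (hasFDerivAt_prodMk_right ξ w)
  constructor
  · have h1 : ContDiffOn ℝ ∞ (fun p => (fderiv ℝ (fun p : (Fin m → ℝ) × E => h p.1 p.2) p).comp
        (ContinuousLinearMap.inr ℝ (Fin m → ℝ) E)) ({0}ᶜ ×ˢ O) :=
      (hh.1.fderiv_of_isOpen (isOpen_compl_zero_prod hO) (by simp)).clm_comp contDiffOn_const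
    exact h1.congr fun p hp => (hd p.1 hp.1 p.2 hp.2).fderiv
  · intro t ht ξ hξ w hw
    have h1 : h (t • ξ) =ᶠ[nhds w] fun w => t ^ e • h ξ w := by
      filter_upwards [hO.mem_nhds hw] with w' hw' using hh.2 t ht ξ hξ w' hw'
    beta_reduce
    rw [h1.fderiv_eq, fderiv_fun_const_smul (hd ξ hξ w hw).differentiableAt]

/-! #### Exterior calculus with parameters -/

variable {p : ℕ} {α : (Fin m → ℝ) → E → E [⋀^Fin p]→L[ℝ] ℂ}

/-- The exterior derivative is taken in `w`, with `ξ` a parameter, so the degree does not change. -/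
theorem HomogOn.extDeriv (hα : HomogOn O e α) (hO : IsOpen O) :
    HomogOn O e fun ξ w => _root_.extDeriv (α ξ) w :=
  (hα.fderiv_right hO).map (ContinuousAlternatingMap.alternatizeUncurryFinCLM ℝ E ℂ)

theorem HomogOn.contractSucc {α : (Fin m → ℝ) → E → E [⋀^Fin (p + 1)]→L[ℝ] ℂ}
    {Z : (Fin m → ℝ) → E → E × E} (hZ : HomogOn O e Z) (hα : HomogOn O e' α) :
    HomogOn O (e + e') fun ξ w => Polylog.contractSucc (Z ξ w) (α ξ w) :=
  hZ.map₂ hα Polylog.contractSucc contDiff_contractSucc contractSucc_smul_smul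

theorem HomogOn.contract {Z : (Fin m → ℝ) → E → E × E} (hZ : HomogOn O e Z)
    (hα : HomogOn O e' α) : HomogOn O (e + e') fun ξ w => Polylog.contract (Z ξ w) (α ξ w) :=
  hZ.map₂ hα (fun x y => Polylog.contract x y) contDiff_contract contract_smul_smul

/-- The Lie derivative on a vector space, given by Cartan's formula. -/
def lieFlat (Z : E → E × E) : {p : ℕ} → (E → E [⋀^Fin p]→L[ℝ] ℂ) → E → E [⋀^Fin p]→L[ℝ] ℂ
  | 0, β => fun w => Polylog.contractSucc (Z w) (_root_.extDeriv β w)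
  | _ + 1, β => fun w => _root_.extDeriv (fun w => Polylog.contractSucc (Z w) (β w)) w +
      Polylog.contractSucc (Z w) (_root_.extDeriv β w)

/-- Each summand of Cartan's formula contains `Z` exactly once. -/
theorem HomogOn.lieFlat {Z : (Fin m → ℝ) → E → E × E} (hZ : HomogOn O e Z)
    (hα : HomogOn O e' α) (hO : IsOpen O) :
    HomogOn O (e + e') fun ξ => Polylog.lieFlat (Z ξ) (α ξ) := by
  cases p with
  | zero => exact hZ.contractSucc (hα.extDeriv hO)
  | succ p => exact ((hZ.contractSucc hα).extDeriv hO).add (hZ.contractSucc (hα.extDeriv hO))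

theorem HomogOn.iterate_lieFlat {Z : (Fin m → ℝ) → E → E × E} (hZ : HomogOn O e Z)
    (hα : HomogOn O 0 α) (hO : IsOpen O) (k : ℕ) :
    HomogOn O (k * e) fun ξ => (Polylog.lieFlat (Z ξ))^[k] (α ξ) := by
  induction k with
  | zero => simpa using hα
  | succ k ih =>
    simp only [Function.iterate_succ_apply']
    have := hZ.lieFlat ih hO
    rwa [show e + k * e = (k + 1 : ℕ) * e by push_cast; ring] at this

/-! #### Polynomials with homogeneous coefficients -/

variable {σ : Type}

/-- All coefficients of the polynomial valued function `P` are homogeneous of degree `e`. -/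
def HomogCoeffOn (O : Set E) (e : ℤ) (P : (Fin m → ℝ) → E → MvPolynomial σ ℂ) : Prop :=
  ∀ μ, HomogOn O e fun ξ w => (P ξ w).coeff μ

theorem HomogCoeffOn.mul {P Q : (Fin m → ℝ) → E → MvPolynomial σ ℂ} (hP : HomogCoeffOn O e P)
    (hQ : HomogCoeffOn O e' Q) : HomogCoeffOn O (e + e') fun ξ w => P ξ w * Q ξ w := by
  classical
  intro μ
  simp only [MvPolynomial.coeff_mul]
  exact HomogOn.sum _ fun x _ => (hP x.1).mul (hQ x.2)

theorem HomogCoeffOn.pow {P : (Fin m → ℝ) → E → MvPolynomial σ ℂ} (hP : HomogCoeffOn O e P)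
    (n : ℕ) : HomogCoeffOn O (n * e) fun ξ w => P ξ w ^ n := by
  induction n with
  | zero =>
    intro μ
    simp only [pow_zero, Nat.cast_zero, zero_mul]
    exact homogOn_const contDiffOn_const
  | succ n ih =>
    have := ih.mul hP
    simp only [← pow_succ] at this
    rwa [show n * e + e = (n + 1 : ℕ) * e by push_cast; ring] at this

end HomogCalculus

/-! ### Smooth parametrisations and pull backs of forms -/

section Pull

variable {n p : ℕ} {M : Type*} [TopologicalSpace M] [ChartedSpace (Fin n → ℂ) M]

/-- The real derivative of a map from the model space, as an endomorphism of the model space. -/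
def realD (Ψ : (Fin n → ℂ) → M) (w : Fin n → ℂ) : (Fin n → ℂ) →L[ℝ] (Fin n → ℂ) :=
  mfderiv 𝓘(ℝ, Fin n → ℂ) 𝓘(ℝ, Fin n → ℂ) Ψ w

/-- The pull back of a form along a map from the model space. -/
def pull (Ψ : (Fin n → ℂ) → M) (α : DForm n p M) : DForm n p (Fin n → ℂ) := fun w =>
  (α (Ψ w)).compContinuousLinearMap
    (realD Ψ w)

/-- A local diffeomorphism from the open set `O` of the model space to `M`. -/
structure IsParam (Ψ : (Fin n → ℂ) → M) (O : Set (Fin n → ℂ)) : Prop where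
  isOpen : IsOpen O
  smooth : ContMDiffOn 𝓘(ℝ, Fin n → ℂ) 𝓘(ℝ, Fin n → ℂ) ∞ Ψ O
  injective : ∀ w ∈ O, Function.Injective (realD Ψ w)

/-- `T` is a diffeomorphism between open sets of the model space which expresses `Ψ` in the
chart `e`. -/
structure IsParamChart (Ψ : (Fin n → ℂ) → M) (O : Set (Fin n → ℂ))
    (e : OpenPartialHomeomorph M (Fin n → ℂ))
    (T : OpenPartialHomeomorph (Fin n → ℂ) (Fin n → ℂ)) : Prop where
  source_subset : T.source ⊆ O
  symm_apply : ∀ w ∈ T.source, e.symm (T w) = Ψ w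
  smooth : ContDiffOn ℝ ∞ T T.source
  smooth_symm : ContDiffOn ℝ ∞ T.symm T.target
  mfderiv_eq : ∀ w ∈ T.source,
    realD Ψ w =
      (realD e.symm (T w)).comp (fderiv ℝ T w)

variable {Ψ : (Fin n → ℂ) → M} {O : Set (Fin n → ℂ)} {e : OpenPartialHomeomorph M (Fin n → ℂ)}
  {T : OpenPartialHomeomorph (Fin n → ℂ) (Fin n → ℂ)} {w : Fin n → ℂ} {z : Fin n → ℂ}

theorem IsParam.mdifferentiableAt (hΨ : IsParam Ψ O) (hw : w ∈ O) :
    MDifferentiableAt 𝓘(ℝ, Fin n → ℂ) 𝓘(ℝ, Fin n → ℂ) Ψ w :=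
  (hΨ.smooth.contMDiffAt (hΨ.isOpen.mem_nhds hw)).mdifferentiableAt (by simp)

/-- The tangent space at `Ψ w` is read in the preferred chart there, so the manifold derivative is
the derivative of that chart expression. -/
theorem IsParam.mfderiv_eq (hΨ : IsParam Ψ O) (hw : w ∈ O) :
    realD Ψ w =
      fderiv ℝ (chartAt (Fin n → ℂ) (Ψ w) ∘ Ψ) w := by
  refine (hΨ.mdifferentiableAt hw).mfderiv.trans ?_
  simp only [writtenInExtChartAt, extChartAt_model_space_eq_id, modelWithCornersSelf_coe,
    Set.range_id, fderivWithin_univ]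
  rfl

theorem IsParam.isOpen_inter_preimage (hΨ : IsParam Ψ O) {s : Set M} (hs : IsOpen s) :
    IsOpen (O ∩ Ψ ⁻¹' s) :=
  hΨ.smooth.continuousOn.isOpen_inter_preimage hΨ.isOpen hs

theorem IsParamChart.hasFDerivAt (hT : IsParamChart Ψ O e T) (hw : w ∈ T.source) :
    HasFDerivAt T (fderiv ℝ T w) w :=
  ((hT.smooth.contDiffAt (T.open_source.mem_nhds hw)).differentiableAt (by simp)).hasFDerivAt

theorem IsParamChart.hasFDerivAt_symm (hT : IsParamChart Ψ O e T) (hz : z ∈ T.target) :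
    HasFDerivAt T.symm (fderiv ℝ T.symm z) z :=
  ((hT.smooth_symm.contDiffAt (T.open_target.mem_nhds hz)).differentiableAt
    (by simp)).hasFDerivAt

theorem IsParamChart.fderiv_symm_comp (hT : IsParamChart Ψ O e T) (hw : w ∈ T.source) :
    (fderiv ℝ T.symm (T w)).comp (fderiv ℝ T w) = ContinuousLinearMap.id ℝ _ := by
  have h1 := (hT.hasFDerivAt_symm (T.map_source hw)).comp w (hT.hasFDerivAt hw)
  refine h1.unique ((hasFDerivAt_id w).congr_of_eventuallyEq ?_)
  filter_upwards [T.open_source.mem_nhds hw] with w' hw' using T.left_inv hw'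

theorem IsParamChart.fderiv_comp_symm (hT : IsParamChart Ψ O e T) (hz : z ∈ T.target) :
    (fderiv ℝ T (T.symm z)).comp (fderiv ℝ T.symm z) = ContinuousLinearMap.id ℝ _ := by
  have h1 := (hT.hasFDerivAt (T.map_target hz)).comp z (hT.hasFDerivAt_symm hz)
  refine h1.unique ((hasFDerivAt_id z).congr_of_eventuallyEq ?_)
  filter_upwards [T.open_target.mem_nhds hz] with z' hz' using T.right_inv hz'

theorem IsParamChart.pull_eq (hT : IsParamChart Ψ O e T) (α : DForm n p M) (hw : w ∈ T.source) :
    pull Ψ α w = (inChart e α (T w)).compContinuousLinearMap (fderiv ℝ T w) := by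
  rw [pull, inChart, hT.mfderiv_eq w hw, hT.symm_apply w hw]
  rfl

theorem IsParamChart.inChart_eq (hT : IsParamChart Ψ O e T) (α : DForm n p M)
    (hz : z ∈ T.target) : inChart e α z =
      (pull Ψ α (T.symm z)).compContinuousLinearMap (fderiv ℝ T.symm z) := by
  rw [hT.pull_eq α (T.map_target hz), T.right_inv hz]
  have := hT.fderiv_comp_symm hz
  ext v
  simp only [ContinuousAlternatingMap.compContinuousLinearMap_apply]
  congr 1
  funext i
  exact (DFunLike.congr_fun this (v i)).symm

variable [IsManifold 𝓘(ℝ, Fin n → ℂ) ∞ M]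

theorem contMDiffOn_chart_symm (he : e ∈ atlas (Fin n → ℂ) M) :
    ContMDiffOn 𝓘(ℝ, Fin n → ℂ) 𝓘(ℝ, Fin n → ℂ) ∞ e.symm e.target :=
  contMDiffOn_symm_of_mem_maximalAtlas (IsManifold.subset_maximalAtlas he)

theorem contMDiffOn_chart (he : e ∈ atlas (Fin n → ℂ) M) :
    ContMDiffOn 𝓘(ℝ, Fin n → ℂ) 𝓘(ℝ, Fin n → ℂ) ∞ e e.source :=
  contMDiffOn_of_mem_maximalAtlas (IsManifold.subset_maximalAtlas he)

theorem IsParam.contDiffOn_chart_comp (hΨ : IsParam Ψ O) (he : e ∈ atlas (Fin n → ℂ) M) :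
    ContDiffOn ℝ ∞ (e ∘ Ψ) (O ∩ Ψ ⁻¹' e.source) :=
  contMDiffOn_iff_contDiffOn.1
    ((contMDiffOn_chart he).comp (hΨ.smooth.mono Set.inter_subset_left) Set.inter_subset_right)

theorem IsParam.mfderiv_eq_comp (hΨ : IsParam Ψ O) (he : e ∈ atlas (Fin n → ℂ) M) (hw : w ∈ O)
    (hwe : Ψ w ∈ e.source) :
    realD Ψ w =
      (realD e.symm (e (Ψ w))).comp (fderiv ℝ (e ∘ Ψ) w) := by
  have hs : O ∩ Ψ ⁻¹' e.source ∈ nhds w :=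
    (hΨ.isOpen_inter_preimage e.open_source).mem_nhds ⟨hw, hwe⟩
  have h1 : MDifferentiableAt 𝓘(ℝ, Fin n → ℂ) 𝓘(ℝ, Fin n → ℂ) e.symm (e (Ψ w)) :=
    ((contMDiffOn_chart_symm he).contMDiffAt
      (e.open_target.mem_nhds (e.map_source hwe))).mdifferentiableAt (by simp)
  have h2 : MDifferentiableAt 𝓘(ℝ, Fin n → ℂ) 𝓘(ℝ, Fin n → ℂ) (e ∘ Ψ) w :=
    (((hΨ.contDiffOn_chart_comp he).contDiffAt hs).differentiableAt (by simp)).mdifferentiableAt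
  have h3 : Ψ =ᶠ[nhds w] e.symm ∘ (e ∘ Ψ) := by
    filter_upwards [hs] with w' hw' using (e.left_inv hw'.2).symm
  have h4 := mfderiv_comp w h1 h2
  rw [← h3.mfderiv_eq, mfderiv_eq_fderiv] at h4
  exact h4

/-- The inverse function theorem for `e ∘ Ψ`: an injective endomorphism of a finite dimensional
space is invertible. The local inverse is restricted to where `Ψ` takes values in the chart domain.
-/
theorem IsParam.exists_isParamChart (hΨ : IsParam Ψ O) (he : e ∈ atlas (Fin n → ℂ) M)
    (hw : w ∈ O) (hwe : Ψ w ∈ e.source) :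
    ∃ T, IsParamChart Ψ O e T ∧ w ∈ T.source ∧ ∀ w', T w' = e (Ψ w') := by
  have hs := hΨ.isOpen_inter_preimage e.open_source
  have hd : ∀ w' ∈ O ∩ Ψ ⁻¹' e.source, ∃ f' : (Fin n → ℂ) ≃L[ℝ] (Fin n → ℂ),
      HasFDerivAt (e ∘ Ψ) (f' : (Fin n → ℂ) →L[ℝ] (Fin n → ℂ)) w' := by
    intro w' hw'
    have h1 : DifferentiableAt ℝ (e ∘ Ψ) w' :=
      ((hΨ.contDiffOn_chart_comp he).contDiffAt (hs.mem_nhds hw')).differentiableAt (by simp)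
    have h2 : Function.Injective (fderiv ℝ (e ∘ Ψ) w') := by
      have := hΨ.injective w' hw'.1
      rw [hΨ.mfderiv_eq_comp he hw'.1 hw'.2] at this
      exact Function.Injective.of_comp this
    refine ⟨(LinearEquiv.ofInjectiveEndo (fderiv ℝ (e ∘ Ψ) w' : (Fin n → ℂ) →ₗ[ℝ] (Fin n → ℂ))
      h2).toContinuousLinearEquiv, ?_⟩
    convert h1.hasFDerivAt using 1
    ext1 v
    rfl
  obtain ⟨f', hf'⟩ := hd w ⟨hw, hwe⟩
  have hc := (hΨ.contDiffOn_chart_comp he).contDiffAt (hs.mem_nhds ⟨hw, hwe⟩)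
  let T := (hc.toOpenPartialHomeomorph (e ∘ Ψ) hf' (by simp)).restrOpen _ hs
  have hTs : T.source ⊆ O ∩ Ψ ⁻¹' e.source := Set.inter_subset_right
  have hTe : ∀ w', T w' = e (Ψ w') := fun w' => rfl
  refine ⟨T, ⟨fun w' hw' => (hTs hw').1, ?_, ?_, ?_, ?_⟩, ?_, hTe⟩
  · intro w' hw'
    rw [hTe, e.left_inv (hTs hw').2]
  · exact (hΨ.contDiffOn_chart_comp he).mono hTs
  · intro z hz
    obtain ⟨g', hg'⟩ := hd (T.symm z) (hTs (T.map_target hz))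
    exact (T.contDiffAt_symm hz hg' ((hΨ.contDiffOn_chart_comp he).contDiffAt
      (hs.mem_nhds (hTs (T.map_target hz))))).contDiffWithinAt
  · intro w' hw'
    exact hΨ.mfderiv_eq_comp he (hTs hw').1 (hTs hw').2
  · exact ⟨hc.mem_toOpenPartialHomeomorph_source hf' (by simp), hw, hwe⟩

end Pull

/-! ### Smoothness and Lie derivatives through parametrisations -/

section LieFlat

variable {p : ℕ} {E : Type} [NormedAddCommGroup E] [NormedSpace ℝ E] {O : Set E}
  {Z : E → E × E}

theorem contDiffOn_extDeriv {β : E → E [⋀^Fin p]→L[ℝ] ℂ} (hO : IsOpen O)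
    (hβ : ContDiffOn ℝ ∞ β O) : ContDiffOn ℝ ∞ (extDeriv β) O :=
  (ContinuousAlternatingMap.alternatizeUncurryFinCLM ℝ E ℂ).contDiff.comp_contDiffOn
    (hβ.fderiv_of_isOpen hO (by simp))

theorem contDiffOn_contractSucc {β : E → E [⋀^Fin (p + 1)]→L[ℝ] ℂ} (hZ : ContDiffOn ℝ ∞ Z O)
    (hβ : ContDiffOn ℝ ∞ β O) : ContDiffOn ℝ ∞ (fun w => contractSucc (Z w) (β w)) O := by
  have h : ContDiffOn ℝ ∞ (fun w => (Z w, β w)) O := hZ.prodMk hβ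
  have h' := (contDiff_contractSucc (E := E) (p := p)).comp_contDiffOn h
  exact h'

theorem contDiffOn_lieFlat {β : E → E [⋀^Fin p]→L[ℝ] ℂ} (hO : IsOpen O)
    (hZ : ContDiffOn ℝ ∞ Z O) (hβ : ContDiffOn ℝ ∞ β O) : ContDiffOn ℝ ∞ (lieFlat Z β) O := by
  cases p with
  | zero => exact contDiffOn_contractSucc hZ (contDiffOn_extDeriv hO hβ)
  | succ p =>
    exact (contDiffOn_extDeriv hO (contDiffOn_contractSucc hZ hβ)).add
      (contDiffOn_contractSucc hZ (contDiffOn_extDeriv hO hβ))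

theorem extDeriv_congr_on {β β' : E → E [⋀^Fin p]→L[ℝ] ℂ} (hO : IsOpen O)
    (h : Set.EqOn β β' O) : Set.EqOn (extDeriv β) (extDeriv β') O := fun w hw =>
  Filter.EventuallyEq.extDeriv_eq (by filter_upwards [hO.mem_nhds hw] with w' hw' using h hw')

theorem lieFlat_congr_on {β β' : E → E [⋀^Fin p]→L[ℝ] ℂ} (hO : IsOpen O)
    (h : Set.EqOn β β' O) : Set.EqOn (lieFlat Z β) (lieFlat Z β') O := by
  intro w hw
  cases p with
  | zero => exact congrArg (contractSucc (Z w)) (extDeriv_congr_on hO h hw)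
  | succ p =>
    exact congrArg₂ (· + ·) (extDeriv_congr_on hO
      (fun w' hw' => congrArg (contractSucc (Z w')) (h hw'))
      hw) (congrArg (contractSucc (Z w)) (extDeriv_congr_on hO h hw))

end LieFlat

/-! ### Naturality of the exterior calculus under parametrisations -/

section Pull

variable {n p : ℕ} {M : Type*} [TopologicalSpace M] [ChartedSpace (Fin n → ℂ) M]
  {Ψ : (Fin n → ℂ) → M} {O : Set (Fin n → ℂ)} {w : Fin n → ℂ}

theorem pull_contract {Z : M → (Fin n → ℂ) × (Fin n → ℂ)} {Z' : (Fin n → ℂ) × (Fin n → ℂ)}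
    (hZ : Z (Ψ w) = (realD Ψ w Z'.1, realD Ψ w Z'.2))
    (α : DForm n p M) : pull Ψ (fun x => contract (Z x) (α x)) w = contract Z' (pull Ψ α w) := by
  change (contract (Z (Ψ w)) (α (Ψ w))).compContinuousLinearMap (realD Ψ w) = _
  rw [hZ, contract_compContinuousLinearMap]
  rfl

theorem pull_contractSucc {Z : M → (Fin n → ℂ) × (Fin n → ℂ)} {Z' : (Fin n → ℂ) × (Fin n → ℂ)}
    (hZ : Z (Ψ w) = (realD Ψ w Z'.1, realD Ψ w Z'.2))
    (α : DForm n (p + 1) M) :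
    pull Ψ (fun x => contractSucc (Z x) (α x)) w = contractSucc Z' (pull Ψ α w) :=
  pull_contract hZ α

theorem pull_wedgePow (α : DForm n 2 M) (k : ℕ) :
    pull Ψ (fun x => wedgePow (α x) k) w = wedgePow (pull Ψ α w) k :=
  wedgePow_compContinuousLinearMap _ _ _

theorem pull_smul (f : M → ℂ) (α : DForm n p M) :
    pull Ψ (fun x => f x • α x) w = f (Ψ w) • pull Ψ α w := rfl

theorem pull_sum {κ : Type*} (s : Finset κ) (α : κ → DForm n p M) :
    pull Ψ (fun x => ∑ k ∈ s, α k x) w = ∑ k ∈ s, pull Ψ (α k) w := by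
  ext v
  change (∑ k ∈ s, α k (Ψ w)) (fun i => realD Ψ w (v i)) = _
  rw [ContinuousAlternatingMap.sum_apply, ContinuousAlternatingMap.sum_apply]
  rfl

variable [IsManifold 𝓘(ℝ, Fin n → ℂ) ∞ M]

/-- Near each point, the expression of the form in a chart is its pull back along some `Ψ i`,
carried over by the smooth map `T.symm`. -/
theorem smoothFormOn_of_pull {κ : Type*} {Ψ : κ → (Fin n → ℂ) → M} {O : κ → Set (Fin n → ℂ)}
    {W : Set M} {α : DForm n p M} (hW : IsOpen W) (hΨ : ∀ i, IsParam (Ψ i) (O i))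
    (hcov : ∀ x ∈ W, ∃ i, ∃ w ∈ O i, Ψ i w = x)
    (hα : ∀ i, ContDiffOn ℝ ∞ (pull (Ψ i) α) (O i ∩ Ψ i ⁻¹' W)) : SmoothFormOn α W := by
  intro e he z hz
  obtain ⟨i, w, hw, hwx⟩ := hcov _ hz.2
  have hwe : Ψ i w ∈ e.source := hwx ▸ e.map_target hz.1
  obtain ⟨T, hT, hwT, hTe⟩ := (hΨ i).exists_isParamChart he hw hwe
  have hz' : z = T w := by rw [hTe, hwx, e.right_inv hz.1]
  have hzT : z ∈ T.target := hz' ▸ T.map_source hwT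
  have ho : IsOpen (T.target ∩ T.symm ⁻¹' (O i ∩ Ψ i ⁻¹' W)) :=
    T.symm.isOpen_inter_preimage ((hΨ i).isOpen_inter_preimage hW)
  have hzo : z ∈ T.target ∩ T.symm ⁻¹' (O i ∩ Ψ i ⁻¹' W) := by
    refine ⟨hzT, ?_⟩
    rw [Set.mem_preimage, hz', T.left_inv hwT]
    exact ⟨hw, by rw [Set.mem_preimage, hwx]; exact hz.2⟩
  have h1 : ContDiffOn ℝ ∞ (fun z => (pull (Ψ i) α (T.symm z)).compContinuousLinearMap
      (fderiv ℝ T.symm z)) (T.target ∩ T.symm ⁻¹' (O i ∩ Ψ i ⁻¹' W)) :=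
    contDiffOn_compContinuousLinearMap
      ((hα i).comp (hT.smooth_symm.mono Set.inter_subset_left) fun z hz => hz.2)
      ((hT.smooth_symm.fderiv_of_isOpen T.open_target (by simp)).mono Set.inter_subset_left)
  refine ((h1.contDiffAt (ho.mem_nhds hzo)).congr_of_eventuallyEq ?_).contDiffWithinAt
  filter_upwards [T.open_target.mem_nhds hzT] with z' hz' using hT.inChart_eq α hz'

/-- `extD` at a point uses only the preferred chart at that point. There the form is the pull back
along `T.symm` of a smooth form, and the exterior derivative commutes with that pull back. -/
theorem pull_extD (hΨ : IsParam Ψ O) {α : DForm n p M} (hα : ContDiffOn ℝ ∞ (pull Ψ α) O)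
    (hw : w ∈ O) : pull Ψ (extD α) w = extDeriv (pull Ψ α) w := by
  obtain ⟨T, hT, hwT, hTe⟩ := hΨ.exists_isParamChart (chart_mem_atlas (Fin n → ℂ) (Ψ w)) hw
    (mem_chart_source (Fin n → ℂ) (Ψ w))
  have h1 : inChart (chartAt (Fin n → ℂ) (Ψ w)) α =ᶠ[nhds (T w)] fun z =>
      (pull Ψ α (T.symm z)).compContinuousLinearMap (fderiv ℝ T.symm z) := by
    filter_upwards [T.open_target.mem_nhds (T.map_source hwT)] with z hz
      using hT.inChart_eq α hz
  have h2 : DifferentiableAt ℝ (pull Ψ α) (T.symm (T w)) := by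
    rw [T.left_inv hwT]
    exact (hα.contDiffAt (hΨ.isOpen.mem_nhds hw)).differentiableAt (by simp)
  have h3 := extDeriv_pullback (r := ∞) h2
    (hT.smooth_symm.contDiffAt (T.open_target.mem_nhds (T.map_source hwT)))
    (by
      simp only [minSmoothness_of_isRCLikeNormedField]
      exact WithTop.coe_le_coe.2 le_top)
  have h4 : realD Ψ w =
      fderiv ℝ T w := by
    rw [hΨ.mfderiv_eq hw]
    exact congrArg (fun f => fderiv ℝ f w) (funext fun w' => (hTe w').symm)
  have h5 := hT.fderiv_symm_comp hwT
  rw [pull, h4, extD, ← hTe, h1.extDeriv_eq, h3, T.left_inv hwT]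
  ext v
  simp only [ContinuousAlternatingMap.compContinuousLinearMap_apply]
  congr 1
  funext i
  exact DFunLike.congr_fun h5 (v i)

theorem pull_lieD (hΨ : IsParam Ψ O) {Z : M → (Fin n → ℂ) × (Fin n → ℂ)}
    {Z' : (Fin n → ℂ) → (Fin n → ℂ) × (Fin n → ℂ)}
    (hZ : ∀ w ∈ O, Z (Ψ w) = (realD Ψ w (Z' w).1, realD Ψ w (Z' w).2))
    (hZ' : ContDiffOn ℝ ∞ Z' O) {α : DForm n p M} (hα : ContDiffOn ℝ ∞ (pull Ψ α) O) :
    Set.EqOn (pull Ψ (lieD Z α)) (lieFlat Z' (pull Ψ α)) O := by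
  have h : Set.EqOn (pull Ψ fun x => contractSucc (Z x) (extD α x))
      (fun w => contractSucc (Z' w) (extDeriv (pull Ψ α) w)) O := fun w hw =>
    (pull_contractSucc (hZ w hw) _).trans (congrArg _ (pull_extD hΨ hα hw))
  cases p with
  | zero => exact h
  | succ p =>
    intro w hw
    have hc : Set.EqOn (pull Ψ fun x => contractSucc (Z x) (α x))
        (fun w => contractSucc (Z' w) (pull Ψ α w)) O := fun w hw => pull_contractSucc (hZ w hw) _
    have hs := (contDiffOn_contractSucc hZ' hα).congr hc
    exact congrArg₂ (· + ·) ((pull_extD hΨ hs hw).trans (extDeriv_congr_on hΨ.isOpen hc hw)) (h hw)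

/-- Smoothness of the iterates is part of the induction because `pull_extD` needs it at each stage.
-/
theorem pull_iterate_lieD (hΨ : IsParam Ψ O) {Z : M → (Fin n → ℂ) × (Fin n → ℂ)}
    {Z' : (Fin n → ℂ) → (Fin n → ℂ) × (Fin n → ℂ)}
    (hZ : ∀ w ∈ O, Z (Ψ w) = (realD Ψ w (Z' w).1, realD Ψ w (Z' w).2))
    (hZ' : ContDiffOn ℝ ∞ Z' O) {α : DForm n p M} (hα : ContDiffOn ℝ ∞ (pull Ψ α) O) (k : ℕ) :
    ContDiffOn ℝ ∞ (pull Ψ ((lieD Z)^[k] α)) O ∧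
      Set.EqOn (pull Ψ ((lieD Z)^[k] α)) ((lieFlat Z')^[k] (pull Ψ α)) O := by
  induction k with
  | zero => exact ⟨hα, fun _ _ => rfl⟩
  | succ k ih =>
    simp only [Function.iterate_succ_apply']
    have h := pull_lieD hΨ hZ hZ' ih.1
    exact ⟨(contDiffOn_lieFlat hΨ.isOpen hZ' ih.1).congr h,
      h.trans (lieFlat_congr_on hΨ.isOpen ih.2)⟩

end Pull

/-! ### Currents through parametrisations -/

section TestKernel

variable {E G : Type} [NormedAddCommGroup E] [NormedSpace ℝ E] [NormedAddCommGroup G]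
  [NormedSpace ℝ G] [NormedSpace ℂ G] {O : Set E} {Θ : E → G →L[ℝ] ℂ}

/-- `Θ` is a smooth family of complex linear forms with compact support in `O`. -/
structure IsTestKernel (O : Set E) (Θ : E → G →L[ℝ] ℂ) : Prop where
  smooth : ContDiff ℝ ∞ Θ
  compact : HasCompactSupport Θ
  subset : tsupport Θ ⊆ O
  linear : ∀ w (c : ℂ) x, Θ w (c • x) = c * Θ w x

theorem isTestKernel_of_contDiffOn (hO : IsOpen O) (hΘ : ContDiffOn ℝ ∞ Θ O) {K : Set E}
    (hK : IsCompact K) (hKO : K ⊆ O) (h0 : ∀ w ∉ K, Θ w = 0)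
    (hl : ∀ w (c : ℂ) x, Θ w (c • x) = c * Θ w x) : IsTestKernel K Θ := by
  have hs : tsupport Θ ⊆ K :=
    closure_minimal (fun w hw => by_contra fun h => hw (h0 w h)) hK.isClosed
  exact ⟨contDiff_of_contDiffOn_of_tsupport hO hΘ (hs.trans hKO), HasCompactSupport.intro hK h0,
    hs, hl⟩

theorem IsTestKernel.mono (hΘ : IsTestKernel O Θ) {O' : Set E} (h : O ⊆ O') :
    IsTestKernel O' Θ :=
  ⟨hΘ.smooth, hΘ.compact, hΘ.subset.trans h, hΘ.linear⟩

theorem IsTestKernel.continuous_apply (hΘ : IsTestKernel O Θ) (hO : IsOpen O) {β : E → G}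
    (hβ : ContinuousOn β O) : Continuous fun w => Θ w (β w) := by
  rw [continuous_iff_continuousAt]
  intro w
  by_cases hw : w ∈ O
  · exact hΘ.smooth.continuous.continuousAt.clm_apply (hβ.continuousAt (hO.mem_nhds hw))
  · have : (fun w => Θ w (β w)) =ᶠ[nhds w] fun _ => 0 := by
      filter_upwards [(isClosed_tsupport Θ).isOpen_compl.mem_nhds fun h => hw (hΘ.subset h)]
        with x hx
      rw [image_eq_zero_of_notMem_tsupport hx]
      rfl
    exact continuousAt_const.congr this.symm

theorem IsTestKernel.integrable_apply [MeasurableSpace E] [BorelSpace E] [FiniteDimensional ℝ E]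
    {μ : Measure E} [μ.IsAddHaarMeasure] (hΘ : IsTestKernel O Θ) (hO : IsOpen O) {β : E → G}
    (hβ : ContinuousOn β O) : Integrable (fun w => Θ w (β w)) μ :=
  (hΘ.continuous_apply hO hβ).integrable_of_hasCompactSupport
    (HasCompactSupport.intro hΘ.compact fun w hw => by
      rw [image_eq_zero_of_notMem_tsupport hw]
      rfl)

end TestKernel

theorem contDiff_det {E : Type} [NormedAddCommGroup E] [NormedSpace ℝ E] [FiniteDimensional ℝ E] :
    ContDiff ℝ ∞ fun A : E →L[ℝ] E => A.det := by
  classical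
  let b := Module.finBasis ℝ E
  have h : ∀ A : E →L[ℝ] E, A.det = ∑ σ : Equiv.Perm (Fin (Module.finrank ℝ E)),
      ((Equiv.Perm.sign σ : ℤ) : ℝ) * ∏ i, b.coord (σ i) (A (b i)) := by
    intro A
    rw [ContinuousLinearMap.det, ← LinearMap.det_toMatrix b, Matrix.det_apply']
    simp only [LinearMap.toMatrix_apply]
    rfl
  simp only [h]
  refine ContDiff.sum fun σ _ => contDiff_const.mul (contDiff_prod fun i _ => ?_)
  exact (LinearMap.toContinuousLinearMap (b.coord (σ i))).contDiff.comp
    (contDiff_id.clm_apply contDiff_const)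

/-! ### Change of variables for test kernels -/

section Transport

variable {n p : ℕ} {M : Type*} [TopologicalSpace M] [ChartedSpace (Fin n → ℂ) M]
  {Ψ : (Fin n → ℂ) → M} {O : Set (Fin n → ℂ)} {e : OpenPartialHomeomorph M (Fin n → ℂ)}
  {T : OpenPartialHomeomorph (Fin n → ℂ) (Fin n → ℂ)} {W : Set M}

/-- The determinant does not vanish for a diffeomorphism, so its absolute value is smooth. -/
theorem IsParamChart.contDiffOn_abs_det (hT : IsParamChart Ψ O e T) :
    ContDiffOn ℝ ∞ (fun w => |(fderiv ℝ T w).det|) T.source := by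
  have h1 : ContDiffOn ℝ ∞ (fun w => (fderiv ℝ T w).det) T.source :=
    contDiff_det.comp_contDiffOn (hT.smooth.fderiv_of_isOpen T.open_source (by simp))
  refine ContDiffOn.abs h1 fun w hw h0 => ?_
  have h2 := congrArg ContinuousLinearMap.det (hT.fderiv_symm_comp hw)
  have h3 : ((fderiv ℝ T.symm (T w)).comp (fderiv ℝ T w)).det =
      (fderiv ℝ T.symm (T w)).det * (fderiv ℝ T w).det := LinearMap.det_comp _ _
  rw [h3, h0, mul_zero] at h2
  have h4 : (ContinuousLinearMap.id ℝ (Fin n → ℂ)).det = 1 := LinearMap.det_id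
  rw [h4] at h2
  exact zero_ne_one h2

/-- The change of variables formula. The absolute value of the Jacobian appears, and orientation
plays no role, because the oriented frame has already been inserted in `N` in the chart of `M`. -/
theorem IsParamChart.exists_isTestKernel (hT : IsParamChart Ψ O e T)
    {N : (Fin n → ℂ) → ((Fin n → ℂ) [⋀^Fin p]→L[ℝ] ℂ) →L[ℝ] ℂ}
    (hN : IsTestKernel (T.target ∩ e.symm ⁻¹' W) N) :
    ∃ Θ, IsTestKernel (O ∩ Ψ ⁻¹' W) Θ ∧ ∀ α : DForm n p M,
      ∫ z, N z (inChart e α z) = ∫ w, Θ w (pull Ψ α w) := by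
  classical
  let R : (Fin n → ℂ) → ((Fin n → ℂ) [⋀^Fin p]→L[ℝ] ℂ) →L[ℝ] ((Fin n → ℂ) [⋀^Fin p]→L[ℝ] ℂ) :=
    fun w => ContinuousAlternatingMap.compContinuousLinearMapCLM (fderiv ℝ T.symm (T w))
  -- The extension by zero is smooth: it vanishes outside the compact image of `tsupport N`, which
  -- lies in `T.source`.
  let Θ : (Fin n → ℂ) → ((Fin n → ℂ) [⋀^Fin p]→L[ℝ] ℂ) →L[ℝ] ℂ := fun w =>
    if w ∈ T.source then |(fderiv ℝ T w).det| • (N (T w)).comp (R w) else 0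
  have hΘ : ∀ w ∈ T.source, Θ w = |(fderiv ℝ T w).det| • (N (T w)).comp (R w) :=
    fun w hw => if_pos hw
  have hK : IsCompact (T.symm '' tsupport N) :=
    hN.compact.isCompact.image_of_continuousOn
      (T.continuousOn_symm.mono (hN.subset.trans Set.inter_subset_left))
  have hKs : T.symm '' tsupport N ⊆ T.source := by
    rintro _ ⟨z, hz, rfl⟩
    exact T.map_target (hN.subset hz).1
  have hKW : T.symm '' tsupport N ⊆ O ∩ Ψ ⁻¹' W := by
    rintro _ ⟨z, hz, rfl⟩
    have hz' := T.map_target (hN.subset hz).1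
    refine ⟨hT.source_subset hz', ?_⟩
    rw [Set.mem_preimage, ← hT.symm_apply _ hz', T.right_inv (hN.subset hz).1]
    exact (hN.subset hz).2
  have hs : ContDiffOn ℝ ∞ Θ T.source := by
    refine ContDiffOn.congr ?_ hΘ
    rw [contDiffOn_clm_apply]
    intro a
    have h1 : ContDiffOn ℝ ∞ (fun w => fderiv ℝ T.symm (T w)) T.source :=
      (hT.smooth_symm.fderiv_of_isOpen T.open_target (by simp)).comp hT.smooth
        fun w hw => T.map_source hw
    have h2 : ContDiffOn ℝ ∞ (fun w => R w a) T.source :=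
      contDiffOn_compContinuousLinearMap contDiffOn_const h1
    exact hT.contDiffOn_abs_det.smul ((hN.smooth.comp_contDiffOn hT.smooth).clm_apply h2)
  refine ⟨Θ, (isTestKernel_of_contDiffOn T.open_source hs hK hKs ?_ ?_).mono hKW, ?_⟩
  · intro w hw
    by_cases hws : w ∈ T.source
    · rw [hΘ w hws, image_eq_zero_of_notMem_tsupport fun h => hw ⟨T w, h, T.left_inv hws⟩]
      ext a
      simp
    · exact if_neg hws
  · intro w c a
    by_cases hws : w ∈ T.source
    · have h1 : R w (c • a) = c • R w a := rfl
      rw [hΘ w hws]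
      simp only [smul_apply, ContinuousLinearMap.comp_apply, h1, hN.linear, mul_smul_comm]
    · simp only [Θ, if_neg hws, zero_apply, mul_zero]
  · intro α
    have h1 : ∀ z ∉ T.target, N z (inChart e α z) = 0 := fun z hz => by
      rw [image_eq_zero_of_notMem_tsupport fun h => hz (hN.subset h).1]
      rfl
    have h2 : ∀ w ∉ T.source, Θ w (pull Ψ α w) = 0 := fun w hw => by
      simp only [Θ, if_neg hw, zero_apply]
    rw [← setIntegral_eq_integral_of_forall_compl_eq_zero h1,
      ← setIntegral_eq_integral_of_forall_compl_eq_zero h2,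
      integral_target_eq_integral_abs_det_fderiv_smul _ fun w hw => hT.hasFDerivAt hw]
    refine setIntegral_congr_fun T.open_source.measurableSet fun w hw => ?_
    rw [hΘ w hw, hT.inChart_eq α (T.map_source hw), T.left_inv hw]
    rfl

end Transport

/-! ### Localisation of test kernels -/

section Kernel

variable {E G : Type} [NormedAddCommGroup E] [NormedSpace ℝ E] [NormedAddCommGroup G]
  [NormedSpace ℝ G] [NormedSpace ℂ G] {O : Set E} {Θ : E → G →L[ℝ] ℂ}

theorem IsTestKernel.smul_left (hΘ : IsTestKernel O Θ) {f : E → ℝ} (hf : ContDiff ℝ ∞ f)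
    {V : Set E} (hV : tsupport f ⊆ V) : IsTestKernel (V ∩ O) fun w => f w • Θ w := by
  have h0 : ∀ w ∉ tsupport Θ, f w • Θ w = 0 := fun w hw => by
    ext x
    rw [smul_apply, image_eq_zero_of_notMem_tsupport hw, zero_apply, smul_zero]
  refine ⟨hf.smul hΘ.smooth, HasCompactSupport.intro hΘ.compact h0,
    fun w hw => ⟨hV ?_, hΘ.subset ?_⟩, ?_⟩
  · exact tsupport_smul_subset_left f Θ hw
  · exact tsupport_smul_subset_right f Θ hw
  · intro w c x
    simp only [smul_apply, hΘ.linear, mul_smul_comm]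

theorem apply_eq_sum_smul_apply {J : Type*} (s : Finset J)
    {f : J → E → ℝ} (hf : ∀ w ∈ tsupport Θ, ∑ j ∈ s, f j w = 1) (w : E) (x : G) :
    Θ w x = ∑ j ∈ s, (f j w • Θ w) x := by
  by_cases hw : w ∈ tsupport Θ
  · simp only [smul_apply, ← Finset.sum_smul]
    rw [hf w hw, one_smul]
  · rw [image_eq_zero_of_notMem_tsupport hw]
    refine (Finset.sum_eq_zero fun j _ => ?_).symm
    rw [smul_apply, zero_apply, smul_zero]

end Kernel

/-! ### Currents of forms as finite sums of kernels -/

section Current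

universe u

variable {n p : ℕ} {M : Type u} [TopologicalSpace M] [ChartedSpace (Fin n → ℂ) M]
  {κ : Type*} {Ψ : κ → (Fin n → ℂ) → M} {O : κ → Set (Fin n → ℂ)} {W : Set M}
  {e : OpenPartialHomeomorph M (Fin n → ℂ)}

theorem inChart_wedge {q : ℕ} (α : DForm n p M) (η : DForm n q M) (z : Fin n → ℂ) :
    inChart e (fun x => wedge (α x) (η x)) z = wedge (inChart e α z) (inChart e η z) :=
  wedge_compContinuousLinearMap _ _ _

/-- Finitely many members of a partition of unity subordinate to the sets `(T z).target` suffice on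
the compact support of `N`. The kernels are chosen before `α`, so they apply to all forms at once.
-/
theorem exists_isTestKernel_sum [IsManifold 𝓘(ℝ, Fin n → ℂ) ∞ M] (hW : IsOpen W)
    (hΨ : ∀ i, IsParam (Ψ i) (O i)) (hcov : ∀ x ∈ W, ∃ i, ∃ w ∈ O i, Ψ i w = x)
    (he : e ∈ atlas (Fin n → ℂ) M)
    {N : (Fin n → ℂ) → ((Fin n → ℂ) [⋀^Fin p]→L[ℝ] ℂ) →L[ℝ] ℂ}
    (hN : IsTestKernel (e.target ∩ e.symm ⁻¹' W) N) :
    ∃ (J : Type) (_ : Fintype J) (i : J → κ)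
      (Θ : J → (Fin n → ℂ) → ((Fin n → ℂ) [⋀^Fin p]→L[ℝ] ℂ) →L[ℝ] ℂ),
      (∀ j, IsTestKernel (O (i j) ∩ Ψ (i j) ⁻¹' W) (Θ j)) ∧
      ∀ α : DForm n p M, SmoothFormOn α W →
        ∫ z, N z (inChart e α z) = ∑ j, ∫ w, Θ j w (pull (Ψ (i j)) α w) := by
  classical
  have h1 : ∀ z : tsupport N, ∃ i T, IsParamChart (Ψ i) (O i) e T ∧ (z : Fin n → ℂ) ∈ T.target := by
    intro z
    have hz := hN.subset z.2
    obtain ⟨i, w, hw, hwx⟩ := hcov _ hz.2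
    have hwe : Ψ i w ∈ e.source := hwx ▸ e.map_target hz.1
    obtain ⟨T, hT, hwT, hTe⟩ := (hΨ i).exists_isParamChart he hw hwe
    refine ⟨i, T, hT, ?_⟩
    have h2 : (z : Fin n → ℂ) = T w := by rw [hTe, hwx, e.right_inv hz.1]
    exact h2 ▸ T.map_source hwT
  choose i T hT hzT using h1
  obtain ⟨f, hf⟩ := SmoothPartitionOfUnity.exists_isSubordinate 𝓘(ℝ, Fin n → ℂ)
    (isClosed_tsupport N) (fun z => (T z).target) (fun z => (T z).open_target)
    fun z hz => Set.mem_iUnion.2 ⟨⟨z, hz⟩, hzT ⟨z, hz⟩⟩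
  have hfin := f.locallyFinite.finite_nonempty_inter_compact hN.compact.isCompact
  have hsum : ∀ z ∈ tsupport N, ∑ j ∈ hfin.toFinset, f j z = 1 := by
    intro z hz
    rw [← f.sum_eq_one hz, finsum_eq_sum_of_support_subset]
    intro j hj
    exact hfin.mem_toFinset.2 ⟨z, hj, hz⟩
  have hker : ∀ j, IsTestKernel ((T j).target ∩ (e.target ∩ e.symm ⁻¹' W))
      fun z => f j z • N z := fun j => hN.smul_left (f j).contMDiff.contDiff (hf j)
  choose Θ hΘ hΘe using fun j => (hT j).exists_isTestKernel (W := W) (p := p)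
    ((hker j).mono fun z hz => ⟨hz.1, hz.2.2⟩)
  refine ⟨hfin.toFinset, inferInstance, fun j => i j, fun j => Θ j, fun j => hΘ j,
    fun α hα => ?_⟩
  have ho : IsOpen (e.target ∩ e.symm ⁻¹' W) := e.symm.isOpen_inter_preimage hW
  calc ∫ z, N z (inChart e α z)
      = ∫ z, ∑ j ∈ hfin.toFinset, (f j z • N z) (inChart e α z) :=
        integral_congr_ae (Filter.Eventually.of_forall fun z => apply_eq_sum_smul_apply _ hsum z _)
    _ = ∑ j ∈ hfin.toFinset, ∫ z, (f j z • N z) (inChart e α z) :=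
        integral_finsetSum _ fun j _ => ((hker j).mono Set.inter_subset_right).integrable_apply ho
          (hα e he).continuousOn
    _ = ∑ j ∈ hfin.toFinset, ∫ w, Θ j w (pull (Ψ (i j)) α w) :=
        Finset.sum_congr rfl fun j _ => hΘe j α
    _ = _ := (Finset.sum_coe_sort hfin.toFinset _).symm

variable [IsManifold 𝓘(ℂ, Fin n → ℂ) ω M] [T2Space M] [SigmaCompactSpace M]

theorem chartPartition_isSubordinate :
    (chartPartition n M).IsSubordinate fun x => (chartAt (Fin n → ℂ) x).source :=
  haveI : IsManifold 𝓘(ℝ, Fin n → ℂ) ∞ M := isManifold_real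
  (SmoothPartitionOfUnity.exists_isSubordinate_chartAt_source
    𝓘(ℝ, Fin n → ℂ) M).choose_spec

/-- The kernel sends `a` to the partition function times `(a ∧ η)` evaluated on the oriented frame.
It is complex linear in `a`, and its support is compact because that of `η` is. -/
theorem exists_isTestKernel_chart {q m : ℕ} (hm : m = 2 * n) (hpq : p + q = m)
    {η : DForm n q M} (hη : IsTestForm W η) (i : M) :
    ∃ N : (Fin n → ℂ) → ((Fin n → ℂ) [⋀^Fin p]→L[ℝ] ℂ) →L[ℝ] ℂ,
      IsTestKernel ((chartAt (Fin n → ℂ) i).target ∩ (chartAt (Fin n → ℂ) i).symm ⁻¹' W) N ∧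
      ∀ α : DForm n p M, ∫ y in (chartAt (Fin n → ℂ) i).target,
        (chartPartition n M i ((chartAt (Fin n → ℂ) i).symm y) : ℂ) *
          inChart (chartAt (Fin n → ℂ) i) (fun x => wedge (α x) (η x)) y
            (fun j => stdFrame n (Fin.cast (hpq.trans hm) j)) =
        ∫ z, N z (inChart (chartAt (Fin n → ℂ) i) α z) := by
  classical
  have : IsManifold 𝓘(ℝ, Fin n → ℂ) ∞ M := isManifold_real
  set e := chartAt (Fin n → ℂ) i
  set ρ := chartPartition n M i
  have he : e ∈ atlas (Fin n → ℂ) M := chart_mem_atlas _ i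
  let fr : Fin (p + q) → Fin n → ℂ := fun j => stdFrame n (Fin.cast (hpq.trans hm) j)
  let N : (Fin n → ℂ) → ((Fin n → ℂ) [⋀^Fin p]→L[ℝ] ℂ) →L[ℝ] ℂ := fun z =>
    LinearMap.toContinuousLinearMap
      (if z ∈ e.target then ρ (e.symm z) • wedgeEval fr (inChart e η z) else 0)
  have hNa : ∀ z ∈ e.target, ∀ a, N z a = ρ (e.symm z) • wedgeEval fr (inChart e η z) a := by
    intro z hz a
    simp only [N, if_pos hz]
    rfl
  have hN0 : ∀ z ∉ e.target, ∀ a, N z a = 0 := by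
    intro z hz a
    simp only [N, if_neg hz]
    rfl
  have hsρ : tsupport ρ ⊆ e.source := chartPartition_isSubordinate i
  have hK : IsCompact (e '' (tsupport ρ ∩ tsupport η)) :=
    (hη.2.1.isCompact.inter_left (isClosed_tsupport ρ)).image_of_continuousOn
      (e.continuousOn.mono fun x hx => hsρ hx.1)
  have hKt : e '' (tsupport ρ ∩ tsupport η) ⊆ e.target := by
    rintro _ ⟨x, hx, rfl⟩
    exact e.map_source (hsρ hx.1)
  have hKW : e '' (tsupport ρ ∩ tsupport η) ⊆ e.target ∩ e.symm ⁻¹' W := by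
    rintro _ ⟨x, hx, rfl⟩
    refine ⟨e.map_source (hsρ hx.1), ?_⟩
    rw [Set.mem_preimage, e.left_inv (hsρ hx.1)]
    exact hη.2.2 hx.2
  have hs : ContDiffOn ℝ ∞ N e.target := by
    rw [contDiffOn_clm_apply]
    intro a
    have h1 : ContDiffOn ℝ ∞ (fun z => ρ (e.symm z)) e.target :=
      contMDiffOn_iff_contDiffOn.1 (ρ.contMDiff.comp_contMDiffOn (contMDiffOn_chart_symm he))
    have h2 : ContDiffOn ℝ ∞ (inChart e η) e.target := by
      have := hη.1 e he
      rwa [Set.preimage_univ, Set.inter_univ] at this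
    have h3 : ContDiffOn ℝ ∞ (fun z => wedgeEval fr (inChart e η z) a) e.target :=
      (LinearMap.toContinuousLinearMap ((wedgeEval fr).flip a)).contDiff.comp_contDiffOn h2
    exact (h1.smul h3).congr fun z hz => hNa z hz a
  refine ⟨N, (isTestKernel_of_contDiffOn e.open_target hs hK hKt ?_ ?_).mono hKW, ?_⟩
  · intro z hz
    ext a
    by_cases hze : z ∈ e.target
    · rw [hNa z hze]
      by_cases h1 : e.symm z ∈ tsupport ρ
      · have h2 : e.symm z ∉ tsupport η := fun h => hz ⟨_, ⟨h1, h⟩, e.right_inv hze⟩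
        have h3 : inChart e η z = 0 := by
          rw [inChart, image_eq_zero_of_notMem_tsupport h2]
          rfl
        rw [h3, map_zero]
        exact smul_zero _
      · rw [image_eq_zero_of_notMem_tsupport h1]
        exact zero_smul _ _
    · exact hN0 z hze a
  · intro z c a
    by_cases hze : z ∈ e.target
    · rw [hNa z hze, hNa z hze, wedgeEval_smul, mul_smul_comm]
    · rw [hN0 z hze, hN0 z hze, mul_zero]
  · intro α
    rw [← setIntegral_eq_integral_of_forall_compl_eq_zero fun z hz => hN0 z hz _]
    refine setIntegral_congr_fun e.open_target.measurableSet fun z hz => ?_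
    rw [hNa z hz, wedgeEval_apply, ← inChart_wedge, Complex.real_smul]

/-- The compact support of `η` meets the supports of finitely many members of the chart partition,
and each of these contributes finitely many kernels. They depend on `η` only, which permits later
exchanges with infinite sums over the forms `α`. -/
theorem exists_formCurrent_eq (hW : IsOpen W) (hΨ : ∀ i, IsParam (Ψ i) (O i))
    (hcov : ∀ x ∈ W, ∃ i, ∃ w ∈ O i, Ψ i w = x) (hp : p ≤ 2 * n)
    {η : DForm n (2 * n - p) M} (hη : IsTestForm W η) :
    ∃ (J : Type u) (_ : Fintype J) (i : J → κ)
      (Θ : J → (Fin n → ℂ) → ((Fin n → ℂ) [⋀^Fin p]→L[ℝ] ℂ) →L[ℝ] ℂ),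
      (∀ j, IsTestKernel (O (i j) ∩ Ψ (i j) ⁻¹' W) (Θ j)) ∧
      ∀ α : DForm n p M, SmoothFormOn α W →
        formCurrent hp α η = ∑ j, ∫ w, Θ j w (pull (Ψ (i j)) α w) := by
  classical
  have : IsManifold 𝓘(ℝ, Fin n → ℂ) ∞ M := isManifold_real
  have hfin := (chartPartition n M).locallyFinite.finite_nonempty_inter_compact
    hη.2.1.isCompact
  choose N hN hNe using fun i => exists_isTestKernel_chart (p := p)
    (show p + (2 * n - p) = 2 * n by omega) rfl hη i
  choose J hJ k Θ hΘ hΘe using fun i =>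
    exists_isTestKernel_sum hW hΨ hcov (chart_mem_atlas (Fin n → ℂ) i) (hN i)
  refine ⟨Σ i : hfin.toFinset, J i, inferInstance, fun j => k j.1 j.2, fun j => Θ j.1 j.2,
    fun j => hΘ j.1 j.2, fun α hα => ?_⟩
  rw [formCurrent, formIntegral, finsum_eq_sum_of_support_subset (s := hfin.toFinset)]
  · rw [Fintype.sum_sigma, ← Finset.sum_coe_sort]
    exact Finset.sum_congr rfl fun i _ => (hNe i α).trans (hΘe i α hα)
  · intro i hi
    by_contra h
    refine hi ((integral_congr_ae (Filter.Eventually.of_forall fun y => ?_)).trans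
      (integral_zero _ _))
    by_cases h1 : (chartPartition n M) i ((chartAt (Fin n → ℂ) i).symm y) = 0
    · rw [h1, Complex.ofReal_zero, zero_mul]
    · have h2 : (chartAt (Fin n → ℂ) i).symm y ∉ tsupport η := fun h2 =>
        h (hfin.mem_toFinset.2 ⟨_, h1, h2⟩)
      have h3 : inChart (chartAt (Fin n → ℂ) i) η y = 0 := by
        rw [inChart, image_eq_zero_of_notMem_tsupport h2]
        rfl
      have h4 := map_zero (wedgeEval (p := p) (q := 2 * n - p)
        fun j => stdFrame n (Fin.cast (show p + (2 * n - p) = 2 * n by omega) j))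
      rw [inChart_wedge, h3]
      exact (congrArg _ (LinearMap.congr_fun h4 _)).trans (mul_zero _)

end Current

/-! ### Real coordinates on a family of tori -/

section Realification

variable {n : ℕ} {V : Type*} [NormedAddCommGroup V] [NormedSpace ℂ V] [NormedSpace ℝ V]
  [IsScalarTower ℝ ℂ V] {M : Type*} [TopologicalSpace M] [ChartedSpace (Fin n → ℂ) M]

theorem contMDiffOn_real {f : V → M} {O : Set V}
    (h : ContMDiffOn 𝓘(ℂ, V) 𝓘(ℂ, Fin n → ℂ) ω f O) :
    ContMDiffOn 𝓘(ℝ, V) 𝓘(ℝ, Fin n → ℂ) ∞ f O := by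
  intro x hx
  have h1 := h x hx
  rw [contMDiffWithinAt_iff] at h1 ⊢
  exact ⟨h1.1, (h1.2.restrict_scalars ℝ).of_le le_top⟩

theorem mfderiv_real_apply {f : V → M} {x : V}
    (h : MDifferentiableAt 𝓘(ℂ, V) 𝓘(ℂ, Fin n → ℂ) f x) (v : V) :
    (mfderiv 𝓘(ℝ, V) 𝓘(ℝ, Fin n → ℂ) f x : V →L[ℝ] (Fin n → ℂ)) v =
      (mfderiv 𝓘(ℂ, V) 𝓘(ℂ, Fin n → ℂ) f x : V →L[ℂ] (Fin n → ℂ)) v := by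
  have h1 := h.hasMFDerivAt
  let f' : V →L[ℂ] (Fin n → ℂ) := mfderiv 𝓘(ℂ, V) 𝓘(ℂ, Fin n → ℂ) f x
  let f'' : V →L[ℝ] (Fin n → ℂ) := f'.restrictScalars ℝ
  have h2 : HasMFDerivAt 𝓘(ℝ, V) 𝓘(ℝ, Fin n → ℂ) f x f'' :=
    ⟨h1.1, HasFDerivWithinAt.restrictScalars ℝ h1.2⟩
  exact congrArg (fun L : V →L[ℝ] (Fin n → ℂ) => L v) h2.mfderiv

end Realification

/-- Only the real dimension matters: the coordinates below need not respect the complex structure or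
the orientation. -/
theorem finrank_split (r d : ℕ) : Module.finrank ℝ (Fin (r + d) → ℂ) =
    Module.finrank ℝ ((Fin r → ℂ) × (Fin (2 * d) → ℝ)) := by
  simp only [Module.finrank_pi_fintype, Complex.finrank_real_complex, Finset.sum_const,
    Finset.card_univ, Fintype.card_fin, smul_eq_mul, Module.finrank_prod, Module.finrank_self]
  ring

/-- Linear real coordinates on `ℂ^{r+d}`. -/
def split (r d : ℕ) : (Fin (r + d) → ℂ) ≃L[ℝ] (Fin r → ℂ) × (Fin (2 * d) → ℝ) :=
  ContinuousLinearEquiv.ofFinrankEq (finrank_split r d)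

/-- The coordinates along the fibres. -/
def splitSnd (r d : ℕ) : (Fin (r + d) → ℂ) →L[ℝ] (Fin (2 * d) → ℝ) :=
  (ContinuousLinearMap.snd ℝ _ _).comp (split r d : _ →L[ℝ] (Fin r → ℂ) × (Fin (2 * d) → ℝ))

/-- The inclusion of the coordinates along the fibres. -/
def splitInr (r d : ℕ) : (Fin (2 * d) → ℝ) →L[ℝ] (Fin (r + d) → ℂ) :=
  ((split r d).symm : (Fin r → ℂ) × (Fin (2 * d) → ℝ) →L[ℝ] _).comp
    (ContinuousLinearMap.inr ℝ _ _)

theorem split_splitInr {r d : ℕ} (v : Fin (2 * d) → ℝ) : split r d (splitInr r d v) = (0, v) :=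
  (split r d).apply_symm_apply _

theorem splitSnd_splitInr {r d : ℕ} (v : Fin (2 * d) → ℝ) : splitSnd r d (splitInr r d v) = v :=
  congrArg Prod.snd (split_splitInr v)

/-! ### The fibrewise uniformisation by periods -/

section Geometry

variable {r d : ℕ} {S X : Type*} [TopologicalSpace S] [ChartedSpace (Fin r → ℂ) S]
  [TopologicalSpace X] [ChartedSpace (Fin (r + d) → ℂ) X] {𝒳 : TorusFamily r d S X}

namespace PeriodFrame

variable (F : PeriodFrame 𝒳)

theorem per_apply (s : S) (u : Fin (2 * d) → ℝ) : F.per s u = ∑ j, u j • F.period j s := by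
  simp only [per, sum_apply, ContinuousLinearMap.smulRight_apply, ContinuousLinearMap.proj_apply]

/-- The periods identify `ℝ^{2d}` with `ℂ^d`. -/
theorem exists_per_eq {s : S} (hs : s ∈ F.U) :
    ∃ e : (Fin (2 * d) → ℝ) ≃L[ℝ] (Fin d → ℂ),
      (e : (Fin (2 * d) → ℝ) →L[ℝ] (Fin d → ℂ)) = F.per s := by
  have hinj : Function.Injective (F.per s : (Fin (2 * d) → ℝ) →ₗ[ℝ] (Fin d → ℂ)) := by
    rw [← LinearMap.ker_eq_bot, LinearMap.ker_eq_bot']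
    intro u hu
    have h1 : ∑ j, u j • F.period j s = 0 := by rw [← F.per_apply]; exact hu
    funext j
    exact Fintype.linearIndependent_iff.1 (F.period_indep s hs) u h1 j
  have hfr : Module.finrank ℝ (Fin (2 * d) → ℝ) = Module.finrank ℝ (Fin d → ℂ) := by
    simp only [Module.finrank_pi_fintype, Complex.finrank_real_complex, Finset.sum_const,
      Finset.card_univ, Fintype.card_fin, smul_eq_mul, Module.finrank_self]
    ring
  refine ⟨(LinearEquiv.ofInjectiveOfFinrankEq _ hinj hfr).toContinuousLinearEquiv, ?_⟩
  ext1 u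
  rfl

theorem per_inverse_per {s : S} (hs : s ∈ F.U) (u : Fin (2 * d) → ℝ) :
    (F.per s).inverse (F.per s u) = u := by
  obtain ⟨e, he⟩ := F.exists_per_eq hs
  rw [← he, ContinuousLinearMap.inverse_equiv]
  exact e.symm_apply_apply u

theorem per_per_inverse {s : S} (hs : s ∈ F.U) (v : Fin d → ℂ) :
    F.per s ((F.per s).inverse v) = v := by
  obtain ⟨e, he⟩ := F.exists_per_eq hs
  rw [← he, ContinuousLinearMap.inverse_equiv]
  exact e.apply_symm_apply v

theorem proj_triv {s : S} (hs : s ∈ F.U) (u : Fin (2 * d) → ℝ) : 𝒳.proj (F.triv (s, u)) = s :=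
  F.proj_unif hs _

theorem triv_eq_iff {s : S} (hs : s ∈ F.U) (u u' : Fin (2 * d) → ℝ) :
    F.triv (s, u) = F.triv (s, u') ↔ ∃ k : Fin (2 * d) → ℤ, u - u' = fun j => (k j : ℝ) := by
  change F.unif s (F.per s u) = F.unif s (F.per s u') ↔ _
  rw [F.unif_eq_iff s hs, ← map_sub, Submodule.mem_span_range_iff_exists_fun]
  refine exists_congr fun k => ?_
  have h1 : F.per s (fun j => (k j : ℝ)) = ∑ j, k j • F.period j s := by
    rw [F.per_apply]
    exact Finset.sum_congr rfl fun j _ => by rw [Int.cast_smul_eq_zsmul]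
  rw [← h1]
  obtain ⟨e, he⟩ := F.exists_per_eq hs
  rw [← he]
  exact ⟨fun h => (e.injective h).symm, fun h => by rw [h]⟩

theorem exists_triv_eq {x : X} (hx : 𝒳.proj x ∈ F.U) : ∃ u, F.triv (𝒳.proj x, u) = x := by
  have h : x ∈ Set.range (F.unif (𝒳.proj x)) := by
    rw [F.range_unif _ hx]
    rfl
  obtain ⟨v, hv⟩ := h
  refine ⟨(F.per (𝒳.proj x)).inverse v, ?_⟩
  change F.unif _ (F.per _ _) = x
  rw [F.per_per_inverse hx, hv]

theorem triv_coord {x : X} (hx : 𝒳.proj x ∈ F.U) : F.triv (𝒳.proj x, F.coord x) = x :=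
  Function.invFun_eq (f := fun u => F.triv (𝒳.proj x, u)) (F.exists_triv_eq hx)

/-- `coord` is an arbitrary lift, with no continuity in the point. Later arguments only use that it
is correct modulo `ℤ^{2d}`. -/
theorem exists_coord_eq {s : S} (hs : s ∈ F.U) (u : Fin (2 * d) → ℝ) :
    ∃ k : Fin (2 * d) → ℤ, F.coord (F.triv (s, u)) = u - fun j => (k j : ℝ) := by
  have h1 := F.proj_triv hs u
  have h2 := F.triv_coord (x := F.triv (s, u)) (h1.symm ▸ hs)
  rw [h1] at h2
  obtain ⟨k, hk⟩ := (F.triv_eq_iff hs _ _).1 h2.symm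
  exact ⟨k, by rw [← hk]; abel⟩

theorem triv_mem_range_zero_iff {s : S} (hs : s ∈ F.U) (u : Fin (2 * d) → ℝ) :
    F.triv (s, u) ∈ Set.range 𝒳.zero ↔ ∃ k : Fin (2 * d) → ℤ, u = fun j => (k j : ℝ) := by
  have h0 : F.triv (s, 0) = 𝒳.zero s := by
    change F.unif s (F.per s 0) = _
    rw [map_zero, F.unif_zero s hs]
  have h1 : F.triv (s, u) ∈ Set.range 𝒳.zero ↔ F.triv (s, u) = F.triv (s, 0) := by
    rw [h0]
    refine ⟨?_, fun h => ⟨s, h.symm⟩⟩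
    rintro ⟨s', hs'⟩
    have h2 := 𝒳.proj_zero s'
    rw [hs', F.proj_triv hs] at h2
    rw [← hs', h2]
  rw [h1, F.triv_eq_iff hs]
  simp only [sub_zero]

/-! #### The parametrisation attached to a chart of the base -/

variable {c : OpenPartialHomeomorph S (Fin r → ℂ)}

/-- The base point with coordinate vector `w`. -/
def base (c : OpenPartialHomeomorph S (Fin r → ℂ)) (w : Fin (r + d) → ℂ) : S :=
  c.symm (split r d w).1

/-- The point of `X` with coordinate vector `w`. -/
def param (c : OpenPartialHomeomorph S (Fin r → ℂ)) (w : Fin (r + d) → ℂ) : X :=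
  F.triv (base c w, splitSnd r d w)

/-- The coordinate domain. -/
def dom (c : OpenPartialHomeomorph S (Fin r → ℂ)) : Set (Fin (r + d) → ℂ) :=
  {w | (split r d w).1 ∈ c.target ∩ c.symm ⁻¹' F.U}

theorem base_mem {w : Fin (r + d) → ℂ} (hw : w ∈ F.dom c) : base c w ∈ F.U := hw.2

theorem proj_param {w : Fin (r + d) → ℂ} (hw : w ∈ F.dom c) : 𝒳.proj (F.param c w) = base c w :=
  F.proj_triv (F.base_mem hw) _

theorem isOpen_dom : IsOpen (F.dom c) :=
  (c.symm.isOpen_inter_preimage F.isOpen_U).preimage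
    (continuous_fst.comp (split r d).continuous)

theorem exists_param_eq {x : X} (hx : 𝒳.proj x ∈ F.U) :
    ∃ w ∈ F.dom (chartAt (Fin r → ℂ) (𝒳.proj x)),
      F.param (chartAt (Fin r → ℂ) (𝒳.proj x)) w = x := by
  set c := chartAt (Fin r → ℂ) (𝒳.proj x)
  have hc : 𝒳.proj x ∈ c.source := mem_chart_source _ _
  obtain ⟨u, hu⟩ := F.exists_triv_eq hx
  have h1 : split r d ((split r d).symm (c (𝒳.proj x), u)) = (c (𝒳.proj x), u) :=
    (split r d).apply_symm_apply _
  refine ⟨(split r d).symm (c (𝒳.proj x), u), ?_, ?_⟩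
  · change (split r d ((split r d).symm (c (𝒳.proj x), u))).1 ∈ c.target ∩ c.symm ⁻¹' F.U
    rw [h1]
    exact ⟨c.map_source hc, by rw [Set.mem_preimage, c.left_inv hc]; exact hx⟩
  · change F.triv (c.symm (split r d _).1, (split r d _).2) = x
    rw [h1, c.left_inv hc, hu]

section Smooth

variable [IsManifold 𝓘(ℂ, Fin r → ℂ) ω S]

theorem contMDiffOn_chart_symm_complex (hc : c ∈ atlas (Fin r → ℂ) S) :
    ContMDiffOn 𝓘(ℂ, Fin r → ℂ) 𝓘(ℂ, Fin r → ℂ) ω c.symm c.target :=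
  contMDiffOn_symm_of_mem_maximalAtlas (IsManifold.subset_maximalAtlas hc)

theorem contMDiffOn_chart_complex (hc : c ∈ atlas (Fin r → ℂ) S) :
    ContMDiffOn 𝓘(ℂ, Fin r → ℂ) 𝓘(ℂ, Fin r → ℂ) ω c c.source :=
  contMDiffOn_of_mem_maximalAtlas (IsManifold.subset_maximalAtlas hc)

theorem contDiffOn_period (hc : c ∈ atlas (Fin r → ℂ) S) (j : Fin (2 * d)) :
    ContDiffOn ℝ ∞ (fun x => F.period j (c.symm x)) (c.target ∩ c.symm ⁻¹' F.U) := by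
  have h1 := (F.period_holo j).comp ((contMDiffOn_chart_symm_complex hc).mono
    Set.inter_subset_left) fun x (hx : x ∈ c.target ∩ c.symm ⁻¹' F.U) => hx.2
  exact ((contMDiffOn_iff_contDiffOn.1 h1).restrict_scalars ℝ).of_le le_top

theorem contDiffOn_per (hc : c ∈ atlas (Fin r → ℂ) S) :
    ContDiffOn ℝ ∞ (fun x => F.per (c.symm x)) (c.target ∩ c.symm ⁻¹' F.U) := by
  rw [contDiffOn_clm_apply]
  intro u
  simp only [per_apply]
  exact ContDiffOn.sum fun j _ => (F.contDiffOn_period hc j).const_smul (u j)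

theorem contDiffOn_per_inverse (hc : c ∈ atlas (Fin r → ℂ) S) :
    ContDiffOn ℝ ∞ (fun x => (F.per (c.symm x)).inverse) (c.target ∩ c.symm ⁻¹' F.U) := by
  intro x hx
  obtain ⟨e, he⟩ := F.exists_per_eq hx.2
  have h1 : ContDiffAt ℝ ∞ ContinuousLinearMap.inverse (F.per (c.symm x)) :=
    he ▸ contDiffAt_map_inverse e
  exact h1.comp_contDiffWithinAt x (F.contDiffOn_per hc x hx)

/-- The map `unif` in a chart of the base. -/
def unifFlat (c : OpenPartialHomeomorph S (Fin r → ℂ)) (z : (Fin r → ℂ) × (Fin d → ℂ)) : X :=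
  F.unif (c.symm z.1) z.2

theorem contMDiffOn_unifFlat (hc : c ∈ atlas (Fin r → ℂ) S) :
    ContMDiffOn 𝓘(ℂ, (Fin r → ℂ) × (Fin d → ℂ)) 𝓘(ℂ, Fin (r + d) → ℂ) ω (F.unifFlat c)
      ((c.target ∩ c.symm ⁻¹' F.U) ×ˢ Set.univ) := by
  have h1 : ContMDiffOn 𝓘(ℂ, (Fin r → ℂ) × (Fin d → ℂ)) 𝓘(ℂ, Fin r → ℂ) ω
      (fun z : (Fin r → ℂ) × (Fin d → ℂ) => c.symm z.1)
      ((c.target ∩ c.symm ⁻¹' F.U) ×ˢ Set.univ) :=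
    (contMDiffOn_chart_symm_complex hc).comp contDiff_fst.contMDiff.contMDiffOn
      fun z hz => hz.1.1
  have h2 : ContMDiffOn 𝓘(ℂ, (Fin r → ℂ) × (Fin d → ℂ)) 𝓘(ℂ, Fin d → ℂ) ω
      (fun z : (Fin r → ℂ) × (Fin d → ℂ) => z.2)
      ((c.target ∩ c.symm ⁻¹' F.U) ×ˢ Set.univ) := contDiff_snd.contMDiff.contMDiffOn
  exact F.unif_holo.comp (h1.prodMk h2) fun z hz => ⟨hz.1.2, trivial⟩

/-- `unifFlat` is the étale map `unif` after the inverse chart of the base, and the latter has the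
chart as a differentiable left inverse. -/
theorem injective_mfderiv_unifFlat (hc : c ∈ atlas (Fin r → ℂ) S)
    {z : (Fin r → ℂ) × (Fin d → ℂ)} (hz : z.1 ∈ c.target ∩ c.symm ⁻¹' F.U) :
    Function.Injective (mfderiv 𝓘(ℂ, (Fin r → ℂ) × (Fin d → ℂ)) 𝓘(ℂ, Fin (r + d) → ℂ)
      (F.unifFlat c) z) := by
  have hs1 : MDifferentiableAt 𝓘(ℂ, Fin r → ℂ) 𝓘(ℂ, Fin r → ℂ) c.symm z.1 :=
    ((contMDiffOn_chart_symm_complex hc).contMDiffAt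
      (c.open_target.mem_nhds hz.1)).mdifferentiableAt (by simp)
  have hf1 : MDifferentiableAt 𝓘(ℂ, (Fin r → ℂ) × (Fin d → ℂ)) 𝓘(ℂ, Fin r → ℂ)
      (fun z : (Fin r → ℂ) × (Fin d → ℂ) => z.1) z := differentiableAt_fst.mdifferentiableAt
  have hf2 : MDifferentiableAt 𝓘(ℂ, (Fin r → ℂ) × (Fin d → ℂ)) 𝓘(ℂ, Fin d → ℂ)
      (fun z : (Fin r → ℂ) × (Fin d → ℂ) => z.2) z := differentiableAt_snd.mdifferentiableAt
  let j : (Fin r → ℂ) × (Fin d → ℂ) → S × (Fin d → ℂ) := fun z => (c.symm z.1, z.2)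
  have hj : MDifferentiableAt 𝓘(ℂ, (Fin r → ℂ) × (Fin d → ℂ))
      (𝓘(ℂ, Fin r → ℂ).prod 𝓘(ℂ, Fin d → ℂ)) j z :=
    (hs1.comp z hf1).prodMk hf2
  have hk1 : MDifferentiableAt 𝓘(ℂ, Fin r → ℂ) 𝓘(ℂ, Fin r → ℂ) c (j z).1 :=
    ((contMDiffOn_chart_complex hc).contMDiffAt
      (c.open_source.mem_nhds (c.map_target hz.1))).mdifferentiableAt (by simp)
  have hk : MDifferentiableAt (𝓘(ℂ, Fin r → ℂ).prod 𝓘(ℂ, Fin d → ℂ))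
      𝓘(ℂ, (Fin r → ℂ) × (Fin d → ℂ))
      (fun q : S × (Fin d → ℂ) => (c q.1, q.2)) (j z) :=
    (hk1.comp (j z) mdifferentiableAt_fst).prodMk_space mdifferentiableAt_snd
  have hkj : (fun q : S × (Fin d → ℂ) => (c q.1, q.2)) ∘ j =ᶠ[nhds z] id := by
    filter_upwards [(c.open_target.preimage continuous_fst).mem_nhds hz.1] with z' hz'
    exact Prod.ext (c.right_inv hz') rfl
  have hj_inj : Function.Injective (mfderiv 𝓘(ℂ, (Fin r → ℂ) × (Fin d → ℂ))
      (𝓘(ℂ, Fin r → ℂ).prod 𝓘(ℂ, Fin d → ℂ)) j z) := by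
    have h1 := mfderiv_comp z hk hj
    intro v v' hv
    have h3 : mfderiv 𝓘(ℂ, (Fin r → ℂ) × (Fin d → ℂ))
        𝓘(ℂ, (Fin r → ℂ) × (Fin d → ℂ))
        ((fun q : S × (Fin d → ℂ) => (c q.1, q.2)) ∘ j) z =
        ContinuousLinearMap.id ℂ ((Fin r → ℂ) × (Fin d → ℂ)) := by
      rw [hkj.mfderiv_eq]
      exact mfderiv_id
    rw [h3] at h1
    have h4 := DFunLike.congr_fun h1 v
    have h5 := DFunLike.congr_fun h1 v'
    exact (h4.trans (congrArg (mfderiv (𝓘(ℂ, Fin r → ℂ).prod 𝓘(ℂ, Fin d → ℂ))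
      𝓘(ℂ, (Fin r → ℂ) × (Fin d → ℂ)) (fun q : S × (Fin d → ℂ) => (c q.1, q.2)) (j z))
      hv)).trans h5.symm
  have hzU : (j z).1 ∈ F.U := hz.2
  have hu : MDifferentiableAt (𝓘(ℂ, Fin r → ℂ).prod 𝓘(ℂ, Fin d → ℂ)) 𝓘(ℂ, Fin (r + d) → ℂ)
      (fun q : S × (Fin d → ℂ) => F.unif q.1 q.2) (j z) :=
    (F.unif_holo.contMDiffAt ((F.isOpen_U.prod isOpen_univ).mem_nhds
      ⟨hzU, trivial⟩)).mdifferentiableAt (by simp)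
  have h6 := mfderiv_comp z hu hj
  have h7 : F.unifFlat c = (fun q : S × (Fin d → ℂ) => F.unif q.1 q.2) ∘ j := rfl
  rw [h7, h6]
  exact (F.unif_etale _ hzU _).1.comp hj_inj

end Smooth

end PeriodFrame

end Geometry

/-! ### The parametrisations are local diffeomorphisms and split the tangent spaces -/

section Geometry

variable {r d : ℕ} {S X : Type*} [TopologicalSpace S] [ChartedSpace (Fin r → ℂ) S]
  [TopologicalSpace X] [ChartedSpace (Fin (r + d) → ℂ) X] {𝒳 : TorusFamily r d S X}
  [IsManifold 𝓘(ℂ, Fin r → ℂ) ω S]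

namespace PeriodFrame

variable (F : PeriodFrame 𝒳) {c : OpenPartialHomeomorph S (Fin r → ℂ)} {w : Fin (r + d) → ℂ}

theorem contDiffOn_per_base (hc : c ∈ atlas (Fin r → ℂ) S) :
    ContDiffOn ℝ ∞ (fun w => F.per (base c w)) (F.dom c) :=
  (F.contDiffOn_per hc).comp
    (contDiff_fst.comp (split r d).contDiff).contDiffOn fun _ hw => hw

theorem contDiffOn_per_inverse_base (hc : c ∈ atlas (Fin r → ℂ) S) :
    ContDiffOn ℝ ∞ (fun w => (F.per (base c w)).inverse) (F.dom c) :=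
  (F.contDiffOn_per_inverse hc).comp
    (contDiff_fst.comp (split r d).contDiff).contDiffOn fun _ hw => hw

/-- The complex coordinates of the point with coordinate vector `w`. -/
def toUnif (c : OpenPartialHomeomorph S (Fin r → ℂ)) (w : Fin (r + d) → ℂ) :
    (Fin r → ℂ) × (Fin d → ℂ) :=
  ((split r d w).1, F.per (base c w) (splitSnd r d w))

/-- The coordinate vector of the point with given complex coordinates. -/
def ofUnif (c : OpenPartialHomeomorph S (Fin r → ℂ)) (z : (Fin r → ℂ) × (Fin d → ℂ)) :
    Fin (r + d) → ℂ :=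
  (split r d).symm (z.1, (F.per (c.symm z.1)).inverse z.2)

theorem contDiffOn_toUnif (hc : c ∈ atlas (Fin r → ℂ) S) :
    ContDiffOn ℝ ∞ (F.toUnif c) (F.dom c) := by
  have h1 : ContDiffOn ℝ ∞ (fun w => (split r d w).1) (F.dom c) :=
    (contDiff_fst.comp (split r d).contDiff).contDiffOn
  have h2 : ContDiffOn ℝ ∞ (fun w => F.per (base c w) (splitSnd r d w)) (F.dom c) :=
    (F.contDiffOn_per_base hc).clm_apply (splitSnd r d).contDiff.contDiffOn
  exact h1.prodMk h2

theorem contDiffOn_ofUnif (hc : c ∈ atlas (Fin r → ℂ) S) :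
    ContDiffOn ℝ ∞ (F.ofUnif c) ((c.target ∩ c.symm ⁻¹' F.U) ×ˢ Set.univ) := by
  have h1 : ContDiffOn ℝ ∞ (fun z : (Fin r → ℂ) × (Fin d → ℂ) =>
      (F.per (c.symm z.1)).inverse z.2) ((c.target ∩ c.symm ⁻¹' F.U) ×ˢ Set.univ) :=
    ((F.contDiffOn_per_inverse hc).comp contDiff_fst.contDiffOn fun z hz => hz.1).clm_apply
      contDiff_snd.contDiffOn
  exact (split r d).symm.contDiff.comp_contDiffOn (contDiff_fst.contDiffOn.prodMk h1)

theorem ofUnif_toUnif (hw : w ∈ F.dom c) : F.ofUnif c (F.toUnif c w) = w := by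
  have h1 : (F.per (base c w)).inverse (F.per (base c w) (splitSnd r d w)) = splitSnd r d w :=
    F.per_inverse_per (F.base_mem hw) _
  change (split r d).symm ((split r d w).1,
    (F.per (base c w)).inverse (F.per (base c w) (splitSnd r d w))) = w
  rw [h1]
  exact (split r d).symm_apply_apply w

/-- `param` is the holomorphic `unifFlat` after `toUnif`. The real map `toUnif` has the smooth left
inverse `ofUnif`, and the real derivative of `unifFlat` is its injective complex derivative. -/
theorem isParam (hc : c ∈ atlas (Fin r → ℂ) S) : IsParam (F.param c) (F.dom c) := by
  have hmaps : Set.MapsTo (F.toUnif c) (F.dom c) ((c.target ∩ c.symm ⁻¹' F.U) ×ˢ Set.univ) :=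
    fun w hw => ⟨hw, trivial⟩
  have hreal := contMDiffOn_real (F.contMDiffOn_unifFlat hc)
  refine ⟨F.isOpen_dom, hreal.comp (F.contDiffOn_toUnif hc).contMDiffOn hmaps, fun w hw => ?_⟩
  have ho : IsOpen ((c.target ∩ c.symm ⁻¹' F.U) ×ˢ (Set.univ : Set (Fin d → ℂ))) :=
    (c.symm.isOpen_inter_preimage F.isOpen_U).prod isOpen_univ
  have h1 : DifferentiableAt ℝ (F.toUnif c) w :=
    ((F.contDiffOn_toUnif hc).contDiffAt (F.isOpen_dom.mem_nhds hw)).differentiableAt (by simp)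
  have h2 : DifferentiableAt ℝ (F.ofUnif c) (F.toUnif c w) :=
    ((F.contDiffOn_ofUnif hc).contDiffAt (ho.mem_nhds (hmaps hw))).differentiableAt (by simp)
  have h3 : (fderiv ℝ (F.ofUnif c) (F.toUnif c w)).comp (fderiv ℝ (F.toUnif c) w) =
      ContinuousLinearMap.id ℝ _ := by
    refine (h2.hasFDerivAt.comp w h1.hasFDerivAt).unique
      ((hasFDerivAt_id w).congr_of_eventuallyEq ?_)
    filter_upwards [F.isOpen_dom.mem_nhds hw] with w' hw' using F.ofUnif_toUnif hw'
  have h4 : Function.Injective (fderiv ℝ (F.toUnif c) w) := by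
    intro v v' hv
    have h5 := DFunLike.congr_fun h3 v
    have h6 := DFunLike.congr_fun h3 v'
    exact (h5.symm.trans (congrArg (fderiv ℝ (F.ofUnif c) (F.toUnif c w)) hv)).trans h6
  have h7 : MDifferentiableAt 𝓘(ℂ, (Fin r → ℂ) × (Fin d → ℂ)) 𝓘(ℂ, Fin (r + d) → ℂ)
      (F.unifFlat c) (F.toUnif c w) :=
    ((F.contMDiffOn_unifFlat hc).contMDiffAt (ho.mem_nhds (hmaps hw))).mdifferentiableAt (by simp)
  have h8 : MDifferentiableAt 𝓘(ℝ, (Fin r → ℂ) × (Fin d → ℂ)) 𝓘(ℝ, Fin (r + d) → ℂ)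
      (F.unifFlat c) (F.toUnif c w) :=
    (hreal.contMDiffAt (ho.mem_nhds (hmaps hw))).mdifferentiableAt (by simp)
  have h9 := mfderiv_comp w h8 h1.mdifferentiableAt
  rw [mfderiv_eq_fderiv] at h9
  intro v v' hv
  have h10 : ∀ v, realD (F.param c) w v = (mfderiv 𝓘(ℂ, (Fin r → ℂ) × (Fin d → ℂ))
      𝓘(ℂ, Fin (r + d) → ℂ) (F.unifFlat c) (F.toUnif c w) :
        (Fin r → ℂ) × (Fin d → ℂ) →L[ℂ] (Fin (r + d) → ℂ)) (fderiv ℝ (F.toUnif c) w v) :=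
    fun v => (DFunLike.congr_fun h9 v).trans (mfderiv_real_apply h7 _)
  rw [h10, h10] at hv
  exact h4 (F.injective_mfderiv_unifFlat hc (z := F.toUnif c w) hw hv)

/-- Without differentiability `mfderiv` is zero by convention, and `trivD` would carry no
information. -/
theorem mdifferentiableAt_triv (hc : c ∈ atlas (Fin r → ℂ) S) {s : S} (hs : s ∈ F.U)
    (hsc : s ∈ c.source) (u : Fin (2 * d) → ℝ) :
    MDifferentiableAt (𝓘(ℝ, Fin r → ℂ).prod 𝓘(ℝ, Fin (2 * d) → ℝ)) 𝓘(ℝ, Fin (r + d) → ℂ)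
      F.triv (s, u) := by
  have : IsManifold 𝓘(ℝ, Fin r → ℂ) ∞ S := isManifold_real
  have hsplit : ∀ q : S × (Fin (2 * d) → ℝ), split r d ((split r d).symm (c q.1, q.2)) =
      (c q.1, q.2) := fun q => (split r d).apply_symm_apply _
  have hk1 : MDifferentiableAt 𝓘(ℝ, Fin r → ℂ) 𝓘(ℝ, Fin r → ℂ) c s :=
    ((contMDiffOn_chart hc).contMDiffAt (c.open_source.mem_nhds hsc)).mdifferentiableAt (by simp)
  have hk : MDifferentiableAt (𝓘(ℝ, Fin r → ℂ).prod 𝓘(ℝ, Fin (2 * d) → ℝ))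
      𝓘(ℝ, (Fin r → ℂ) × (Fin (2 * d) → ℝ))
      (fun q : S × (Fin (2 * d) → ℝ) => (c q.1, q.2)) (s, u) :=
    (MDifferentiableAt.comp (g := c) (s, u) hk1 mdifferentiableAt_fst).prodMk_space
      mdifferentiableAt_snd
  have hg : MDifferentiableAt (𝓘(ℝ, Fin r → ℂ).prod 𝓘(ℝ, Fin (2 * d) → ℝ))
      𝓘(ℝ, Fin (r + d) → ℂ)
      (fun q : S × (Fin (2 * d) → ℝ) => (split r d).symm (c q.1, q.2)) (s, u) :=
    MDifferentiableAt.comp (g := (split r d).symm) (s, u)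
      (split r d).symm.differentiableAt.mdifferentiableAt hk
  have hmem : (split r d).symm (c s, u) ∈ F.dom c := by
    change (split r d ((split r d).symm (c s, u))).1 ∈ c.target ∩ c.symm ⁻¹' F.U
    rw [hsplit (s, u)]
    exact ⟨c.map_source hsc, by rw [Set.mem_preimage, c.left_inv hsc]; exact hs⟩
  have hcomp := MDifferentiableAt.comp (g := F.param c) (s, u)
    ((F.isParam hc).mdifferentiableAt hmem) hg
  refine hcomp.congr_of_eventuallyEq ?_
  filter_upwards [(c.open_source.preimage continuous_fst).mem_nhds hsc] with q hq
  change F.triv q = F.triv (c.symm (split r d ((split r d).symm (c q.1, q.2))).1,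
    (split r d ((split r d).symm (c q.1, q.2))).2)
  rw [hsplit q, c.left_inv hq]

/-- The chain rule for `param` as `triv` after base and fibre coordinates. The base part `A` kills
vertical vectors, so the coordinates realise the splitting of the tangent space that defines the
vertical vector fields. -/
theorem exists_realD_param_eq (hc : c ∈ atlas (Fin r → ℂ) S) (hw : w ∈ F.dom c) :
    ∃ A : (Fin (r + d) → ℂ) →L[ℝ] (Fin r → ℂ), (∀ v, A (splitInr r d v) = 0) ∧
      realD (F.param c) w = (F.trivD (F.param c w)).comp (A.prod (splitSnd r d)) := by
  have : IsManifold 𝓘(ℝ, Fin r → ℂ) ∞ S := isManifold_real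
  have hs := F.base_mem hw
  obtain ⟨k, hk⟩ := F.exists_coord_eq hs (splitSnd r d w)
  let b : (Fin (r + d) → ℂ) → S := fun w => c.symm (split r d w).1
  -- With `k` fixed, `y` is smooth and equals `coord` at the point in question, where `trivD` is
  -- taken; by periodicity `triv ∘ (b, y)` is still `param` nearby.
  let y : (Fin (r + d) → ℂ) → (Fin (2 * d) → ℝ) := fun w => splitSnd r d w - fun j => (k j : ℝ)
  have hb1 : MDifferentiableAt 𝓘(ℝ, Fin r → ℂ) 𝓘(ℝ, Fin r → ℂ) c.symm (split r d w).1 :=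
    ((contMDiffOn_chart_symm hc).contMDiffAt
      (c.open_target.mem_nhds hw.1)).mdifferentiableAt (by simp)
  have hb2 : DifferentiableAt ℝ (fun w => (split r d w).1) w :=
    differentiableAt_fst.comp w (split r d).differentiableAt
  have hb : MDifferentiableAt 𝓘(ℝ, Fin (r + d) → ℂ) 𝓘(ℝ, Fin r → ℂ) b w :=
    hb1.comp w hb2.mdifferentiableAt
  have hyd : HasFDerivAt y (splitSnd r d) w := (splitSnd r d).hasFDerivAt.sub_const _
  have hy : MDifferentiableAt 𝓘(ℝ, Fin (r + d) → ℂ) 𝓘(ℝ, Fin (2 * d) → ℝ) y w :=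
    hyd.differentiableAt.mdifferentiableAt
  let A : (Fin (r + d) → ℂ) →L[ℝ] (Fin r → ℂ) :=
    mfderiv 𝓘(ℝ, Fin (r + d) → ℂ) 𝓘(ℝ, Fin r → ℂ) b w
  refine ⟨A, fun v => ?_, ?_⟩
  · have h1 := mfderiv_comp w hb1 hb2.mdifferentiableAt
    have h2 := DFunLike.congr_fun h1 (splitInr r d v)
    refine h2.trans ?_
    have h3 : mfderiv 𝓘(ℝ, Fin (r + d) → ℂ) 𝓘(ℝ, Fin r → ℂ) (fun w => (split r d w).1) w =
        (ContinuousLinearMap.fst ℝ (Fin r → ℂ) (Fin (2 * d) → ℝ)).comp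
          (split r d : (Fin (r + d) → ℂ) →L[ℝ] (Fin r → ℂ) × (Fin (2 * d) → ℝ)) := by
      rw [mfderiv_eq_fderiv]
      exact (hasFDerivAt_fst.comp w (split r d).hasFDerivAt).fderiv
    have h4 : ((ContinuousLinearMap.fst ℝ (Fin r → ℂ) (Fin (2 * d) → ℝ)).comp
          (split r d : (Fin (r + d) → ℂ) →L[ℝ] (Fin r → ℂ) × (Fin (2 * d) → ℝ)))
          (splitInr r d v) = 0 := congrArg Prod.fst (split_splitInr v)
    rw [h3]
    exact (congrArg (mfderiv 𝓘(ℝ, Fin r → ℂ) 𝓘(ℝ, Fin r → ℂ) c.symm (split r d w).1) h4).trans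
      (map_zero _)
  · have hbw : b w = base c w := rfl
    have hyw : F.coord (F.param c w) = y w := hk
    have ht : MDifferentiableAt (𝓘(ℝ, Fin r → ℂ).prod 𝓘(ℝ, Fin (2 * d) → ℝ))
        𝓘(ℝ, Fin (r + d) → ℂ) F.triv (b w, y w) :=
      F.mdifferentiableAt_triv hc hs (c.map_target hw.1) _
    have h1 := mfderiv_comp w ht (hb.prodMk hy)
    have h2 : F.triv ∘ (fun w => (b w, y w)) =ᶠ[nhds w] F.param c := by
      filter_upwards [F.isOpen_dom.mem_nhds hw] with w' hw'
      refine (F.triv_eq_iff (F.base_mem hw') _ _).2 ⟨-k, ?_⟩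
      funext j
      simp [y]
    rw [h2.mfderiv_eq] at h1
    have h3 : F.trivD (F.param c w) = (mfderiv (𝓘(ℝ, Fin r → ℂ).prod 𝓘(ℝ, Fin (2 * d) → ℝ))
        𝓘(ℝ, Fin (r + d) → ℂ) F.triv (b w, y w) :
        (Fin r → ℂ) × (Fin (2 * d) → ℝ) →L[ℝ] (Fin (r + d) → ℂ)) := by
      rw [trivD, F.proj_param hw, hyw, hbw]
    rw [h3]
    ext1 v
    refine (DFunLike.congr_fun h1 v).trans ?_
    have h4 := mfderiv_prodMk hb hy
    have h5 := DFunLike.congr_fun h4 v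
    refine (congrArg (mfderiv (𝓘(ℝ, Fin r → ℂ).prod 𝓘(ℝ, Fin (2 * d) → ℝ))
        𝓘(ℝ, Fin (r + d) → ℂ) F.triv (b w, y w)) h5).trans ?_
    have h6 : mfderiv 𝓘(ℝ, Fin (r + d) → ℂ) 𝓘(ℝ, Fin (2 * d) → ℝ) y w = splitSnd r d := by
      rw [mfderiv_eq_fderiv]
      exact hyd.fderiv
    rw [h6]
    rfl

theorem trivD_param (hc : c ∈ atlas (Fin r → ℂ) S) (hw : w ∈ F.dom c) (v : Fin (2 * d) → ℝ) :
    F.trivD (F.param c w) (0, v) = realD (F.param c) w (splitInr r d v) := by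
  obtain ⟨A, hA, h⟩ := F.exists_realD_param_eq hc hw
  rw [h, ContinuousLinearMap.comp_apply, ContinuousLinearMap.prod_apply, hA, splitSnd_splitInr]

theorem vertProj_comp_realD_param (hc : c ∈ atlas (Fin r → ℂ) S) (hw : w ∈ F.dom c) :
    (F.vertProj (F.param c w)).comp (realD (F.param c) w) = splitSnd r d := by
  obtain ⟨A, hA, h⟩ := F.exists_realD_param_eq hc hw
  have h1 := (F.isParam hc).injective w hw
  have h2 : Function.Surjective (realD (F.param c) w) :=
    LinearMap.injective_iff_surjective.1 h1
  -- Surjectivity passes to the left factor and gives bijectivity by dimension, so `inverse` in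
  -- `vertProj` is a true inverse.
  have h3 : Function.Surjective (F.trivD (F.param c w)) := by
    rw [h] at h2
    exact Function.Surjective.of_comp h2
  have h4 : Function.Injective (F.trivD (F.param c w)) :=
    (LinearMap.injective_iff_surjective_of_finrank_eq_finrank (finrank_split r d).symm).2 h3
  let e := (LinearEquiv.ofBijective (F.trivD (F.param c w)).toLinearMap
    ⟨h4, h3⟩).toContinuousLinearEquiv
  have he : F.trivD (F.param c w) =
      (e : (Fin r → ℂ) × (Fin (2 * d) → ℝ) →L[ℝ] (Fin (r + d) → ℂ)) := by
    refine ContinuousLinearMap.ext fun v => ?_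
    rfl
  rw [vertProj, h, he, ContinuousLinearMap.inverse_equiv]
  ext1 v
  simp

end PeriodFrame

end Geometry

/-! ### The polarization in real coordinates -/

section Polarized

variable {r d : ℕ} {S X : Type*} [TopologicalSpace S] [ChartedSpace (Fin r → ℂ) S]
  [TopologicalSpace X] [ChartedSpace (Fin (r + d) → ℂ) X] {𝒳 : TorusFamily r d S X}

namespace PeriodFrame

variable (F : PeriodFrame 𝒳) (pol : Polarization 𝒳)

/-- Positivity concerns nonzero elements of the Lie algebra of the fibre; injectivity transfers it
to nonzero vectors of `ℝ^{2d}`. -/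
theorem lieMap_injective [IsManifold 𝓘(ℂ, Fin r → ℂ) ω S] {s : S} (hs : s ∈ F.U) :
    Function.Injective (F.lieMap s hs) := by
  set c := chartAt (Fin r → ℂ) s
  have hc : c ∈ atlas (Fin r → ℂ) S := chart_mem_atlas _ s
  have hsc : s ∈ c.source := mem_chart_source _ s
  have hz : c s ∈ c.target ∩ c.symm ⁻¹' F.U :=
    ⟨c.map_source hsc, by rw [Set.mem_preimage, c.left_inv hsc]; exact hs⟩
  have ho : IsOpen ((c.target ∩ c.symm ⁻¹' F.U) ×ˢ (Set.univ : Set (Fin d → ℂ))) :=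
    (c.symm.isOpen_inter_preimage F.isOpen_U).prod isOpen_univ
  have h1 : MDifferentiableAt 𝓘(ℂ, (Fin r → ℂ) × (Fin d → ℂ)) 𝓘(ℂ, Fin (r + d) → ℂ)
      (F.unifFlat c) (c s, (0 : Fin d → ℂ)) :=
    ((F.contMDiffOn_unifFlat hc).contMDiffAt (ho.mem_nhds ⟨hz, trivial⟩)).mdifferentiableAt
      (by simp)
  have h2 : HasFDerivAt (𝕜 := ℂ) (fun v : Fin d → ℂ => (c s, v))
      (ContinuousLinearMap.inr ℂ (Fin r → ℂ) (Fin d → ℂ)) 0 := hasFDerivAt_prodMk_right _ _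
  have h3 := mfderiv_comp (0 : Fin d → ℂ) h1 h2.differentiableAt.mdifferentiableAt
  have h4 : F.unifFlat c ∘ (fun v : Fin d → ℂ => (c s, v)) = F.unif s := by
    funext v
    change F.unif (c.symm (c s)) v = _
    rw [c.left_inv hsc]
  rw [h4, mfderiv_eq_fderiv, h2.fderiv] at h3
  intro v v' hv
  have h5 := congrArg Subtype.val hv
  have h6 := (DFunLike.congr_fun h3 v).symm.trans (h5.trans (DFunLike.congr_fun h3 v'))
  have h7 := F.injective_mfderiv_unifFlat hc (z := (c s, (0 : Fin d → ℂ))) hz h6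
  exact congrArg Prod.snd h7

/-- The Gram matrix of the polarization in the frame of periods. -/
def gram (j k : Fin (2 * d)) : ℝ :=
  pol.form F.s₀ (F.lieMap F.s₀ F.s₀_mem (F.period j F.s₀))
    (F.lieMap F.s₀ F.s₀_mem (F.period k F.s₀))

/-- The polarization as a bilinear form on `ℝ^{2d}`. -/
def gramForm (x y : Fin (2 * d) → ℝ) : ℝ := ∑ j, ∑ k, x j * y k * F.gram pol j k

theorem lieMap_per {s : S} (hs : s ∈ F.U) (x : Fin (2 * d) → ℝ) :
    F.lieMap s hs (F.per s x) = ∑ j, x j • F.lieMap s hs (F.period j s) := by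
  rw [F.per_apply, map_sum]
  exact Finset.sum_congr rfl fun j _ => (F.lieMap s hs).map_smul_of_tower _ _

/-- The polarization pairs two period sections to an integer that is the same over all of `U`, so
its matrix at `s` is the one at `s₀`. -/
theorem form_lieMap_per {s : S} (hs : s ∈ F.U) (x y : Fin (2 * d) → ℝ) :
    pol.form s (F.lieMap s hs (F.per s x)) (F.lieMap s hs (F.per s y)) = F.gramForm pol x y := by
  rw [lieMap_per, lieMap_per]
  simp only [map_sum, LinearMap.sum_apply, map_smul, LinearMap.smul_apply, smul_eq_mul,
    Finset.mul_sum]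
  rw [Finset.sum_comm]
  refine Finset.sum_congr rfl fun j _ => Finset.sum_congr rfl fun k _ => ?_
  obtain ⟨m, hm⟩ := pol.integral F j k
  rw [gram, hm s hs, hm F.s₀ F.s₀_mem]
  ring

/-- Multiplication by `i` on `ℂ^d`. -/
def mulI (d : ℕ) : (Fin d → ℂ) →L[ℝ] (Fin d → ℂ) :=
  (Complex.I • ContinuousLinearMap.id ℂ (Fin d → ℂ)).restrictScalars ℝ

/-- The complex structure of `Lie(X_s)` transported to `ℝ^{2d}`. -/
def cpxReal (s : S) : (Fin (2 * d) → ℝ) →L[ℝ] (Fin (2 * d) → ℝ) :=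
  ((F.per s).inverse.comp (mulI d)).comp (F.per s)

/-- The inclusion of `ℝ^{2d}` in `ℂ^{2d}`. -/
def toComplex (x : Fin (2 * d) → ℝ) : Fin (2 * d) → ℂ := fun j => (x j : ℂ)

theorem toComplex_injective : Function.Injective (toComplex (d := d)) := fun x y h => by
  funext j
  exact Complex.ofReal_injective (congrFun h j)

theorem cpx_toComplex (s : S) (x : Fin (2 * d) → ℝ) :
    F.cpx s (toComplex x) = toComplex (F.cpxReal s x) := by
  have h1 : (fun k => (toComplex x k).re) = x := rfl
  have h2 : (fun k => (toComplex x k).im) = 0 := rfl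
  funext j
  rw [cpx, h1, h2, map_zero, smul_zero, map_zero, Pi.zero_apply, Complex.ofReal_zero, mul_zero,
    add_zero]
  rfl

theorem gramForm_self (x : Fin (2 * d) → ℝ) : F.gramForm pol x x = 0 := by
  rw [← F.form_lieMap_per pol F.s₀_mem, pol.alternating]

theorem gramForm_add_left (x x' y : Fin (2 * d) → ℝ) :
    F.gramForm pol (x + x') y = F.gramForm pol x y + F.gramForm pol x' y := by
  simp only [gramForm, Pi.add_apply, add_mul, Finset.sum_add_distrib]

theorem gramForm_add_right (x y y' : Fin (2 * d) → ℝ) :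
    F.gramForm pol x (y + y') = F.gramForm pol x y + F.gramForm pol x y' := by
  simp only [gramForm, Pi.add_apply, mul_add, add_mul, Finset.sum_add_distrib]

theorem gramForm_swap (x y : Fin (2 * d) → ℝ) : F.gramForm pol x y = -F.gramForm pol y x := by
  have h := F.gramForm_self pol (x + y)
  rw [gramForm_add_left, gramForm_add_right, gramForm_add_right, gramForm_self,
    gramForm_self] at h
  linarith

theorem gramForm_cpxReal_pos [IsManifold 𝓘(ℂ, Fin r → ℂ) ω S] {s : S} (hs : s ∈ F.U)
    {x : Fin (2 * d) → ℝ} (hx : x ≠ 0) : 0 < F.gramForm pol (F.cpxReal s x) x := by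
  have h1 : F.per s (F.cpxReal s x) = Complex.I • F.per s x := F.per_per_inverse hs _
  rw [← F.form_lieMap_per pol hs, h1, map_smul]
  refine pol.positive s _ fun h => hx ?_
  have h2 : F.per s x = 0 := F.lieMap_injective hs (h.trans (map_zero _).symm)
  have h3 := F.per_inverse_per hs x
  rw [h2, map_zero] at h3
  exact h3.symm

theorem pair_toComplex (x y : Fin (2 * d) → ℝ) :
    F.pair pol (toComplex x) (toComplex y) = 2 * Real.pi * Complex.I * F.gramForm pol x y := by
  simp only [pair, gramForm, toComplex, gram, Complex.ofReal_sum, Finset.mul_sum,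
    Complex.ofReal_mul]
  refine Finset.sum_congr rfl fun j _ => Finset.sum_congr rfl fun k _ => ?_
  ring

theorem pair_add_left (x x' y : Fin (2 * d) → ℂ) :
    F.pair pol (x + x') y = F.pair pol x y + F.pair pol x' y := by
  simp only [pair, Pi.add_apply, add_mul, Finset.sum_add_distrib]

theorem pair_add_right (x y y' : Fin (2 * d) → ℂ) :
    F.pair pol x (y + y') = F.pair pol x y + F.pair pol x y' := by
  simp only [pair, Pi.add_apply, mul_add, add_mul, Finset.sum_add_distrib]

theorem pair_smul_left (a : ℂ) (x y : Fin (2 * d) → ℂ) :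
    F.pair pol (a • x) y = a * F.pair pol x y := by
  simp only [pair, Pi.smul_apply, smul_eq_mul, Finset.mul_sum, mul_assoc]

theorem pair_smul_right (a : ℂ) (x y : Fin (2 * d) → ℂ) :
    F.pair pol x (a • y) = a * F.pair pol x y := by
  simp only [pair, Pi.smul_apply, smul_eq_mul, Finset.mul_sum, mul_assoc, mul_left_comm a]

/-- With `J` the complex structure, the terms `⟨x, x⟩` and `⟨Jx, Jx⟩` vanish and the cross terms
coincide, leaving `-(i/2) ⟨Jx, x⟩ = -(i/2) · 2πi E(Jx, x)`. The denominators are thus nonzero at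
every nonzero real vector, not just at lattice points, as a symbol on `ℝ^{2d} ∖ 0` requires. -/
theorem pair_hodgeA_hodgeB (s : S) (x : Fin (2 * d) → ℝ) :
    F.pair pol (F.hodgeA (toComplex x) s) (F.hodgeB (toComplex x) s) =
      Real.pi * F.gramForm pol (F.cpxReal s x) x := by
  rw [hodgeA, hodgeB, cpx_toComplex, sub_eq_add_neg, ← neg_smul]
  simp only [pair_smul_left, pair_smul_right, pair_add_left, pair_add_right, pair_toComplex,
    gramForm_self, F.gramForm_swap pol x, Complex.ofReal_zero, Complex.ofReal_neg]
  linear_combination -(Real.pi * F.gramForm pol (F.cpxReal s x) x : ℂ) * Complex.I_mul_I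

theorem pair_hodgeA_hodgeB_ne_zero [IsManifold 𝓘(ℂ, Fin r → ℂ) ω S] {s : S} (hs : s ∈ F.U)
    {x : Fin (2 * d) → ℝ} (hx : x ≠ 0) :
    F.pair pol (F.hodgeA (toComplex x) s) (F.hodgeB (toComplex x) s) ≠ 0 := by
  rw [pair_hodgeA_hodgeB]
  exact mul_ne_zero (Complex.ofReal_ne_zero.2 Real.pi_ne_zero)
    (Complex.ofReal_ne_zero.2 (F.gramForm_cpxReal_pos pol hs hx).ne')

/-! #### The dual lattice -/

/-- The linear map `x ↦ ⟨x, ·⟩ / 2πi` in coordinates. -/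
def dualMap : (Fin (2 * d) → ℝ) →ₗ[ℝ] (Fin (2 * d) → ℝ) where
  toFun x k := ∑ j, x j * F.gram pol j k
  map_add' x y := by
    funext k
    simp only [Pi.add_apply, add_mul, Finset.sum_add_distrib]
  map_smul' a x := by
    funext k
    simp only [Pi.smul_apply, smul_eq_mul, mul_assoc, Finset.mul_sum, RingHom.id_apply]

theorem gramForm_eq (x y : Fin (2 * d) → ℝ) :
    F.gramForm pol x y = ∑ k, F.dualMap pol x k * y k := by
  rw [gramForm, Finset.sum_comm]
  refine Finset.sum_congr rfl fun k _ => ?_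
  change _ = (∑ j, x j * F.gram pol j k) * y k
  rw [Finset.sum_mul]
  exact Finset.sum_congr rfl fun j _ => by ring

variable [IsManifold 𝓘(ℂ, Fin r → ℂ) ω S]

/-- A kernel vector `x` would pair to zero with `Jx`, contradicting positivity. -/
theorem dualMap_injective : Function.Injective (F.dualMap pol) := by
  rw [← LinearMap.ker_eq_bot, LinearMap.ker_eq_bot']
  intro x hx
  by_contra h
  have h1 := F.gramForm_cpxReal_pos pol F.s₀_mem h
  rw [gramForm_swap, gramForm_eq, hx] at h1
  simp at h1

/-- The vector `x ∈ ℝ^{2d}` with `⟨x, y⟩ = 2πi ∑ ξ_k y_k`. -/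
def dualVec : (Fin (2 * d) → ℝ) →L[ℝ] (Fin (2 * d) → ℝ) :=
  (LinearEquiv.ofInjectiveEndo (F.dualMap pol)
    (F.dualMap_injective pol)).symm.toLinearMap.toContinuousLinearMap

theorem dualMap_dualVec (x : Fin (2 * d) → ℝ) : F.dualMap pol (F.dualVec pol x) = x :=
  (LinearEquiv.ofInjectiveEndo (F.dualMap pol) (F.dualMap_injective pol)).apply_symm_apply x

theorem dualVec_ne_zero {x : Fin (2 * d) → ℝ} (hx : x ≠ 0) : F.dualVec pol x ≠ 0 := fun h => by
  have h1 := F.dualMap_dualVec pol x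
  rw [h, map_zero] at h1
  exact hx h1.symm

theorem pair_dualVec (x y : Fin (2 * d) → ℝ) :
    F.pair pol (toComplex (F.dualVec pol x)) (toComplex y) =
      2 * Real.pi * Complex.I * ∑ k, (x k : ℂ) * y k := by
  rw [pair_toComplex, gramForm_eq, dualMap_dualVec]
  push_cast
  rfl

theorem dualVec_mem (n : Fin (2 * d) → ℤ) :
    toComplex (F.dualVec pol (Int.castRingHom ℝ ∘ n)) ∈ F.dualLattice pol := by
  rintro _ ⟨z, rfl⟩
  refine ⟨∑ k, n k * z k, ?_⟩
  have h1 : ((Int.castAddHom ℂ).compLeft (Fin (2 * d))) z = toComplex (Int.castRingHom ℝ ∘ z) := by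
    funext k
    simp [toComplex]
  rw [h1, pair_dualVec]
  push_cast
  rfl

theorem eq_of_pair_eq {l l' : Fin (2 * d) → ℂ}
    (h : ∀ k, F.pair pol l (Pi.single k 1) = F.pair pol l' (Pi.single k 1)) : l = l' := by
  have h0 : ∀ l k, F.pair pol l (Pi.single k 1) =
      2 * Real.pi * Complex.I * ∑ j, l j * (F.gram pol j k : ℂ) := by
    intro l k
    rw [pair, Finset.mul_sum]
    refine Finset.sum_congr rfl fun j _ => ?_
    rw [Finset.sum_eq_single k]
    · rw [Pi.single_eq_same, gram]
      ring
    · intro i _ hi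
      rw [Pi.single_eq_of_ne hi, mul_zero, zero_mul]
    · exact fun h => absurd (Finset.mem_univ k) h
  have h1 : ∀ k, ∑ j, l j * (F.gram pol j k : ℂ) = ∑ j, l' j * (F.gram pol j k : ℂ) := by
    intro k
    have h2 := h k
    rw [h0, h0] at h2
    exact mul_left_cancel₀ Complex.two_pi_I_ne_zero h2
  funext j
  -- The Gram matrix is real, so real and imaginary parts can be compared separately.
  apply Complex.ext
  · refine congrFun (F.dualMap_injective pol (a₁ := fun j => (l j).re)
      (a₂ := fun j => (l' j).re) ?_) j
    funext k
    have := congrArg Complex.re (h1 k)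
    simp only [Complex.re_sum, Complex.re_mul_ofReal] at this
    exact this
  · refine congrFun (F.dualMap_injective pol (a₁ := fun j => (l j).im)
      (a₂ := fun j => (l' j).im) ?_) j
    funext k
    have := congrArg Complex.im (h1 k)
    simp only [Complex.im_sum, Complex.im_mul_ofReal] at this
    exact this

/-- The integers obtained by pairing with the standard basis determine the vector. In particular the
dual lattice consists of real vectors. -/
theorem exists_dualVec_eq {l : Fin (2 * d) → ℂ} (hl : l ∈ F.dualLattice pol) :
    ∃ n : Fin (2 * d) → ℤ, toComplex (F.dualVec pol (Int.castRingHom ℝ ∘ n)) = l := by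
  have h1 : ∀ k, (Pi.single k 1 : Fin (2 * d) → ℂ) ∈ lattice d := fun k => by
    refine ⟨Pi.single k 1, ?_⟩
    funext j
    by_cases hj : j = k
    · subst hj
      simp
    · simp [Pi.single_eq_of_ne hj]
  choose n hn using fun k => hl _ (h1 k)
  refine ⟨n, F.eq_of_pair_eq pol fun k => ?_⟩
  have h2 : (Pi.single k 1 : Fin (2 * d) → ℂ) = toComplex (Pi.single k 1) := by
    funext j
    by_cases hj : j = k
    · subst hj
      simp [toComplex]
    · simp [toComplex, Pi.single_eq_of_ne hj]
  rw [hn, h2, pair_dualVec, Finset.sum_eq_single k]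
  · simp
  · intro j _ hj
    rw [Pi.single_eq_of_ne hj, Complex.ofReal_zero, mul_zero]
  · exact fun h => absurd (Finset.mem_univ k) h

/-- The nonzero elements of the dual lattice, in coordinates. -/
def indexEquiv : {n : Fin (2 * d) → ℤ // n ≠ 0} ≃ F.Index pol :=
  Equiv.ofBijective
    (fun n => ⟨toComplex (F.dualVec pol (Int.castRingHom ℝ ∘ n.1)), F.dualVec_mem pol n.1,
      fun h => by
      refine F.dualVec_ne_zero pol (x := Int.castRingHom ℝ ∘ n.1) (fun h0 => n.2 ?_)
        (toComplex_injective h)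
      funext j
      exact Int.cast_injective (α := ℝ) ((congrFun h0 j).trans Int.cast_zero.symm)⟩)
    ⟨fun n n' h => by
      have h1 := toComplex_injective (congrArg Subtype.val h)
      have h2 := congrArg (F.dualMap pol) h1
      rw [dualMap_dualVec, dualMap_dualVec] at h2
      refine Subtype.ext (funext fun j => ?_)
      exact Int.cast_injective (α := ℝ) (congrFun h2 j),
    fun l => by
      obtain ⟨n, hn⟩ := F.exists_dualVec_eq pol l.2.1
      refine ⟨⟨n, fun h => l.2.2 ?_⟩, Subtype.ext hn⟩
      have h1 : (Int.castRingHom ℝ ∘ n : Fin (2 * d) → ℝ) = 0 := by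
        funext j
        simp [h]
      rw [← hn, h1, map_zero]
      rfl⟩

end PeriodFrame

end Polarized

theorem iterate_lieFlat_congr_on {p : ℕ} {E : Type} [NormedAddCommGroup E] [NormedSpace ℝ E]
    {O : Set E} {Z : E → E × E} {β β' : E → E [⋀^Fin p]→L[ℝ] ℂ} (hO : IsOpen O)
    (h : Set.EqOn β β' O) (k : ℕ) : Set.EqOn ((lieFlat Z)^[k] β) ((lieFlat Z)^[k] β') O := by
  induction k with
  | zero => exact h
  | succ k ih =>
    rw [Function.iterate_succ_apply', Function.iterate_succ_apply']
    exact lieFlat_congr_on hO ih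

/-! ### The terms of the polylogarithm in real coordinates -/

section Term

variable {r d : ℕ} {S X : Type*} [TopologicalSpace S] [ChartedSpace (Fin r → ℂ) S]
  [TopologicalSpace X] [ChartedSpace (Fin (r + d) → ℂ) X] {𝒳 : TorusFamily r d S X}
  [IsManifold 𝓘(ℂ, Fin r → ℂ) ω S]

namespace PeriodFrame

variable (F : PeriodFrame 𝒳) (pol : Polarization 𝒳) {c : OpenPartialHomeomorph S (Fin r → ℂ)}
  {w : Fin (r + d) → ℂ}

theorem contDiffOn_cpxReal (hc : c ∈ atlas (Fin r → ℂ) S) :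
    ContDiffOn ℝ ∞ (fun w => F.cpxReal (base c w)) (F.dom c) :=
  ((F.contDiffOn_per_inverse_base hc).clm_comp contDiffOn_const).clm_comp
    (F.contDiffOn_per_base hc)

variable (c) in
/-- The vector field of `λ^{-1,0}` in coordinates, where `λ` is dual to `ξ`. -/
def vecA (ξ : Fin (2 * d) → ℝ) (w : Fin (r + d) → ℂ) : (Fin (r + d) → ℂ) × (Fin (r + d) → ℂ) :=
  (splitInr r d ((1 / 2 : ℝ) • F.dualVec pol ξ),
    splitInr r d ((-1 / 2 : ℝ) • F.cpxReal (base c w) (F.dualVec pol ξ)))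

variable (c) in
/-- The vector field of `λ^{0,-1}` in coordinates, where `λ` is dual to `ξ`. -/
def vecB (ξ : Fin (2 * d) → ℝ) (w : Fin (r + d) → ℂ) : (Fin (r + d) → ℂ) × (Fin (r + d) → ℂ) :=
  (splitInr r d ((1 / 2 : ℝ) • F.dualVec pol ξ),
    splitInr r d ((1 / 2 : ℝ) • F.cpxReal (base c w) (F.dualVec pol ξ)))

theorem hodgeA_apply (x : Fin (2 * d) → ℝ) (s : S) (j : Fin (2 * d)) :
    F.hodgeA (toComplex x) s j =
      ((1 / 2 * x j : ℝ) : ℂ) + Complex.I * ((-1 / 2 * F.cpxReal s x j : ℝ) : ℂ) := by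
  rw [hodgeA, cpx_toComplex]
  simp only [Pi.smul_apply, Pi.sub_apply, smul_eq_mul, toComplex]
  push_cast
  ring

theorem hodgeB_apply (x : Fin (2 * d) → ℝ) (s : S) (j : Fin (2 * d)) :
    F.hodgeB (toComplex x) s j =
      ((1 / 2 * x j : ℝ) : ℂ) + Complex.I * ((1 / 2 * F.cpxReal s x j : ℝ) : ℂ) := by
  rw [hodgeB, cpx_toComplex]
  simp only [Pi.smul_apply, Pi.add_apply, smul_eq_mul, toComplex]
  push_cast
  ring

theorem vertField_param (hc : c ∈ atlas (Fin r → ℂ) S) (hw : w ∈ F.dom c)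
    {v : S → Fin (2 * d) → ℂ} {x y : Fin (2 * d) → ℝ}
    (hv : ∀ j, v (base c w) j = (x j : ℂ) + Complex.I * (y j : ℂ)) :
    F.vertField v (F.param c w) = (realD (F.param c) w (splitInr r d x),
      realD (F.param c) w (splitInr r d y)) := by
  have h1 : (fun j => (v (base c w) j).re) = x := by
    funext j
    rw [hv]
    simp
  have h2 : (fun j => (v (base c w) j).im) = y := by
    funext j
    rw [hv]
    simp
  rw [vertField, F.proj_param hw, h1, h2, F.trivD_param hc hw, F.trivD_param hc hw]

theorem vertField_hodgeA (hc : c ∈ atlas (Fin r → ℂ) S) (hw : w ∈ F.dom c)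
    (ξ : Fin (2 * d) → ℝ) :
    F.vertField (F.hodgeA (toComplex (F.dualVec pol ξ))) (F.param c w) =
      (realD (F.param c) w (F.vecA pol c ξ w).1, realD (F.param c) w (F.vecA pol c ξ w).2) :=
  F.vertField_param hc hw fun j => F.hodgeA_apply _ _ j

theorem vertField_hodgeB (hc : c ∈ atlas (Fin r → ℂ) S) (hw : w ∈ F.dom c)
    (ξ : Fin (2 * d) → ℝ) :
    F.vertField (F.hodgeB (toComplex (F.dualVec pol ξ))) (F.param c w) =
      (realD (F.param c) w (F.vecB pol c ξ w).1, realD (F.param c) w (F.vecB pol c ξ w).2) :=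
  F.vertField_param hc hw fun j => F.hodgeB_apply _ _ j

theorem contDiffOn_vecA (hc : c ∈ atlas (Fin r → ℂ) S) (ξ : Fin (2 * d) → ℝ) :
    ContDiffOn ℝ ∞ (F.vecA pol c ξ) (F.dom c) :=
  contDiffOn_const.prodMk ((splitInr r d).contDiff.comp_contDiffOn
    (((F.contDiffOn_cpxReal hc).clm_apply contDiffOn_const).const_smul (-1 / 2 : ℝ)))

/-- The form `ω` in coordinates. -/
def omegaFlat : (Fin (r + d) → ℂ) [⋀^Fin 2]→L[ℝ] ℂ :=
  (1 / 2 : ℂ) • (F.pairForm pol).compContinuousLinearMap (splitSnd r d)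

/-- The pairing is constant in the frame of periods, so `ω` has constant coefficients; only the
Hodge decomposition varies with the base point. -/
theorem pull_omega (hc : c ∈ atlas (Fin r → ℂ) S) (hw : w ∈ F.dom c) :
    pull (F.param c) (F.omega pol) w = F.omegaFlat pol := by
  rw [omegaFlat, ← F.vertProj_comp_realD_param hc hw]
  rfl

/-- The integer ambiguity of `coord` changes the exponent by a multiple of `2πi`. -/
theorem char_coord (hw : w ∈ F.dom c) (n : Fin (2 * d) → ℤ) :
    char (ContinuousLinearMap.id ℝ (Fin (2 * d) → ℝ)) n (F.coord (F.param c w)) =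
      char (splitSnd r d) n w := by
  obtain ⟨k, hk⟩ := F.exists_coord_eq (F.base_mem hw) (splitSnd r d w)
  have h : F.coord (F.param c w) = splitSnd r d w - fun j => (k j : ℝ) := hk
  rw [char, char, charArg_apply, charArg_apply, Complex.exp_eq_exp_iff_exists_int]
  refine ⟨-∑ j, n j * k j, ?_⟩
  simp only [h, ContinuousLinearMap.id_apply, Pi.sub_apply, Complex.ofReal_sub, mul_sub,
    Finset.sum_sub_distrib, Complex.ofReal_intCast, Int.cast_neg, Int.cast_sum, Int.cast_mul]
  ring

theorem chi_dualVec (n : Fin (2 * d) → ℤ) (x : X) :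
    F.chi pol (toComplex (F.dualVec pol (Int.castRingHom ℝ ∘ n))) x =
      char (ContinuousLinearMap.id ℝ (Fin (2 * d) → ℝ)) n (F.coord x) := by
  rw [chi, char, charArg_apply]
  refine congrArg Complex.exp ((F.pair_dualVec pol _ (F.coord x)).trans ?_)
  simp only [Function.comp_apply, eq_intCast, Complex.ofReal_intCast]
  rfl

/-- The `k`-th summand of the form part of a term. -/
def termForm (l : Fin (2 * d) → ℂ) (k : ℕ) : DForm (r + d) (2 * d - 1 - 1) X := fun x =>
  contract (F.vertField (F.hodgeA l) x) (contract (F.vertField (F.hodgeB l) x)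
    ((lieD (F.vertField (F.hodgeA l)))^[k] (fun y => wedgePow (F.omega pol y) d) x))

variable (c) in
/-- The `k`-th summand of the form part of a term, in coordinates. -/
def formFlat (k : ℕ) (ξ : Fin (2 * d) → ℝ) (w : Fin (r + d) → ℂ) :
    (Fin (r + d) → ℂ) [⋀^Fin (2 * d - 1 - 1)]→L[ℝ] ℂ :=
  contract (F.vecA pol c ξ w) (contract (F.vecB pol c ξ w)
    ((lieFlat (F.vecA pol c ξ))^[k] (fun _ => wedgePow (F.omegaFlat pol) d) w))

variable [IsManifold 𝓘(ℂ, Fin (r + d) → ℂ) ω X]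

theorem pull_termForm (hc : c ∈ atlas (Fin r → ℂ) S) (hw : w ∈ F.dom c)
    (ξ : Fin (2 * d) → ℝ) (k : ℕ) :
    pull (F.param c) (F.termForm pol (toComplex (F.dualVec pol ξ)) k) w =
      F.formFlat pol c k ξ w := by
  have : IsManifold 𝓘(ℝ, Fin (r + d) → ℂ) ∞ X := isManifold_real
  have h1 : Set.EqOn (pull (F.param c) fun y => wedgePow (F.omega pol y) d)
      (fun _ => wedgePow (F.omegaFlat pol) d) (F.dom c) := fun w hw => by
    rw [pull_wedgePow, F.pull_omega pol hc hw]
  have h2 : ContDiffOn ℝ ∞ (pull (F.param c) fun y => wedgePow (F.omega pol y) d) (F.dom c) :=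
    contDiffOn_const.congr h1
  have h3 := (pull_iterate_lieD (F.isParam hc) (fun w hw => F.vertField_hodgeA pol hc hw ξ)
    (F.contDiffOn_vecA pol hc ξ) h2 k).2 hw
  rw [iterate_lieFlat_congr_on F.isOpen_dom h1 k hw] at h3
  refine (pull_contract (F.vertField_hodgeA pol hc hw ξ) _).trans
    (congrArg (contract (F.vecA pol c ξ w)) ?_)
  exact (pull_contract (F.vertField_hodgeB pol hc hw ξ) _).trans
    (congrArg (contract (F.vecB pol c ξ w)) h3)

/-- The numerical coefficient of the `k`-th summand of a term. -/
def termCoeff (a b k : ℕ) : ℂ :=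
  (-1) ^ d * ((a + b + k - 1).factorial : ℂ) /
    ((a + b - 1).factorial * k.factorial * d.factorial * F.kappa pol)

variable (c) in
/-- The `k`-th summand of a term without its character, in coordinates. -/
def symbolTerm (a b : ℕ) (m : Fin (2 * d) →₀ ℕ) (k : ℕ) (ξ : Fin (2 * d) → ℝ)
    (w : Fin (r + d) → ℂ) : (Fin (r + d) → ℂ) [⋀^Fin (2 * d - 1 - 1)]→L[ℝ] ℂ :=
  let A := F.hodgeA (toComplex (F.dualVec pol ξ)) (base c w)
  let B := F.hodgeB (toComplex (F.dualVec pol ξ)) (base c w)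
  ((symOne B ^ (a - 1) * symOne A ^ (b - 1)).coeff m *
    (F.termCoeff pol a b k * (F.pair pol A B ^ (a + b + k))⁻¹)) • F.formFlat pol c k ξ w

variable (c) in
/-- A term without its character, in coordinates. -/
def symbol (a b : ℕ) (m : Fin (2 * d) →₀ ℕ) (n : Fin (2 * d) → ℤ) (w : Fin (r + d) → ℂ) :
    (Fin (r + d) → ℂ) [⋀^Fin (2 * d - 1 - 1)]→L[ℝ] ℂ :=
  ∑ k ∈ Finset.range (2 * d + 1), F.symbolTerm pol c a b m k (Int.castRingHom ℝ ∘ n) w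

/-- In coordinates a term is a character along the fibre times a symbol, the shape treated by the
oscillatory and regularised sums above. -/
theorem pull_term (hc : c ∈ atlas (Fin r → ℂ) S) (hw : w ∈ F.dom c) (a b : ℕ)
    (m : Fin (2 * d) →₀ ℕ) (n : Fin (2 * d) → ℤ) :
    pull (F.param c) (F.term pol a b m (toComplex (F.dualVec pol (Int.castRingHom ℝ ∘ n)))) w =
      char (splitSnd r d) n w • F.symbol pol c a b m n w := by
  set l := toComplex (F.dualVec pol (Int.castRingHom ℝ ∘ n)) with hl
  have h1 : F.term pol a b m l = fun x => (F.chi pol l x *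
      (symOne (F.hodgeB l (𝒳.proj x)) ^ (a - 1) *
        symOne (F.hodgeA l (𝒳.proj x)) ^ (b - 1)).coeff m) •
      ∑ k ∈ Finset.range (2 * d + 1), (F.termCoeff pol a b k /
        F.pair pol (F.hodgeA l (𝒳.proj x)) (F.hodgeB l (𝒳.proj x)) ^ (a + b + k)) •
          F.termForm pol l k x := rfl
  rw [h1, pull_smul, pull_sum, symbol, mul_smul, F.chi_dualVec, F.char_coord hw, Finset.smul_sum]
  refine congrArg _ (Finset.sum_congr rfl fun k _ => ?_)
  rw [pull_smul, F.pull_termForm pol hc hw, F.proj_param hw, symbolTerm, smul_smul, div_eq_mul_inv]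

/-! #### Homogeneity -/

theorem homogOn_dualVec (hc : c ∈ atlas (Fin r → ℂ) S) : HomogOn (F.dom c) 1
    fun ξ w => (F.dualVec pol ξ, F.cpxReal (base c w) (F.dualVec pol ξ)) := by
  have h1 : HomogOn (F.dom c) 1 fun ξ (_ : Fin (r + d) → ℂ) => F.dualVec pol ξ :=
    homogOn_linear contDiffOn_const
  have h2 : HomogOn (F.dom c) 1 fun ξ w => F.cpxReal (base c w) (F.dualVec pol ξ) :=
    homogOn_linear (L := fun w => (F.cpxReal (base c w)).comp (F.dualVec pol))
      ((F.contDiffOn_cpxReal hc).clm_comp contDiffOn_const)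
  exact h1.prodMk h2

theorem homogOn_dualVec_map (hc : c ∈ atlas (Fin r → ℂ) S) {G : Type} [NormedAddCommGroup G]
    [NormedSpace ℝ G] (L L' : (Fin (2 * d) → ℝ) →L[ℝ] G) : HomogOn (F.dom c) 1
      fun ξ w => L (F.dualVec pol ξ) + L' (F.cpxReal (base c w) (F.dualVec pol ξ)) :=
  (F.homogOn_dualVec pol hc).map (L.coprod L')

theorem homogOn_vecA (hc : c ∈ atlas (Fin r → ℂ) S) :
    HomogOn (F.dom c) 1 (F.vecA pol c) := by
  refine HomogOn.congr (((F.homogOn_dualVec pol hc).map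
    (((1 / 2 : ℝ) • splitInr r d).prodMap ((-1 / 2 : ℝ) • splitInr r d)))) fun ξ _ w _ => ?_
  simp only [vecA, map_smul]
  rfl

theorem homogOn_vecB (hc : c ∈ atlas (Fin r → ℂ) S) :
    HomogOn (F.dom c) 1 (F.vecB pol c) := by
  refine HomogOn.congr (((F.homogOn_dualVec pol hc).map
    (((1 / 2 : ℝ) • splitInr r d).prodMap ((1 / 2 : ℝ) • splitInr r d)))) fun ξ _ w _ => ?_
  simp only [vecB, map_smul]
  rfl

theorem homogOn_hodge (hc : c ∈ atlas (Fin r → ℂ) S) (j : Fin (2 * d)) (t : ℝ) :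
    HomogOn (F.dom c) 1 fun ξ w => ((1 / 2 * F.dualVec pol ξ j : ℝ) : ℂ) +
      Complex.I * ((t * F.cpxReal (base c w) (F.dualVec pol ξ) j : ℝ) : ℂ) := by
  let P : (Fin (2 * d) → ℝ) →L[ℝ] ℂ := Complex.ofRealCLM.comp (ContinuousLinearMap.proj j)
  refine HomogOn.congr (F.homogOn_dualVec_map pol hc ((1 / 2 : ℂ) • P)
    ((Complex.I * (t : ℂ)) • P)) fun ξ _ w _ => ?_
  simp only [P, smul_apply, ContinuousLinearMap.comp_apply, ContinuousLinearMap.proj_apply,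
    Complex.ofRealCLM_apply, smul_eq_mul]
  push_cast
  ring

theorem homogOn_hodgeA (hc : c ∈ atlas (Fin r → ℂ) S) (j : Fin (2 * d)) :
    HomogOn (F.dom c) 1 fun ξ w => F.hodgeA (toComplex (F.dualVec pol ξ)) (base c w) j := by
  simp only [hodgeA_apply]
  exact F.homogOn_hodge pol hc j (-1 / 2)

theorem homogOn_hodgeB (hc : c ∈ atlas (Fin r → ℂ) S) (j : Fin (2 * d)) :
    HomogOn (F.dom c) 1 fun ξ w => F.hodgeB (toComplex (F.dualVec pol ξ)) (base c w) j := by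
  simp only [hodgeB_apply]
  exact F.homogOn_hodge pol hc j (1 / 2)

theorem homogCoeffOn_symOne {O : Set (Fin (r + d) → ℂ)} {e : ℤ}
    {v : (Fin (2 * d) → ℝ) → (Fin (r + d) → ℂ) → Fin (2 * d) → ℂ}
    (hv : ∀ j, HomogOn O e fun ξ w => v ξ w j) :
    HomogCoeffOn O e fun ξ w => symOne (v ξ w) := by
  intro μ
  simp only [symOne, MvPolynomial.coeff_sum, MvPolynomial.coeff_C_mul]
  refine HomogOn.sum _ fun j _ => ?_
  have := (hv j).mul (homogOn_const (m := 2 * d) (O := O) (contDiffOn_const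
    (c := (MvPolynomial.X j : MvPolynomial (Fin (2 * d)) ℂ).coeff μ)))
  rwa [add_zero] at this

theorem homogOn_pair (hc : c ∈ atlas (Fin r → ℂ) S) : HomogOn (F.dom c) 2 fun ξ w =>
    F.pair pol (F.hodgeA (toComplex (F.dualVec pol ξ)) (base c w))
      (F.hodgeB (toComplex (F.dualVec pol ξ)) (base c w)) := by
  simp only [pair]
  refine HomogOn.sum _ fun j _ => HomogOn.sum _ fun k _ => ?_
  have := ((F.homogOn_hodgeA pol hc j).mul (F.homogOn_hodgeB pol hc k)).mul
    (homogOn_const (m := 2 * d) (O := F.dom c) (contDiffOn_const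
      (c := (2 * Real.pi * Complex.I * (F.gram pol j k : ℝ) : ℂ))))
  rw [add_zero, one_add_one_eq_two] at this
  exact this

/-- One degree for each of the `k` Lie derivatives and for each of the two contractions, all of
which are linear in `ξ`; the form `ω^d` has degree `0`. -/
theorem homogOn_formFlat (hc : c ∈ atlas (Fin r → ℂ) S) (k : ℕ) :
    HomogOn (F.dom c) (k + 2) (F.formFlat pol c k) := by
  have h1 := HomogOn.iterate_lieFlat (F.homogOn_vecA pol hc)
    (homogOn_const (m := 2 * d) (O := F.dom c)
      (contDiffOn_const (c := wedgePow (F.omegaFlat pol) d))) F.isOpen_dom k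
  have h2 := (F.homogOn_vecA pol hc).contract ((F.homogOn_vecB pol hc).contract h1)
  rw [show (1 + (1 + k * 1) : ℤ) = k + 2 by ring] at h2
  exact h2

/-- The degrees add up to `(a-1) + (b-1) + (k+2) - 2(a+b+k) = -(a+b+k)`. The hypotheses on `a` and
`b` make the truncated subtractions genuine. -/
theorem isHomog_symbolTerm (hc : c ∈ atlas (Fin r → ℂ) S) {a b : ℕ} (ha : 1 ≤ a) (hb : 1 ≤ b)
    (m : Fin (2 * d) →₀ ℕ) (k : ℕ) :
    IsHomog (F.dom c) (a + b + k) (F.symbolTerm pol c a b m k) := by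
  have h1 := ((homogCoeffOn_symOne (F.homogOn_hodgeB pol hc)).pow (a - 1)).mul
    ((homogCoeffOn_symOne (F.homogOn_hodgeA pol hc)).pow (b - 1)) m
  have h2 := (F.homogOn_pair pol hc).inv_pow (fun ξ hξ w hw =>
    F.pair_hodgeA_hodgeB_ne_zero pol (F.base_mem hw) (F.dualVec_ne_zero pol hξ)) (a + b + k)
  have h3 := (h1.mul ((homogOn_const (m := 2 * d) (O := F.dom c) (contDiffOn_const
    (c := F.termCoeff pol a b k))).mul h2)).smul (F.homogOn_formFlat pol hc k)
  refine HomogOn.isHomog ?_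
  rw [show ((a - 1 : ℕ) * 1 + (b - 1 : ℕ) * 1 + (0 + -((a + b + k : ℕ) * 2)) + (k + 2) : ℤ) =
    -(a + b + k : ℕ) by push_cast [Nat.cast_sub ha, Nat.cast_sub hb]; ring] at h3
  exact h3

/-- At `ξ = 0` the denominator is a positive power of `0`, and its inverse is `0` by convention:
exactly the normalisation at the origin demanded of symbols. -/
theorem symbolTerm_zero {a b : ℕ} (ha : 1 ≤ a) (m : Fin (2 * d) →₀ ℕ) (k : ℕ)
    (w : Fin (r + d) → ℂ) : F.symbolTerm pol c a b m k 0 w = 0 := by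
  have h : F.pair pol (F.hodgeA (toComplex (F.dualVec pol 0)) (base c w))
      (F.hodgeB (toComplex (F.dualVec pol 0)) (base c w)) = 0 := by
    rw [pair_hodgeA_hodgeB, map_zero, map_zero, gramForm_self, Complex.ofReal_zero, mul_zero]
  rw [symbolTerm, h, zero_pow (by omega), inv_zero, mul_zero, mul_zero]
  exact zero_smul ℂ (F.formFlat pol c k 0 w)

theorem symbol_zero {a b : ℕ} (ha : 1 ≤ a) (m : Fin (2 * d) →₀ ℕ) (w : Fin (r + d) → ℂ) :
    F.symbol pol c a b m 0 w = 0 := by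
  have h : (Int.castRingHom ℝ ∘ (0 : Fin (2 * d) → ℤ)) = 0 := by
    funext j
    simp
  rw [symbol, h]
  exact Finset.sum_eq_zero fun k _ => F.symbolTerm_zero pol ha m k w

theorem isSymbol_symbol (hc : c ∈ atlas (Fin r → ℂ) S) {a b : ℕ} (ha : 1 ≤ a) (hb : 1 ≤ b)
    (m : Fin (2 * d) →₀ ℕ) : IsSymbol (F.dom c) (F.symbol pol c a b m) := by
  have h1 := IsSymbol.sum F.isOpen_dom (Finset.range (2 * d + 1)) fun k _ =>
    (F.isHomog_symbolTerm pol hc ha hb m k).isSymbol F.isOpen_dom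
      fun w => F.symbolTerm_zero pol ha m k w
  have h3 : F.symbol pol c a b m = ∑ k ∈ Finset.range (2 * d + 1), fun n : Fin (2 * d) → ℤ =>
      F.symbolTerm pol c a b m k (Int.castRingHom ℝ ∘ n) := by
    funext n w
    rw [Finset.sum_apply, Finset.sum_apply]
    rfl
  rw [h3]
  exact h1

end PeriodFrame

end Term

/-! ### The polylogarithm -/

section Main

universe u

variable {r d : ℕ} {S : Type*} {X : Type u} [TopologicalSpace S] [ChartedSpace (Fin r → ℂ) S]
  [TopologicalSpace X] [ChartedSpace (Fin (r + d) → ℂ) X] {𝒳 : TorusFamily r d S X}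
  [IsManifold 𝓘(ℂ, Fin r → ℂ) ω S]

namespace PeriodFrame

variable (F : PeriodFrame 𝒳) (pol : Polarization 𝒳) {c : OpenPartialHomeomorph S (Fin r → ℂ)}
  {w : Fin (r + d) → ℂ}

/-- The element of the dual lattice with coordinates `n`. -/
def dualInt (n : Fin (2 * d) → ℤ) : Fin (2 * d) → ℂ :=
  toComplex (F.dualVec pol (Int.castRingHom ℝ ∘ n))

/-- The sum of the terms of `g_{a,b}` off the zero section, regularised by summation by parts. -/
def polylogForm (N a b : ℕ) (m : Fin (2 * d) →₀ ℕ) : DForm (r + d) (2 * d - 1 - 1) X := fun x =>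
  regSum (ContinuousLinearMap.id ℝ (Fin (2 * d) → ℝ)) N
    (fun n _ => (F.chi pol (F.dualInt pol n) x)⁻¹ • F.term pol a b m (F.dualInt pol n) x)
    (F.coord x)

theorem charWeight_coord (hw : w ∈ F.dom c) :
    charWeight (ContinuousLinearMap.id ℝ (Fin (2 * d) → ℝ)) (F.coord (F.param c w)) =
      charWeight (splitSnd r d) w := by
  simp only [charWeight, F.char_coord hw]

theorem param_mem_range_zero_iff (hw : w ∈ F.dom c) :
    F.param c w ∈ Set.range 𝒳.zero ↔ charWeight (splitSnd r d) w = 0 := by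
  rw [charWeight_eq_zero_iff]
  refine (F.triv_mem_range_zero_iff (F.base_mem hw) _).trans (exists_congr fun k => ?_)
  exact funext_iff

theorem dom_inter_preimage : F.dom c ∩ F.param c ⁻¹' (𝒳.proj ⁻¹' F.U \ Set.range 𝒳.zero) =
    F.dom c ∩ {w | charWeight (splitSnd r d) w ≠ 0} := by
  ext w
  refine and_congr_right fun hw => ?_
  rw [Set.mem_preimage, Set.mem_sdiff, F.param_mem_range_zero_iff hw, Set.mem_ofPred_eq]
  refine and_iff_right ?_
  rw [Set.mem_preimage, F.proj_param hw]
  exact F.base_mem hw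

variable [IsManifold 𝓘(ℂ, Fin (r + d) → ℂ) ω X]

/-- Dividing a term by its character recovers the symbol pointwise, so the regularised form is
defined on `X` without choosing a base chart. On each parametrisation it becomes the regularised sum
of the symbol. -/
theorem pull_polylogForm (hc : c ∈ atlas (Fin r → ℂ) S) (hw : w ∈ F.dom c) (N a b : ℕ)
    (m : Fin (2 * d) →₀ ℕ) : pull (F.param c) (F.polylogForm pol N a b m) w =
      regSum (splitSnd r d) N (F.symbol pol c a b m) w := by
  set x := F.param c w with hx
  let e : (Fin (r + d) → ℂ) ≃L[ℝ] (Fin (r + d) → ℂ) :=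
    (LinearEquiv.ofInjectiveEndo (realD (F.param c) w : (Fin (r + d) → ℂ) →ₗ[ℝ] _)
      ((F.isParam hc).injective w hw)).toContinuousLinearEquiv
  -- At a fixed point, pulling back is a continuous linear isomorphism of the spaces of forms, so it
  -- commutes with the infinite sum with no summability to check.
  let φ : ((Fin (r + d) → ℂ) [⋀^Fin (2 * d - 1 - 1)]→L[ℝ] ℂ) ≃L[ℝ]
      ((Fin (r + d) → ℂ) [⋀^Fin (2 * d - 1 - 1)]→L[ℝ] ℂ) :=
    e.symm.continuousAlternatingMapCongrLeft
  have hφ : ∀ α : DForm (r + d) (2 * d - 1 - 1) X, pull (F.param c) α w = φ (α x) := fun α => rfl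
  have hφs : ∀ (t : ℂ) α, φ (t • α) = t • φ α := fun t α => rfl
  have hg : ∀ n, φ ((F.chi pol (F.dualInt pol n) x)⁻¹ • F.term pol a b m (F.dualInt pol n) x) =
      F.symbol pol c a b m n w := by
    intro n
    rw [hφs, ← hφ, dualInt, F.pull_term pol hc hw, hx, F.chi_dualVec, F.char_coord hw, smul_smul,
      inv_mul_cancel₀ (show char (splitSnd r d) n w ≠ 0 from Complex.exp_ne_zero _), one_smul]
  rw [hφ, polylogForm, regSum, regSum, hφs, F.charWeight_coord hw, φ.map_tsum]
  refine congrArg _ (tsum_congr fun n => ?_)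
  rw [hφs, F.char_coord hw, iterate_lap_apply, iterate_lap_apply]
  refine congrArg _ ?_
  rw [← funext hg]
  exact (congrFun (map_iterate_lap (AddMonoidHomClass.toAddMonoidHom φ)
    (fun n => (F.chi pol (F.dualInt pol n) x)⁻¹ • F.term pol a b m (F.dualInt pol n) x) N) n).symm

theorem contDiffOn_pull_term (hc : c ∈ atlas (Fin r → ℂ) S) {a b : ℕ} (ha : 1 ≤ a) (hb : 1 ≤ b)
    (m : Fin (2 * d) →₀ ℕ) (n : Fin (2 * d) → ℤ) :
    ContDiffOn ℝ ∞ (pull (F.param c) (F.term pol a b m (F.dualInt pol n))) (F.dom c) :=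
  ((contDiff_char (splitSnd r d) n).contDiffOn.smul
    (((F.isSymbol_symbol pol hc ha hb m) 0).1 n)).congr
      fun _ hw => F.pull_term pol hc hw a b m n

theorem contDiffOn_pull_polylogForm (hc : c ∈ atlas (Fin r → ℂ) S) {a b N : ℕ} (ha : 1 ≤ a)
    (hb : 1 ≤ b) (hN : 2 * d + 1 ≤ 2 * N) (m : Fin (2 * d) →₀ ℕ) :
    ContDiffOn ℝ ∞ (pull (F.param c) (F.polylogForm pol N a b m))
      (F.dom c ∩ F.param c ⁻¹' (𝒳.proj ⁻¹' F.U \ Set.range 𝒳.zero)) := by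
  rw [F.dom_inter_preimage]
  exact ((F.isSymbol_symbol pol hc ha hb m).contDiffOn_regSum (splitSnd r d) F.isOpen_dom hN).congr
    fun _ hw => F.pull_polylogForm pol hc hw.1 N a b m

variable [T2Space S] [T2Space X] [SigmaCompactSpace X]

theorem isOpen_preimage_proj : IsOpen (𝒳.proj ⁻¹' F.U) :=
  F.isOpen_U.preimage 𝒳.proj_holo.continuous

/-- The image of a continuous section of a Hausdorff space is closed, being the coincidence set of
`zero ∘ proj` and the identity. -/
theorem isOpen_compl_zero : IsOpen (𝒳.proj ⁻¹' F.U \ Set.range 𝒳.zero) := by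
  refine F.isOpen_preimage_proj.sdiff ?_
  have h : Set.range 𝒳.zero = {x | 𝒳.zero (𝒳.proj x) = x} := by
    ext x
    refine ⟨?_, fun hx => ⟨_, hx⟩⟩
    rintro ⟨s, rfl⟩
    exact congrArg 𝒳.zero (𝒳.proj_zero s)
  rw [h]
  exact isClosed_eq (𝒳.zero_holo.continuous.comp 𝒳.proj_holo.continuous) continuous_id

theorem exists_formCurrent_kernels {W : Set X} (hW : IsOpen W) (hWU : W ⊆ 𝒳.proj ⁻¹' F.U) {p : ℕ}
    (hp : p ≤ 2 * (r + d)) {η : DForm (r + d) (2 * (r + d) - p) X} (hη : IsTestForm W η) :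
    ∃ (J : Type u) (_ : Fintype J) (c : J → OpenPartialHomeomorph S (Fin r → ℂ))
      (Θ : J → (Fin (r + d) → ℂ) → ((Fin (r + d) → ℂ) [⋀^Fin p]→L[ℝ] ℂ) →L[ℝ] ℂ),
      (∀ j, c j ∈ atlas (Fin r → ℂ) S) ∧
      (∀ j, IsTestKernel (F.dom (c j) ∩ F.param (c j) ⁻¹' W) (Θ j)) ∧
      ∀ α : DForm (r + d) p X, SmoothFormOn α W →
        formCurrent hp α η = ∑ j, ∫ w, Θ j w (pull (F.param (c j)) α w) := by
  obtain ⟨J, hJ, i, Θ, hΘ, h⟩ := exists_formCurrent_eq (κ := S)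
    (Ψ := fun s => F.param (chartAt (Fin r → ℂ) s))
    (O := fun s => F.dom (chartAt (Fin r → ℂ) s)) hW
    (fun s => F.isParam (chart_mem_atlas _ s)) (fun _ hx => ⟨_, F.exists_param_eq (hWU hx)⟩) hp hη
  exact ⟨J, hJ, fun j => chartAt _ (i j), Θ, fun j => chart_mem_atlas _ _, hΘ, h⟩

theorem smoothFormOn_of_pull_param {W : Set X} (hW : IsOpen W) (hWU : W ⊆ 𝒳.proj ⁻¹' F.U) {p : ℕ}
    {α : DForm (r + d) p X} (hα : ∀ c ∈ atlas (Fin r → ℂ) S,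
      ContDiffOn ℝ ∞ (pull (F.param c) α) (F.dom c ∩ F.param c ⁻¹' W)) : SmoothFormOn α W :=
  have : IsManifold 𝓘(ℝ, Fin (r + d) → ℂ) ∞ X := isManifold_real
  smoothFormOn_of_pull (κ := S) (Ψ := fun s => F.param (chartAt (Fin r → ℂ) s))
    (O := fun s => F.dom (chartAt (Fin r → ℂ) s)) hW
    (fun s => F.isParam (chart_mem_atlas _ s)) (fun _ hx => ⟨_, F.exists_param_eq (hWU hx)⟩)
    fun s => hα _ (chart_mem_atlas _ s)

theorem formCurrent_term_eq {W : Set X} (hW : IsOpen W) (hWU : W ⊆ 𝒳.proj ⁻¹' F.U)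
    {η : DForm (r + d) (2 * (r + d) - (2 * d - 1 - 1)) X}
    {J : Type*} [Fintype J] {c : J → OpenPartialHomeomorph S (Fin r → ℂ)}
    {Θ : J → (Fin (r + d) → ℂ) → ((Fin (r + d) → ℂ) [⋀^Fin (2 * d - 1 - 1)]→L[ℝ] ℂ) →L[ℝ] ℂ}
    (hc : ∀ j, c j ∈ atlas (Fin r → ℂ) S)
    (hΘ : ∀ j, IsTestKernel (F.dom (c j) ∩ F.param (c j) ⁻¹' W) (Θ j))
    (h : ∀ α : DForm (r + d) (2 * d - 1 - 1) X, SmoothFormOn α W →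
        formCurrent (by omega) α η = ∑ j, ∫ w, Θ j w (pull (F.param (c j)) α w))
    {a b : ℕ} (ha : 1 ≤ a) (hb : 1 ≤ b) (m : Fin (2 * d) →₀ ℕ) (n : Fin (2 * d) → ℤ) :
    F.termCurrent pol a b m (F.dualInt pol n) η =
      ∑ j, ∫ w, Θ j w (char (splitSnd r d) n w • F.symbol pol (c j) a b m n w) := by
  refine (h _ (F.smoothFormOn_of_pull_param hW hWU fun c hc =>
    (F.contDiffOn_pull_term pol hc ha hb m n).mono Set.inter_subset_left)).trans ?_
  refine Finset.sum_congr rfl fun j _ => integral_congr_ae (Filter.Eventually.of_forall fun w => ?_)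
  by_cases hw : w ∈ tsupport (Θ j)
  · exact congrArg _ (F.pull_term pol (hc j) ((hΘ j).subset hw).1 a b m n)
  · simp only [image_eq_zero_of_notMem_tsupport hw, zero_apply]

theorem splitSnd_single (j : Fin (2 * d)) :
    splitSnd r d (splitInr r d (Pi.single j 1)) = Pi.single j 1 := splitSnd_splitInr _

/-- The terms of `g_{a,b}` are summable on every test form. -/
theorem summable_termCurrent {η : DForm (r + d) (2 * (r + d) - (2 * d - 1 - 1)) X}
    (hη : IsTestForm (𝒳.proj ⁻¹' F.U) η) {a b : ℕ} (ha : 1 ≤ a) (hb : 1 ≤ b)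
    (m : Fin (2 * d) →₀ ℕ) :
    Summable fun l : F.Index pol => F.termCurrent pol a b m l η := by
  obtain ⟨J, _, c, Θ, hc, hΘ, h⟩ :=
    F.exists_formCurrent_kernels F.isOpen_preimage_proj subset_rfl (by omega) hη
  have h1 : Summable fun n => F.termCurrent pol a b m (F.dualInt pol n) η := by
    rw [funext (F.formCurrent_term_eq pol F.isOpen_preimage_proj subset_rfl hc hΘ h ha hb m)]
    refine summable_sum fun j _ => ?_
    exact summable_integral_char_smul (splitSnd r d) splitSnd_single F.isOpen_dom
      (F.isSymbol_symbol pol (hc j) ha hb m).decayFamily (hΘ j).smooth (hΘ j).compact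
      ((hΘ j).subset.trans Set.inter_subset_left) (hΘ j).linear
  rw [← (F.indexEquiv pol).summable_iff]
  -- Summability was obtained over all of `ℤ^{2d}`; the nonzero vectors form a subfamily.
  exact h1.comp_injective Subtype.val_injective

/-- The sum of the terms of `g_{a,b}` on a test form supported off the zero section. -/
theorem tsum_termCurrent {η : DForm (r + d) (2 * (r + d) - (2 * d - 1 - 1)) X}
    {J : Type*} [Fintype J] {c : J → OpenPartialHomeomorph S (Fin r → ℂ)}
    {Θ : J → (Fin (r + d) → ℂ) → ((Fin (r + d) → ℂ) [⋀^Fin (2 * d - 1 - 1)]→L[ℝ] ℂ) →L[ℝ] ℂ}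
    (hc : ∀ j, c j ∈ atlas (Fin r → ℂ) S)
    (hΘ : ∀ j, IsTestKernel (F.dom (c j) ∩
      F.param (c j) ⁻¹' (𝒳.proj ⁻¹' F.U \ Set.range 𝒳.zero)) (Θ j))
    (h : ∀ α : DForm (r + d) (2 * d - 1 - 1) X,
      SmoothFormOn α (𝒳.proj ⁻¹' F.U \ Set.range 𝒳.zero) →
        formCurrent (by omega) α η = ∑ j, ∫ w, Θ j w (pull (F.param (c j)) α w))
    {a b N : ℕ} (ha : 1 ≤ a) (hb : 1 ≤ b) (hN : 2 * d + 1 ≤ 2 * N) (m : Fin (2 * d) →₀ ℕ) :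
    ∑' l : F.Index pol, F.termCurrent pol a b m l η =
      ∑ j, ∫ w, Θ j w (pull (F.param (c j)) (F.polylogForm pol N a b m) w) := by
  have h1 := F.formCurrent_term_eq pol F.isOpen_compl_zero Set.sdiff_subset hc hΘ h ha hb m
  -- The term of index `0` vanishes by `symbol_zero`, so the sum extends to the whole lattice, where
  -- the translations of summation by parts make sense.
  have h2 : ∑' l : F.Index pol, F.termCurrent pol a b m l η =
      ∑' n, F.termCurrent pol a b m (F.dualInt pol n) η := by
    rw [← (F.indexEquiv pol).tsum_eq]
    refine tsum_subtype_eq_of_support_subset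
      (f := fun n => F.termCurrent pol a b m (F.dualInt pol n) η) (s := {n | n ≠ 0}) ?_
    rintro n hn rfl
    refine hn ((h1 0).trans (Finset.sum_eq_zero fun j _ => ?_))
    refine (integral_congr_ae (Filter.Eventually.of_forall fun w => ?_)).trans (integral_zero _ _)
    change Θ j w (char (splitSnd r d) 0 w • F.symbol pol (c j) a b m 0 w) = 0
    rw [(hΘ j).linear, F.symbol_zero pol ha, map_zero, mul_zero]
  rw [h2, tsum_congr h1, Summable.tsum_finsetSum]
  · refine Finset.sum_congr rfl fun j _ => ?_
    have hs := (hΘ j).subset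
    rw [F.dom_inter_preimage] at hs
    refine ((F.isSymbol_symbol pol (hc j) ha hb m).tsum_integral_eq (splitSnd r d)
      splitSnd_single F.isOpen_dom (hΘ j).smooth (hΘ j).compact hs (hΘ j).linear hN).trans ?_
    refine integral_congr_ae (Filter.Eventually.of_forall fun w => ?_)
    by_cases hw : w ∈ tsupport (Θ j)
    · exact congrArg _ (F.pull_polylogForm pol (hc j) ((hΘ j).subset hw).1 N a b m).symm
    · simp only [image_eq_zero_of_notMem_tsupport hw, zero_apply]
  · intro j _
    exact summable_integral_char_smul (splitSnd r d) splitSnd_single F.isOpen_dom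
      (F.isSymbol_symbol pol (hc j) ha hb m).decayFamily (hΘ j).smooth (hΘ j).compact
      ((hΘ j).subset.trans Set.inter_subset_left) (hΘ j).linear

/-- The polylogarithmic current is smooth off the zero section. -/
theorem isSmoothCurrentOn_polylogCurrent (m : Fin (2 * d) →₀ ℕ) :
    IsSmoothCurrentOn (by omega) (F.polylogCurrent pol m)
      (𝒳.proj ⁻¹' F.U \ Set.range 𝒳.zero) := by
  -- With `d + 1` Laplacians the coefficients decay to order `2d + 2`, which exceeds the rank `2d`,
  -- so the regularised series converges absolutely.
  have hN : 2 * d + 1 ≤ 2 * (d + 1) := by omega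
  let γ : ℕ × ℕ → DForm (r + d) (2 * d - 1 - 1) X := fun p =>
    F.polylogForm pol (d + 1) (p.1 + 1) (p.2 + 1) m
  let ε : ℕ × ℕ → ℂ := fun p => (-1) ^ (p.1 + 1)
  let s := Finset.HasAntidiagonal.antidiagonal m.degree
  have hγ : ∀ p, ∀ c ∈ atlas (Fin r → ℂ) S, ContDiffOn ℝ ∞ (pull (F.param c) (γ p))
      (F.dom c ∩ F.param c ⁻¹' (𝒳.proj ⁻¹' F.U \ Set.range 𝒳.zero)) := fun p c hc =>
    F.contDiffOn_pull_polylogForm pol hc (by omega) (by omega) hN m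
  have hpull : ∀ c w, pull (F.param c) (fun x => ∑ p ∈ s, ε p • γ p x) w =
      ∑ p ∈ s, ε p • pull (F.param c) (γ p) w := fun c w => pull_sum s fun p x => ε p • γ p x
  have hsmooth : SmoothFormOn (fun x => ∑ p ∈ s, ε p • γ p x)
      (𝒳.proj ⁻¹' F.U \ Set.range 𝒳.zero) :=
    F.smoothFormOn_of_pull_param F.isOpen_compl_zero Set.sdiff_subset fun c hc =>
      (ContDiffOn.sum fun p _ => (hγ p c hc).const_smul (ε p)).congr fun w _ => hpull c w
  refine ⟨fun x => ∑ p ∈ s, ε p • γ p x, hsmooth, fun η hη => ?_⟩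
  -- One choice of kernels, depending only on `η`, is used for all pairs `(a, b)`, for each term and
  -- for the regularised sums.
  obtain ⟨J, _, c, Θ, hc, hΘ, h⟩ :=
    F.exists_formCurrent_kernels F.isOpen_compl_zero Set.sdiff_subset (by omega) hη
  have hint : ∀ j p, Integrable fun w => Θ j w (pull (F.param (c j)) (γ p) w) := fun j p =>
    (hΘ j).integrable_apply ((F.isParam (hc j)).isOpen_inter_preimage F.isOpen_compl_zero)
      (hγ p _ (hc j)).continuousOn
  rw [h _ hsmooth, polylogCurrent]
  simp only [hpull, map_sum, (hΘ _).linear]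
  calc ∑ p ∈ s, ε p * ∑' l : F.Index pol, F.termCurrent pol (p.1 + 1) (p.2 + 1) m l η
      = ∑ p ∈ s, ε p * ∑ j, ∫ w, Θ j w (pull (F.param (c j)) (γ p) w) :=
        Finset.sum_congr rfl fun p _ => congrArg _
          (F.tsum_termCurrent pol hc hΘ h (by omega) (by omega) hN m)
    _ = ∑ j, ∑ p ∈ s, ε p * ∫ w, Θ j w (pull (F.param (c j)) (γ p) w) := by
        simp only [Finset.mul_sum]
        exact Finset.sum_comm
    _ = _ := by
        refine Finset.sum_congr rfl fun j _ => ?_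
        rw [integral_finsetSum _ fun p _ => (hint j p).const_mul (ε p)]
        exact Finset.sum_congr rfl fun p _ => (integral_const_mul _ _).symm

end PeriodFrame

end Main

end Polylog

theorem propositionA2p1 {r d : ℕ} {S X : Type*}
    [TopologicalSpace S] [ChartedSpace (Fin r → ℂ) S]
    [IsManifold 𝓘(ℂ, Fin r → ℂ) ω S] [T2Space S]
    [TopologicalSpace X] [ChartedSpace (Fin (r + d) → ℂ) X]
    [IsManifold 𝓘(ℂ, Fin (r + d) → ℂ) ω X] [T2Space X] [SigmaCompactSpace X]
    (𝒳 : Polylog.TorusFamily r d S X) (pol : Polylog.Polarization 𝒳)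
    (F : Polylog.PeriodFrame 𝒳) (m : Fin (2 * d) →₀ ℕ) :
    (∀ a b : ℕ, 1 ≤ a → 1 ≤ b → ∀ η, Polylog.IsTestForm (𝒳.proj ⁻¹' F.U) η →
      Summable fun l : F.Index pol => F.termCurrent pol a b m l η) ∧
    Polylog.IsSmoothCurrentOn (by omega) (F.polylogCurrent pol m)
      (𝒳.proj ⁻¹' F.U \ Set.range 𝒳.zero) :=
  ⟨fun _ _ ha hb _ hη => F.summable_termCurrent pol hη ha hb m,
    F.isSmoothCurrentOn_polylogCurrent pol m⟩
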